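/- Let $M\ge 5$, let $\mathbb P^M$ be complex projective space and let $\mathcal F=\mathbb P(H^0(\mathbb P^M,\mathcal O_{\mathbb P^M}(M)))$ be the space parametrizing hypersurfaces of degree $M$ in $\mathbb P^M$. Let $\mathcal F_{\rm reg}\subset\mathcal F$ be the set of hypersurfaces $V$ satisfying the following two conditions. (1) At every smooth point $x\in V$ the following holds: if $(X_0:\ldots:X_M)$ are homogeneous coordinates on $\mathbb P^M$ with $x=(1:0:\ldots:0)$ and $q_1+\cdots+q_M$ is the equation of $V\cap\{X_0\neq 0\}$ in the affine coordinates $X_1,\ldots,X_M$ (on the chart $X_0=1$), where $q_i$ is homogeneous of degree $i$, then $q_1,\ldots,q_{M-1}$ is a regular sequence in $\mathbb C[X_1,\ldots,X_M]$. (2) Through every singular point of $V$ there are only finitely many lines contained in $V$. (Smooth and singular points are understood with respect to the equation of $V$: a point of $V$ is singular if all first partial derivatives of the equation vanish there.) Then the Zariski closure $\overline{\mathcal F\setminus\mathcal F_{\rm reg}}$ of the complement of $\mathcal F_{\rm reg}$ has codimension at least $\frac{M(M-5)}{2}+4$ in $\mathcal F$. -/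

import Mathlib

open MvPolynomial
open scoped LinearAlgebra.Projectivization

namespace Hypersurfaces

/-- The parameter space of hypersurfaces of degree `M` in complex projective `M`-space: the
projectivization of the space of homogeneous polynomials of degree `M` in `X₀, …, X_M`. -/
def ParamSpace (M : ℕ) : Type :=
  ℙ ℂ (homogeneousSubmodule (Fin (M + 1)) ℂ M)

/-- A (nonzero) equation of the hypersurface `V`; it is unique up to a nonzero scalar. -/
noncomputable def ParamSpace.equation {M : ℕ} (V : ParamSpace M) : MvPolynomial (Fin (M + 1)) ℂ :=
  ((Projectivization.rep V : homogeneousSubmodule (Fin (M + 1)) ℂ M) :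
    MvPolynomial (Fin (M + 1)) ℂ)

/-! ### The Zariski topology on the parameter space -/

/-- Exponents of the monomials of degree `M` in `M + 1` variables; they index the homogeneous
coordinates on the parameter space. -/
abbrev Exponent (M : ℕ) : Type := {d : Fin (M + 1) →₀ ℕ // d.degree = M}

/-- The homogeneous coordinates (coefficients of an equation) of a point of the parameter space. -/
noncomputable def ParamSpace.coords {M : ℕ} (V : ParamSpace M) : Exponent M → ℂ :=
  fun d => coeff d.1 V.equation

/-- The common zeros of a set of polynomials in the homogeneous coordinates. It is used for sets of
homogeneous polynomials only, for which it does not depend on the choice of the equations. -/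
def zeroLocus {M : ℕ} (S : Set (MvPolynomial (Exponent M) ℂ)) : Set (ParamSpace M) :=
  {V | ∀ G ∈ S, eval V.coords G = 0}

/-- Zariski closed sets: common zero loci of sets of homogeneous polynomials. -/
def IsZariskiClosed {M : ℕ} (Z : Set (ParamSpace M)) : Prop :=
  ∃ S : Set (MvPolynomial (Exponent M) ℂ),
    (∀ G ∈ S, ∃ n : ℕ, G.IsHomogeneous n) ∧ Z = zeroLocus S

theorem isZariskiClosed_empty {M : ℕ} : IsZariskiClosed (∅ : Set (ParamSpace M)) := by
  refine ⟨{1}, ?_, ?_⟩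
  · rintro G rfl
    exact ⟨0, isHomogeneous_one _ _⟩
  · ext V
    simp [zeroLocus]

theorem isZariskiClosed_sInter {M : ℕ} (A : Set (Set (ParamSpace M)))
    (hA : ∀ Z ∈ A, IsZariskiClosed Z) : IsZariskiClosed (⋂₀ A) := by
  choose! S hS hZ using hA
  refine ⟨⋃ Z ∈ A, S Z, ?_, ?_⟩
  · intro G hG
    simp only [Set.mem_iUnion] at hG
    obtain ⟨Z, hZA, hG⟩ := hG
    exact hS Z hZA G hG
  · ext V
    simp only [Set.mem_sInter, zeroLocus, Set.mem_iUnion, Set.mem_ofPred_eq]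
    constructor
    · rintro h G ⟨Z, hZA, hG⟩
      have := h Z hZA
      rw [hZ Z hZA] at this
      exact this G hG
    · intro h Z hZA
      rw [hZ Z hZA]
      intro G hG
      exact h G ⟨Z, hZA, hG⟩

theorem isZariskiClosed_union {M : ℕ} (Z : Set (ParamSpace M)) (hZ : IsZariskiClosed Z)
    (W : Set (ParamSpace M)) (hW : IsZariskiClosed W) : IsZariskiClosed (Z ∪ W) := by
  obtain ⟨S, hS, rfl⟩ := hZ
  obtain ⟨T, hT, rfl⟩ := hW
  refine ⟨{G | ∃ P ∈ S, ∃ Q ∈ T, G = P * Q}, ?_, ?_⟩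
  · rintro G ⟨P, hP, Q, hQ, rfl⟩
    obtain ⟨m, hm⟩ := hS P hP
    obtain ⟨n, hn⟩ := hT Q hQ
    exact ⟨m + n, hm.mul hn⟩
  · ext V
    constructor
    · rintro (h | h) G ⟨P, hP, Q, hQ, rfl⟩
      · rw [map_mul, h P hP, zero_mul]
      · rw [map_mul, h Q hQ, mul_zero]
    · intro h
      by_contra hV
      rw [Set.mem_union, not_or] at hV
      simp only [zeroLocus, Set.mem_ofPred_eq, not_forall] at hV
      obtain ⟨⟨P, hP, hP0⟩, ⟨Q, hQ, hQ0⟩⟩ := hV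
      have := h (P * Q) ⟨P, hP, Q, hQ, rfl⟩
      rw [map_mul] at this
      exact (mul_ne_zero hP0 hQ0) this

/-- The Zariski topology on the parameter space. -/
instance instTopologicalSpaceParamSpace (M : ℕ) : TopologicalSpace (ParamSpace M) :=
  TopologicalSpace.ofClosed {Z | IsZariskiClosed Z} isZariskiClosed_empty
    isZariskiClosed_sInter isZariskiClosed_union

/-- The subset `Z` of `X` has codimension at least `c`: `dim Z + c ≤ dim X`, where `dim` is the
Krull dimension of a topological space (the empty set has dimension `⊥`). It is used for closed
subsets of the parameter space, an irreducible space of finite dimension. -/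
def CodimAtLeast {X : Type*} [TopologicalSpace X] (Z : Set X) (c : ℕ) : Prop :=
  topologicalKrullDim Z + (c : WithBot ℕ∞) ≤ topologicalKrullDim X

/-! ### The regularity conditions

Points of projective `M`-space are elements of `ℙ ℂ (Fin (M + 1) → ℂ)`. -/

/-- `x` lies on the hypersurface `f = 0`. -/
def IsPoint {M : ℕ} (f : MvPolynomial (Fin (M + 1)) ℂ) (x : ℙ ℂ (Fin (M + 1) → ℂ)) : Prop :=
  eval x.rep f = 0

/-- `x` is a singular point of the hypersurface `f = 0`. -/
def IsSingularPoint {M : ℕ} (f : MvPolynomial (Fin (M + 1)) ℂ) (x : ℙ ℂ (Fin (M + 1) → ℂ)) :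
    Prop :=
  IsPoint f x ∧ ∀ j, eval x.rep (pderiv j f) = 0

/-- `x` is a smooth point of the hypersurface `f = 0`. -/
def IsSmoothPoint {M : ℕ} (f : MvPolynomial (Fin (M + 1)) ℂ) (x : ℙ ℂ (Fin (M + 1) → ℂ)) :
    Prop :=
  IsPoint f x ∧ ∃ j, eval x.rep (pderiv j f) ≠ 0

/-- A basis `b₀, …, b_M` of `ℂ^(M+1)` gives homogeneous coordinates `(X₀ : … : X_M)`, those of the
point `∑ X_k b_k`. This is the equation of the hypersurface `f = 0` in these coordinates on the
chart `X₀ = 1`, whose origin is the point `(1 : 0 : … : 0)`, that is, the class of `b₀`.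
The variable `X k` stands for the coordinate `X_{k+1}`. -/
noncomputable def localEquation {M : ℕ} (b : Module.Basis (Fin (M + 1)) ℂ (Fin (M + 1) → ℂ))
    (f : MvPolynomial (Fin (M + 1)) ℂ) : MvPolynomial (Fin M) ℂ :=
  aeval (fun j : Fin (M + 1) => C (b 0 j) + ∑ k : Fin M, C (b k.succ j) * X k) f

/-- The homogeneous part `q_i` of degree `i` of the local equation. -/
noncomputable def localPart {M : ℕ} (b : Module.Basis (Fin (M + 1)) ℂ (Fin (M + 1) → ℂ))
    (f : MvPolynomial (Fin (M + 1)) ℂ) (i : ℕ) : MvPolynomial (Fin M) ℂ :=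
  homogeneousComponent i (localEquation b f)

/-- The regularity condition at a smooth point `x`: in homogeneous coordinates with
`x = (1 : 0 : … : 0)`, the homogeneous parts `q_1, …, q_{M-1}` of the local equation form a
regular sequence in the polynomial ring in `M` variables. -/
def RegularAt {M : ℕ} (f : MvPolynomial (Fin (M + 1)) ℂ) (x : ℙ ℂ (Fin (M + 1) → ℂ)) : Prop :=
  ∀ b : Module.Basis (Fin (M + 1)) ℂ (Fin (M + 1) → ℂ),
    Projectivization.mk ℂ (b 0) (b.ne_zero 0) = x →
      RingTheory.Sequence.IsRegular (MvPolynomial (Fin M) ℂ)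
        ((List.range (M - 1)).map fun i => localPart b f (i + 1))

/-- The lines through `x` contained in the hypersurface `f = 0`; a line in projective `M`-space is a
two-dimensional linear subspace of `ℂ^(M+1)`. -/
def linesThrough {M : ℕ} (f : MvPolynomial (Fin (M + 1)) ℂ) (x : ℙ ℂ (Fin (M + 1) → ℂ)) :
    Set (Submodule ℂ (Fin (M + 1) → ℂ)) :=
  {L | Module.finrank ℂ L = 2 ∧ x.submodule ≤ L ∧ ∀ v ∈ L, eval v f = 0}

/-- The set of regular hypersurfaces: (1) the regularity condition holds at every smooth point, and
(2) through every singular point there are only finitely many lines on the hypersurface. -/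
def regularLocus (M : ℕ) : Set (ParamSpace M) :=
  {V | (∀ x, IsSmoothPoint V.equation x → RegularAt V.equation x) ∧
    (∀ x, IsSingularPoint V.equation x → (linesThrough V.equation x).Finite)}

end Hypersurfaces

namespace Hypersurfaces

/-! ### A numerical estimate -/

/-! Idea of the proof. Centre coordinates at a point where a hypersurface is bad. Then infinitely
many directions are common zeros of the homogeneous parts of degrees `1, …, M - 1` (smooth point) or
`1, …, M` (singular point, where the linear part is zero). At a singular point this is the infinity
of lines. At a smooth point it is Cohen–Macaulayness: if some linear form together with `q_1, …,
q_{M-1}` vanished only at the origin, these `M` forms would be a system of parameters at the origin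
of affine `M`-space, hence a regular sequence (`isRegular_of_forall_eq_zero`). So every hyperplane
contains a nonzero common zero, and there are infinitely many directions
(`infinite_of_forall_dual`).

The dimension of the bad locus is counted by transcendence degrees at a generic member. Bad
equations form finitely many families, each made of translates of forms bad at a coordinate point.
For a prime containing the equations of one family, `exists_generic_form` produces algebraically
closed fields `F ⊆ K`, a form with coefficients `u` in `F`, and a zero `y` of its parts having a
coordinate 1 and another coordinate outside `F`. The dimension of the prime is at most `M`
(translations) plus the transcendence degree of `u`.

To bound the latter, let `b + 1` be the dimension over `F` of the span of the coordinates of `y`.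
The equations of this span involve at most `(b + 1) (M - (b + 1))` parameters, as for a
Grassmannian. Now adjoin the coefficients degree by degree. When those of degree `j` are adjoined,
either the transcendence degree `t j` of `y` over the coefficients drops, or it stays; in the second
case linear disjointness (`linearIndependent_of_algebraicIndependent`) shows that the relation "the
part of degree `j` vanishes at `y`" costs the dimension of the `j`-th power of the span of `y`. That
dimension is at least `b * j + 1` by a linear Cauchy–Davenport inequality, and at least `(t j +
j).choose j` by counting monomials in a transcendence basis. Drops are rare because `t 2 ≤ b` and `t
j ≥ 1` throughout. The combinatorial minimum is `codim_le_sum_cost`; it contains a term that pays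
for the parameters of the span, and is attained for `b = 1`.

Finally, chains of irreducible closed sets become chains of prime cone ideals, which the irrelevant
ideal lengthens by one (`length_add_codim_lt`), while a flag of coordinate subspaces bounds the
dimension of the parameter space from below. -/

theorem two_mul_sum_Ico_affine (b j m : ℕ) (h : j ≤ m) :
    2 * ∑ i ∈ Finset.Ico j m, ((b : ℤ) * i + 1) = ((m : ℤ) - j) * (b * (m + j - 1) + 2) := by
  induction m, h using Nat.le_induction with
  | base => simp
  | succ m hm ih =>
    rw [Finset.sum_Ico_succ_top hm, mul_add, ih]
    push_cast
    ring

/-- Since `t` stays positive, at most `t j - 1` of the steps from `j` on can be drops, so at least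
`D + 1 - t j - j` of them pay. The affine price grows with the index, so the cheapest scenario pays
first and drops last. The induction runs backwards from `D`. -/
theorem sum_Ico_affine_le_cost (b D : ℕ) (t c : ℕ → ℕ)
    (ht : ∀ j, 2 ≤ j → j ≤ D → 1 ≤ t j)
    (hstep : ∀ j, 2 ≤ j → j < D → t (j + 1) + 1 ≤ t j ∨
      (t (j + 1) ≤ t j ∧ b * j + 1 ≤ c j)) (k : ℕ) :
    ∀ j, 2 ≤ j → j + k = D →
      ∑ i ∈ Finset.Ico j (D + 1 - t j), (b * i + 1) ≤ ∑ i ∈ Finset.Ico j D, c i := by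
  induction k with
  | zero =>
    intro j hj hD
    have := ht j hj (by omega)
    rw [Finset.Ico_eq_empty (by omega)]
    simp
  | succ k ih =>
    intro j hj hD
    have h1 := ih (j + 1) (by omega) (by omega)
    have h2 := ht j hj (by omega)
    rw [Finset.sum_eq_sum_Ico_succ_bot (by omega : j < D)]
    rcases hstep j hj (by omega) with h | ⟨h, hc⟩
    -- A drop at `j` moves all payments one index to the right, where they are dearer.
    · calc ∑ i ∈ Finset.Ico j (D + 1 - t j), (b * i + 1)
          ≤ ∑ i ∈ Finset.Ico j (D + 1 - t j), (b * (i + 1) + 1) :=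
            Finset.sum_le_sum fun i _ => by gcongr; omega
        _ = ∑ i ∈ Finset.Ico (j + 1) (D + 1 - t j + 1), (b * i + 1) := by
            rw [← Finset.sum_Ico_add' (fun i => b * i + 1)]
        _ ≤ ∑ i ∈ Finset.Ico (j + 1) (D + 1 - t (j + 1)), (b * i + 1) := by
            apply Finset.sum_le_sum_of_subset
            intro i hi
            rw [Finset.mem_Ico] at hi ⊢
            omega
        _ ≤ _ := h1.trans (Nat.le_add_left _ _)
    · by_cases hlt : j < D + 1 - t j
      · rw [Finset.sum_eq_sum_Ico_succ_bot hlt]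
        have : ∑ i ∈ Finset.Ico (j + 1) (D + 1 - t j), (b * i + 1) ≤
            ∑ i ∈ Finset.Ico (j + 1) (D + 1 - t (j + 1)), (b * i + 1) := by
          apply Finset.sum_le_sum_of_subset
          exact Finset.Ico_subset_Ico le_rfl (by omega)
        omega
      · rw [Finset.Ico_eq_empty (by omega)]
        simp

/-- While every step is a drop, `t j + j` never exceeds its initial bound `b + 2`; at `j = D` this
contradicts `1 ≤ t D`. -/
theorem exists_first_stay (b D : ℕ) (hbD : b + 2 ≤ D) (t : ℕ → ℕ) (P : ℕ → Prop)
    (ht : ∀ j, 2 ≤ j → j ≤ D → 1 ≤ t j) (ht2 : t 2 ≤ b)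
    (hstep : ∀ j, 2 ≤ j → j < D → t (j + 1) + 1 ≤ t j ∨ P j) :
    ∃ j, 2 ≤ j ∧ j < D ∧ t j + j ≤ b + 2 ∧ P j := by
  by_contra hcon
  push Not at hcon
  have key : ∀ j, 2 ≤ j → j ≤ D → t j + j ≤ b + 2 := by
    intro j hj
    induction j, hj using Nat.le_induction with
    | base => intro _; omega
    | succ j hj ih =>
      intro hjD
      have h1 := ih (by omega)
      rcases hstep j hj (by omega) with h | h
      · omega
      · exact absurd h (hcon j hj (by omega) h1)
  have := key D (by omega) le_rfl
  have := ht D (by omega) le_rfl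
  omega

/-- The right side is smallest at `j = b + 1`. There, with `D = b + 2 + m` and `b = 1 + e`, the
difference of the two sides is a polynomial in `m` and `e` with nonnegative coefficients, which
vanishes for `e = 0`. -/
theorem codim_estimate_of_one (b j D : ℤ) (hb : 1 ≤ b) (hj : j ≤ b + 1) (hj2 : 2 ≤ j)
    (hbD : b + 2 ≤ D) :
    D ^ 2 - 3 * D + 6 + 2 * (b + 1) * (D - 2 - b) ≤ (D - j) * (b * (D + j - 1) + 2) := by
  have h1 : (D - (b + 1)) * (b * (D + (b + 1) - 1) + 2) ≤ (D - j) * (b * (D + j - 1) + 2) := by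
    have : (D - j) * (b * (D + j - 1) + 2) - (D - (b + 1)) * (b * (D + (b + 1) - 1) + 2) =
      (b + 1 - j) * (b * (b + j) + 2) := by ring
    have : 0 ≤ (b + 1 - j) * (b * (b + j) + 2) := by
      apply mul_nonneg (by linarith); positivity
    linarith
  refine le_trans ?_ h1
  obtain ⟨m, rfl⟩ : ∃ m, D = b + 2 + m := ⟨D - b - 2, by ring⟩
  have hm : 0 ≤ m := by linarith
  obtain ⟨e, rfl⟩ : ∃ e, b = 1 + e := ⟨b - 1, by ring⟩
  have he : 0 ≤ e := by linarith
  have : 0 ≤ m * m * e + e * e * m + e * m + e * e * e := by positivity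
  nlinarith [mul_nonneg hm he, mul_nonneg he he, mul_nonneg (mul_nonneg he he) hm,
    mul_nonneg (mul_nonneg hm he) hm]

theorem codim_estimate_of_two_le (b A D : ℤ) (hb : 1 ≤ b) (hA : A ≤ b + 2) (hA4 : 4 ≤ A)
    (hbD : b + 2 ≤ D) :
    D ^ 2 - 3 * D + 6 + 2 * (b + 1) * (D - 2 - b) ≤
      A * (A - 1) + (D - A) * (b * (D - A + 5) + 2) := by
  obtain ⟨m, rfl⟩ : ∃ m, D = b + 2 + m := ⟨D - b - 2, by ring⟩
  have hm : 0 ≤ m := by linarith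
  obtain ⟨e, rfl⟩ : ∃ e, A = b + 2 - e := ⟨b + 2 - A, by ring⟩
  have he : 0 ≤ e := by linarith
  obtain ⟨f, rfl⟩ : ∃ f, b = 1 + f := ⟨b - 1, by ring⟩
  have hf : 0 ≤ f := by linarith
  have h1 := mul_nonneg hm he
  have h2 := mul_nonneg hm hf
  have h3 := mul_nonneg he hf
  nlinarith [mul_nonneg h1 hf, mul_nonneg h2 hm, mul_nonneg h3 he, mul_nonneg he he]

theorem choose_le_choose_of_le_half {n r s : ℕ} (hrs : r ≤ s) (hs : s ≤ n / 2) :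
    n.choose r ≤ n.choose s := by
  induction s, hrs using Nat.le_induction with
  | base => exact le_rfl
  | succ s _ ih =>
    exact (ih (by omega)).trans (Nat.choose_le_succ_of_lt_half_left (by omega))

/-- The numerical core of the dimension count: `t j` is the dimension before step `j`, each step
either lowers it or has cost at least `c j`. -/
theorem codim_le_sum_cost (b D : ℕ) (hb : 1 ≤ b) (hbD : b + 2 ≤ D) (t c : ℕ → ℕ)
    (ht : ∀ j, 2 ≤ j → j ≤ D → 1 ≤ t j) (ht2 : t 2 ≤ b)
    (hstep : ∀ j, 2 ≤ j → j < D → t (j + 1) + 1 ≤ t j ∨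
      (t (j + 1) ≤ t j ∧ b * j + 1 ≤ c j ∧ (t j + j).choose j ≤ c j)) :
    (D : ℤ) ^ 2 - 3 * D + 6 + 2 * (b + 1) * (D - 2 - b) ≤
      2 * ∑ j ∈ Finset.Ico 2 D, (c j : ℤ) := by
  obtain ⟨j, hj2, hjD, hjb, hst, hcj, hcc⟩ := exists_first_stay b D hbD t _ ht ht2 hstep
  have hstep' : ∀ j, 2 ≤ j → j < D → t (j + 1) + 1 ≤ t j ∨
      (t (j + 1) ≤ t j ∧ b * j + 1 ≤ c j) := fun j h2 hD => by
    rcases hstep j h2 hD with h | h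
    · exact .inl h
    · exact .inr ⟨h.1, h.2.1⟩
  have hphi := sum_Ico_affine_le_cost b D t c ht hstep'
  have htj := ht j hj2 hjD.le
  have hsub : ∑ i ∈ Finset.Ico j D, (c i : ℤ) ≤ ∑ i ∈ Finset.Ico 2 D, (c i : ℤ) :=
    Finset.sum_le_sum_of_subset_of_nonneg (Finset.Ico_subset_Ico hj2 le_rfl)
      fun _ _ _ => by positivity
  rcases Nat.lt_or_ge 1 (t j) with h1 | h1
  · -- the first stationary step has a large cost
    have hp := hphi (D - (j + 1)) (j + 1) (by omega) (by omega)
    have hle : ∑ i ∈ Finset.Ico (j + 1) (D + 1 - t j), (b * i + 1) ≤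
        ∑ i ∈ Finset.Ico (j + 1) D, c i :=
      le_trans (Finset.sum_le_sum_of_subset
        (Finset.Ico_subset_Ico le_rfl (by omega))) hp
    -- Lowering all indices by `j - 2` leaves a bound that depends on `t j` and `j` only through
    -- their sum.
    have hshift : ∑ i ∈ Finset.Ico 3 (D + 3 - (t j + j)), (b * i + 1) ≤
        ∑ i ∈ Finset.Ico (j + 1) (D + 1 - t j), (b * i + 1) := by
      have e1 : D + 1 - t j = (D + 3 - (t j + j)) + (j - 2) := by omega
      have e2 : j + 1 = 3 + (j - 2) := by omega
      rw [e1, e2, ← Finset.sum_Ico_add' (fun i => b * i + 1)]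
      exact Finset.sum_le_sum fun i _ => by gcongr; omega
    -- Both `t j` and `j` are at least 2, so by symmetry the lower index may be brought into the
    -- increasing half of the row.
    have hchoose : (t j + j).choose 2 ≤ (t j + j).choose j := by
      rw [← Nat.choose_symm (by omega : j ≤ t j + j), Nat.add_sub_cancel]
      rcases le_total (t j) j with h | h
      · exact choose_le_choose_of_le_half h1 (by omega)
      · rw [← Nat.choose_symm (by omega : t j ≤ t j + j), Nat.add_sub_cancel_left]
        exact choose_le_choose_of_le_half hj2 (by omega)
    have hch2 : 2 * ((t j + j).choose 2 : ℤ) = (t j + j : ℤ) * (t j + j - 1) := by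
      have := Nat.choose_two_right (t j + j)
      have hev : 2 ∣ (t j + j) * (t j + j - 1) := (Nat.even_mul_pred_self _).two_dvd
      have h3 : 2 * (t j + j).choose 2 = (t j + j) * (t j + j - 1) := by
        rw [this, Nat.mul_div_cancel' hev]
      have h4 : ((t j + j - 1 : ℕ) : ℤ) = t j + j - 1 := by
        rw [Nat.cast_sub (by omega)]; push_cast; ring
      rw [← h4]
      exact_mod_cast h3
    have hG := two_mul_sum_Ico_affine b 3 (D + 3 - (t j + j)) (by omega)
    have hcast : ((D + 3 - (t j + j) : ℕ) : ℤ) = D + 3 - (t j + j) := by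
      rw [Nat.cast_sub (by omega)]; push_cast; ring
    rw [hcast] at hG
    have hest := codim_estimate_of_two_le b (t j + j) D (by exact_mod_cast hb)
      (by exact_mod_cast hjb) (by exact_mod_cast (by omega : 4 ≤ t j + j)) (by exact_mod_cast hbD)
    have hsplit := Finset.sum_eq_sum_Ico_succ_bot hjD c
    have hfin : (t j + j).choose 2 + ∑ i ∈ Finset.Ico 3 (D + 3 - (t j + j)), (b * i + 1) ≤
        ∑ i ∈ Finset.Ico j D, c i := by omega
    have hfin' : ((t j + j).choose 2 : ℤ) +
        ∑ i ∈ Finset.Ico 3 (D + 3 - (t j + j)), ((b : ℤ) * i + 1) ≤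
        ∑ i ∈ Finset.Ico j D, (c i : ℤ) := by exact_mod_cast hfin
    push_cast at hG
    have hGe : ((D : ℤ) + 3 - (t j + j) - 3) * (b * (D + 3 - (t j + j) + 3 - 1) + 2) =
      (D - (t j + j)) * (b * (D - (t j + j) + 5) + 2) := by ring
    rw [hGe] at hG
    linarith
  -- No drop is possible any more: every step from `j` on pays.
  · have h1' : t j = 1 := by omega
    have hp := hphi (D - j) j hj2 (by omega)
    rw [h1', Nat.add_sub_cancel] at hp
    have hG := two_mul_sum_Ico_affine b j D hjD.le
    have hest := codim_estimate_of_one b j D (by exact_mod_cast hb)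
      (by exact_mod_cast (by omega : j ≤ b + 1)) (by exact_mod_cast hj2) (by exact_mod_cast hbD)
    have hp' : ∑ i ∈ Finset.Ico j D, ((b : ℤ) * i + 1) ≤ ∑ i ∈ Finset.Ico j D, (c i : ℤ) := by
      exact_mod_cast hp
    linarith

/-! ### Regular sequences in local rings -/

section LocalAlgebra

open IsLocalRing RingTheory.Sequence CategoryTheory Abelian Limits Pointwise

universe u

variable {A : Type u} [CommRing A] [IsLocalRing A] [IsNoetherianRing A]

/-- Let `U` be the nonzero submodule killed by `P`. If `U` were inside `x N`, regularity of `x`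
would give `U = x U`, contradicting Nakayama. So some element of `U` survives in `N / x N`; it is
killed by `P` and by `x`, and an associated prime above its annihilator works. -/
theorem exists_associatedPrime_quotSMulTop {N : Type u} [AddCommGroup N] [Module A N]
    [Module.Finite A N] {x : A} (hx : x ∈ maximalIdeal A) (hreg : IsSMulRegular N x)
    {P : Ideal A} (hP : IsAssociatedPrime P N) :
    ∃ Q : Ideal A, IsAssociatedPrime Q (QuotSMulTop x N) ∧ P ≤ Q ∧ x ∈ Q := by
  obtain ⟨hPp, n, hn⟩ := (isAssociatedPrime_iff).1 hP
  let U : Submodule A N := Submodule.torsionBySet A N P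
  have hU : ∀ v : N, v ∈ U ↔ ∀ p ∈ P, p • v = 0 := fun v => by
    simp [U, Submodule.mem_torsionBySet_iff]
  have hnU : n ∈ U := by
    rw [hU]
    intro p hp
    rw [hn, Submodule.mem_colon_singleton] at hp
    simpa using hp
  have hn0 : n ≠ 0 := by
    rintro rfl
    exact hPp.ne_top (by rw [hn]; simp)
  have hne : U ≠ ⊥ := fun h => hn0 (by simpa [h] using hnU)
  have hnot : ¬ U ≤ x • (⊤ : Submodule A N) := by
    intro hle
    apply hne
    refine Submodule.eq_bot_of_le_smul_of_le_jacobson_bot (maximalIdeal A) U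
      (IsNoetherian.noetherian U) ?_ (maximalIdeal_le_jacobson _)
    intro v hv
    obtain ⟨w, -, rfl⟩ := (Submodule.mem_smul_pointwise_iff_exists _ _ _).1 (hle hv)
    refine Submodule.smul_mem_smul hx ?_
    rw [hU] at hv ⊢
    intro p hp
    apply hreg
    change x • p • w = x • (0 : N)
    rw [smul_comm, hv p hp, smul_zero]
  obtain ⟨v, hvU, hv⟩ := Set.not_subset.1 hnot
  have hv0 : (Submodule.Quotient.mk v : QuotSMulTop x N) ≠ 0 := by
    rwa [Ne, Submodule.Quotient.mk_eq_zero]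
  obtain ⟨Q, hQ, hle⟩ := exists_le_isAssociatedPrime_of_isNoetherianRing A _ hv0
  refine ⟨Q, hQ, fun p hp => hle ?_, hle ?_⟩
  · rw [Submodule.mem_colon_singleton, ← Submodule.Quotient.mk_smul, (hU v).1 hvU p hp]
    simp
  · rw [Submodule.mem_colon_singleton, ← Submodule.Quotient.mk_smul, Submodule.mem_bot,
      Submodule.Quotient.mk_eq_zero]
    exact Submodule.smul_mem_pointwise_smul _ _ _ trivial

/-- Depth is at most the dimension of any associated prime: the first element of the sequence lies
outside `P` but inside an associated prime `Q ⊇ P` of the next quotient, so each step loses at least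
one dimension. -/
theorem length_le_ringKrullDim_quotient (xs : List A) :
    ∀ (N : Type u) [AddCommGroup N] [Module A N] [Module.Finite A N]
      (_ : ∀ x ∈ xs, x ∈ maximalIdeal A) (_ : IsWeaklyRegular N xs)
      {P : Ideal A} (_ : IsAssociatedPrime P N),
      (xs.length : WithBot ℕ∞) ≤ ringKrullDim (A ⧸ P) := by
  induction xs with
  | nil =>
    intro N _ _ _ _ _ P hP
    have := hP.isPrime
    exact ringKrullDim_nonneg_of_nontrivial
  | cons x xs ih =>
    intro N _ _ _ hmem hreg P hP
    have := hP.isPrime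
    rw [isWeaklyRegular_cons_iff] at hreg
    have hx := hmem x (by simp)
    obtain ⟨Q, hQ, hPQ, hxQ⟩ := exists_associatedPrime_quotSMulTop hx hreg.1 hP
    have h1 := ih (QuotSMulTop x N) (fun z hz => hmem z (by simp [hz])) hreg.2 hQ
    have hxP : x ∉ P := by
      intro hxP
      obtain ⟨hPp, n, hn⟩ := (isAssociatedPrime_iff).1 hP
      have h0 : x • n = x • (0 : N) := by
        rw [hn, Submodule.mem_colon_singleton] at hxP
        simpa using hxP
      have hn0 : n = 0 := hreg.1 h0
      exact hPp.ne_top (by rw [hn, hn0]; simp)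
    have h2 : ringKrullDim (A ⧸ Q) + 1 ≤ ringKrullDim (A ⧸ P) := by
      refine ringKrullDim_succ_le_of_surjective (Ideal.Quotient.factor hPQ)
        (Ideal.Quotient.factor_surjective hPQ) (r := Ideal.Quotient.mk P x) ?_ ?_
      · rw [mem_nonZeroDivisors_iff_ne_zero, Ne, Ideal.Quotient.eq_zero_iff_mem]
        exact hxP
      · rw [Ideal.Quotient.factor_mk, Ideal.Quotient.eq_zero_iff_mem]
        exact hxQ
    refine le_trans ?_ h2
    rw [List.length_cons]
    push_cast
    gcongr

/-- Depth falls by at most one modulo any regular element, whether or not it occurs in `xs`. Depth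
is read off from the vanishing of `Ext` from the residue field, and the long exact sequence of
multiplication by `y` shifts this by one degree. -/
theorem exists_isWeaklyRegular_quotSMulTop {N : Type u} [AddCommGroup N] [Module A N]
    [Module.Finite A N] [Nontrivial N] {y : A} (hy : y ∈ maximalIdeal A)
    (hreg : IsSMulRegular N y) (d : ℕ) (xs : List A) (hlen : xs.length = d + 1)
    (hmem : ∀ x ∈ xs, x ∈ maximalIdeal A) (hxs : IsWeaklyRegular N xs) :
    ∃ rs : List A, rs.length = d ∧ (∀ r ∈ rs, r ∈ maximalIdeal A) ∧
      IsWeaklyRegular (QuotSMulTop y N) rs := by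
  have hlt : ∀ (L : Type u) [AddCommGroup L] [Module A L] [Module.Finite A L] [Nontrivial L],
      (maximalIdeal A) • (⊤ : Submodule A L) < ⊤ := fun L _ _ _ _ =>
    lt_top_iff_ne_top.2 (Submodule.top_ne_ideal_smul_of_le_jacobson_annihilator
      (maximalIdeal_le_jacobson _)).symm
  let K : ModuleCat.{u} A := ModuleCat.of A (A ⧸ maximalIdeal A)
  have hsupp : Module.support A K = PrimeSpectrum.zeroLocus (maximalIdeal A : Set A) := by
    rw [Module.support_eq_zeroLocus]
    congr 2
    exact Ideal.annihilator_quotient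
  have hfin : Module.Finite A K := inferInstanceAs (Module.Finite A (A ⧸ maximalIdeal A))
  have hfinN : Module.Finite A (ModuleCat.of A N) := inferInstanceAs (Module.Finite A N)
  have hext := ModuleCat.subsingleton_ext_of_exists_isRegular (maximalIdeal A) K hsupp.le
    (ModuleCat.of A N) (hlt N) xs hmem
    (IsRegular.of_isWeaklyRegular_of_mem_maximalIdeal N hmem hxs)
  have := nontrivial_quotSMulTop_of_mem_maximalIdeal N hy
  have hfinQ : Module.Finite A (ModuleCat.of A (QuotSMulTop y N)) :=
    inferInstanceAs (Module.Finite A (QuotSMulTop y N))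
  have hext' : ∀ i < d, Subsingleton (Ext K (ModuleCat.of A (QuotSMulTop y N)) i) := by
    intro i hi
    have zero1 := AddCommGrpCat.isZero_of_iff_subsingleton.mpr (hext i (by omega))
    have zero2 := AddCommGrpCat.isZero_of_iff_subsingleton.mpr (hext (i + 1) (by omega))
    have hreg' : IsSMulRegular (ModuleCat.of A N) y := hreg
    exact AddCommGrpCat.subsingleton_of_isZero <| ShortComplex.Exact.isZero_of_both_zeros
      ((Ext.covariant_sequence_exact₃' K hreg'.smulShortComplex_shortExact) i (i + 1) rfl)
      (zero1.eq_zero_of_src _) (zero2.eq_zero_of_tgt _)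
  obtain ⟨rs, h1, h2, h3⟩ := ModuleCat.exists_isRegular_of_exists_subsingleton_ext
    (maximalIdeal A) d (ModuleCat.of A (QuotSMulTop y N)) (hlt _) K hsupp hext'
  exact ⟨rs, h1, h2, h3.toIsWeaklyRegular⟩

/-- A system of parameters of a module of maximal depth is a regular sequence. -/
theorem isWeaklyRegular_of_forall_prime_eq (d : ℕ) :
    ∀ (N : Type u) [AddCommGroup N] [Module A N] [Module.Finite A N] [Nontrivial N]
      (xs ys : List A), xs.length = d → (∀ x ∈ xs, x ∈ maximalIdeal A) → IsWeaklyRegular N xs →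
      ys.length = d → (∀ y ∈ ys, y ∈ maximalIdeal A) →
      (∀ P : Ideal A, P.IsPrime → Module.annihilator A N ≤ P → (∀ y ∈ ys, y ∈ P) →
        P = maximalIdeal A) →
      IsWeaklyRegular N ys := by
  induction d with
  | zero =>
    intro N _ _ _ _ xs ys _ _ _ hys _ _
    rw [List.length_eq_zero_iff] at hys
    subst hys
    exact IsWeaklyRegular.nil A N
  | succ d ih =>
    intro N _ _ _ _ xs ys hxl hxm hxr hyl hym hpr
    obtain ⟨y, ys, rfl⟩ := List.exists_cons_of_length_eq_add_one hyl
    have hyl' : ys.length = d := by simpa using hyl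
    have hy : y ∈ maximalIdeal A := hym y (by simp)
    have hreg : IsSMulRegular N y := by
      -- A zero divisor `y` lies in an associated prime `P`, for which `A / P` has dimension at
      -- least `d + 1`. But modulo `P` the element `y` is wasted, and the other `d` elements already
      -- cut `A / P` down to one prime, so its dimension is at most `d`.
      by_contra hnot
      have hex : ∃ v : N, v ≠ 0 ∧ y • v = 0 := by
        rw [isSMulRegular_iff_right_eq_zero_of_smul] at hnot
        push Not at hnot
        obtain ⟨v, h1, h2⟩ := hnot
        exact ⟨v, h2, h1⟩
      have hmem : y ∈ ⋃ p ∈ associatedPrimes A N, (p : Set A) := by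
        rw [biUnion_associatedPrimes_eq_zero_divisors]
        exact hex
      simp only [Set.mem_iUnion] at hmem
      obtain ⟨P, hP, hyP⟩ := hmem
      have hPp : P.IsPrime := hP.isPrime
      have hann : Module.annihilator A N ≤ P := by
        have := hP.annihilator_le
        rwa [Submodule.annihilator_top] at this
      have h1 := length_le_ringKrullDim_quotient xs N hxm hxr hP
      have hloc : IsLocalRing (A ⧸ P) :=
        IsLocalRing.of_surjective' (Ideal.Quotient.mk P) Ideal.Quotient.mk_surjective
      let s : Set (A ⧸ P) := Ideal.Quotient.mk P '' {z | z ∈ ys}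
      have hs : s ⊆ Ring.jacobson (A ⧸ P) := by
        rw [IsLocalRing.ringJacobson_eq_maximalIdeal]
        rintro _ ⟨z, hz, rfl⟩
        have hz' : z ∈ maximalIdeal A := hym z (by simp at hz; simp [hz])
        rw [SetLike.mem_coe, mem_maximalIdeal, mem_nonunits_iff] at *
        intro hu
        obtain ⟨w, hw⟩ := Ideal.Quotient.mk_surjective (hu.unit⁻¹ : (A ⧸ P)ˣ).1
        have h2 : Ideal.Quotient.mk P (z * w - 1) = 0 := by
          rw [map_sub, map_mul, hw, map_one]
          simp
        rw [Ideal.Quotient.eq_zero_iff_mem] at h2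
        have h3 : z * w - 1 ∈ maximalIdeal A := le_maximalIdeal hPp.ne_top h2
        have h4 : z * w ∈ maximalIdeal A := Ideal.mul_mem_right _ _ (by simpa using hz')
        exact (Ideal.ne_top_iff_one _).1 (maximalIdeal.isMaximal A).ne_top
          (by simpa using Ideal.sub_mem _ h4 h3)
      have h2 := ringKrullDim_le_ringKrullDim_quotient_add_encard s hs
      have hsub : Subsingleton (PrimeSpectrum ((A ⧸ P) ⧸ Ideal.span s)) := by
        have key : ∀ p : PrimeSpectrum ((A ⧸ P) ⧸ Ideal.span s),
            (p.asIdeal.comap (Ideal.Quotient.mk (Ideal.span s))).comap (Ideal.Quotient.mk P) =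
              maximalIdeal A := by
          intro p
          have hle : P ≤ (p.asIdeal.comap (Ideal.Quotient.mk (Ideal.span s))).comap
              (Ideal.Quotient.mk P) := by
            intro z hz
            rw [Ideal.mem_comap, Ideal.Quotient.eq_zero_iff_mem.2 hz]
            exact Ideal.zero_mem _
          refine hpr _ inferInstance (hann.trans hle) ?_
          intro z hz
          rcases List.mem_cons.1 hz with rfl | hz
          · exact hle hyP
          · have hzs : Ideal.Quotient.mk P z ∈ Ideal.span s :=
              Ideal.subset_span (Set.mem_image_of_mem _ hz)
            rw [Ideal.mem_comap, Ideal.mem_comap, Ideal.Quotient.eq_zero_iff_mem.2 hzs]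
            exact Ideal.zero_mem _
        refine ⟨fun p q => PrimeSpectrum.ext ?_⟩
        apply Ideal.comap_injective_of_surjective _ Ideal.Quotient.mk_surjective
        apply Ideal.comap_injective_of_surjective _ Ideal.Quotient.mk_surjective
        rw [key p, key q]
      have h3 : ringKrullDim ((A ⧸ P) ⧸ Ideal.span s) ≤ 0 := Order.krullDim_nonpos_of_subsingleton
      have h4 : s.encard ≤ d := by
        refine (Set.encard_image_le _ _).trans ?_
        classical
        have : {z | z ∈ ys} = (ys.toFinset : Set A) := by ext; simp
        rw [this, Set.encard_coe_eq_coe_finsetCard, ← hyl']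
        exact_mod_cast ys.toFinset_card_le
      have h5 : ((d + 1 : ℕ) : WithBot ℕ∞) ≤ ((d : ℕ) : WithBot ℕ∞) := by
        rw [hxl] at h1
        refine h1.trans (h2.trans ?_)
        calc _ ≤ (0 : WithBot ℕ∞) + ((d : ℕ∞) : WithBot ℕ∞) := add_le_add h3 (by exact_mod_cast h4)
          _ = _ := by rw [zero_add]; rfl
      have h6 : d + 1 ≤ d := by exact_mod_cast h5
      omega
    rw [isWeaklyRegular_cons_iff]
    refine ⟨hreg, ?_⟩
    obtain ⟨rs, hrl, hrm, hrr⟩ := exists_isWeaklyRegular_quotSMulTop hy hreg d xs hxl hxm hxr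
    have := nontrivial_quotSMulTop_of_mem_maximalIdeal N hy
    refine ih (QuotSMulTop y N) rs ys hrl hrm hrr hyl' (fun z hz => hym z (by simp [hz])) ?_
    intro Q hQ hann hys
    have hyann : y ∈ Module.annihilator A (QuotSMulTop y N) := by
      rw [Module.mem_annihilator]
      intro v
      obtain ⟨w, rfl⟩ := Submodule.Quotient.mk_surjective _ v
      rw [← Submodule.Quotient.mk_smul, Submodule.Quotient.mk_eq_zero]
      exact Submodule.smul_mem_pointwise_smul _ _ _ trivial
    have hle : Module.annihilator A N ≤ Module.annihilator A (QuotSMulTop y N) :=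
      LinearMap.annihilator_le_of_surjective (Submodule.mkQ _) (Submodule.mkQ_surjective _)
    refine hpr Q hQ (hle.trans hann) ?_
    intro z hz
    rcases List.mem_cons.1 hz with rfl | hz
    · exact hann hyann
    · exact hys z hz

end LocalAlgebra

/-! ### Regular sequences of homogeneous polynomials -/

section HomogeneousRegular

open IsLocalRing RingTheory.Sequence

attribute [local instance] MvPolynomial.gradedAlgebra

theorem isWeaklyRegular_self_iff {R : Type*} [CommRing R] (rs : List R) :
    IsWeaklyRegular R rs ↔ ∀ i (h : i < rs.length) (g : R),
      rs[i] * g ∈ Ideal.ofList (rs.take i) → g ∈ Ideal.ofList (rs.take i) := by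
  rw [isWeaklyRegular_iff]
  refine forall_congr' fun i => forall_congr' fun h => ?_
  rw [isSMulRegular_iff_right_eq_zero_of_smul]
  constructor
  · intro H g hg
    have := H (Submodule.Quotient.mk g) (by
      rw [← Submodule.Quotient.mk_smul, Submodule.Quotient.mk_eq_zero, smul_eq_mul, smul_eq_mul,
        Ideal.mul_top]
      exact hg)
    rwa [Submodule.Quotient.mk_eq_zero, smul_eq_mul, Ideal.mul_top] at this
  · intro H v hv
    obtain ⟨g, rfl⟩ := Submodule.Quotient.mk_surjective _ v
    rw [← Submodule.Quotient.mk_smul, Submodule.Quotient.mk_eq_zero, smul_eq_mul, smul_eq_mul,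
      Ideal.mul_top] at hv
    rw [Submodule.Quotient.mk_eq_zero, smul_eq_mul, Ideal.mul_top]
    exact H g hv

/-- Ideals generated by variables are monomial, so membership is tested on supports. This gives the
sequence of maximal length at the origin with which other systems of parameters are compared. -/
theorem isWeaklyRegular_X (n : ℕ) :
    IsWeaklyRegular (MvPolynomial (Fin n) ℂ) (List.ofFn fun k : Fin n => (X k : MvPolynomial _ ℂ)) := by
  rw [isWeaklyRegular_self_iff]
  intro i h g hg
  have hlist : Ideal.ofList ((List.ofFn fun k : Fin n => (X k : MvPolynomial _ ℂ)).take i) =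
      Ideal.span (X '' {k : Fin n | (k : ℕ) < i}) := by
    unfold Ideal.ofList
    congr 1
    ext f
    simp only [Set.mem_ofPred_eq, List.mem_take_iff_getElem, List.getElem_ofFn, Set.mem_image,
      List.length_ofFn]
    constructor
    · rintro ⟨j, hj, rfl⟩
      exact ⟨⟨j, by omega⟩, by simp; omega, rfl⟩
    · rintro ⟨k, hk, rfl⟩
      exact ⟨k, by rw [List.length_ofFn] at h; have := k.2; omega, rfl⟩
  rw [List.length_ofFn] at h
  rw [hlist, List.getElem_ofFn, mem_ideal_span_X_image] at hg
  rw [hlist, mem_ideal_span_X_image]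
  intro m hm
  have hm' : Finsupp.single ⟨i, h⟩ 1 + m ∈ (X ⟨i, h⟩ * g : MvPolynomial (Fin n) ℂ).support := by
    rw [mem_support_iff, coeff_X_mul]
    rwa [mem_support_iff] at hm
  obtain ⟨k, hk, hk0⟩ := hg _ hm'
  refine ⟨k, hk, ?_⟩
  have hki : k ≠ ⟨i, h⟩ := by
    rintro rfl
    simp at hk
  rwa [Finsupp.add_apply, Finsupp.single_eq_of_ne hki, zero_add] at hk0

/-- A polynomial which lies in a homogeneous ideal after multiplication with a polynomial with
nonzero constant term lies in this ideal. -/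
theorem mem_of_mul_mem_of_constantCoeff_ne_zero {n : ℕ} {I : Ideal (MvPolynomial (Fin n) ℂ)}
    (hI : I.IsHomogeneous (homogeneousSubmodule (Fin n) ℂ)) {s g : MvPolynomial (Fin n) ℂ}
    (hs : constantCoeff s ≠ 0) {k : ℕ} (hg : g ∈ homogeneousSubmodule (Fin n) ℂ k)
    (h : s * g ∈ I) : g ∈ I := by
  classical
  have h1 := hI (0 + k) h
  rw [DirectSum.coe_decompose_mul_add_of_right_mem _ hg] at h1
  have h2 : ((DirectSum.decompose (homogeneousSubmodule (Fin n) ℂ) s 0 :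
      homogeneousSubmodule (Fin n) ℂ 0) : MvPolynomial (Fin n) ℂ) = C (constantCoeff s) := by
    have := decomposition.decompose'_apply s 0
    rw [homogeneousComponent_zero] at this
    exact this
  rw [h2] at h1
  have h3 := I.mul_mem_left (C (constantCoeff s)⁻¹) h1
  rwa [← mul_assoc, ← C_mul, inv_mul_cancel₀ hs, C_1, one_mul] at h3

theorem isHomogeneous_ofList {n : ℕ} (l : List (MvPolynomial (Fin n) ℂ))
    (hl : ∀ f ∈ l, ∃ k, f.IsHomogeneous k) :
    (Ideal.ofList l).IsHomogeneous (homogeneousSubmodule (Fin n) ℂ) :=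
  Ideal.homogeneous_span _ _ fun f hf => by
    obtain ⟨k, hk⟩ := hl f hf
    exact ⟨k, hk⟩

/-- For a homogeneous sequence, being a nonzerodivisor can be tested on homogeneous elements, and
there a denominator with nonzero constant term can be cancelled. So nothing is lost by localizing at
the origin. -/
theorem isWeaklyRegular_of_isLocalization {n : ℕ} (l : List (MvPolynomial (Fin n) ℂ))
    (hl : ∀ f ∈ l, ∃ k, f.IsHomogeneous k) (p : Ideal (MvPolynomial (Fin n) ℂ)) [p.IsPrime]
    (hp : ∀ f, f ∉ p → constantCoeff f ≠ 0)
    (h : IsWeaklyRegular (Localization.AtPrime p)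
      (l.map (algebraMap _ (Localization.AtPrime p)))) :
    IsWeaklyRegular (MvPolynomial (Fin n) ℂ) l := by
  classical
  rw [isWeaklyRegular_self_iff] at h ⊢
  intro i hi g hg
  obtain ⟨k, hk⟩ := hl l[i] (List.getElem_mem hi)
  have hI := isHomogeneous_ofList (l.take i) fun f hf => hl f (List.mem_of_mem_take hf)
  rw [← DirectSum.sum_support_decompose (homogeneousSubmodule (Fin n) ℂ) g]
  refine Ideal.sum_mem _ fun j _ => ?_
  have h1 : l[i] * ((DirectSum.decompose (homogeneousSubmodule (Fin n) ℂ) g j :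
      homogeneousSubmodule (Fin n) ℂ j) : MvPolynomial (Fin n) ℂ) ∈ Ideal.ofList (l.take i) := by
    have := hI (k + j) hg
    rwa [DirectSum.coe_decompose_mul_add_of_left_mem _ hk] at this
  have h2 := h i (by simpa using hi) (algebraMap _ _
    ((DirectSum.decompose (homogeneousSubmodule (Fin n) ℂ) g j :
      homogeneousSubmodule (Fin n) ℂ j) : MvPolynomial (Fin n) ℂ)) (by
    rw [List.getElem_map, ← map_mul, ← List.map_take, ← Ideal.map_ofList]
    exact Ideal.mem_map_of_mem _ h1)
  rw [← List.map_take, ← Ideal.map_ofList,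
    IsLocalization.algebraMap_mem_map_algebraMap_iff p.primeCompl] at h2
  obtain ⟨s, hs, hsg⟩ := h2
  exact mem_of_mul_mem_of_constantCoeff_ne_zero hI (hp s hs) (SetLike.coe_mem _) hsg

/-- Homogeneous polynomials which, together with one more homogeneous polynomial, have no common
zero except the origin, their number being the number of variables, form a regular sequence. -/
theorem isRegular_of_forall_eq_zero {n r : ℕ} (hr : r + 1 = n) (q : ℕ → MvPolynomial (Fin n) ℂ)
    (hq : ∀ i, (q i).IsHomogeneous (i + 1)) (ℓ : MvPolynomial (Fin n) ℂ) (hℓ : ℓ.IsHomogeneous 1)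
    (h0 : ∀ y : Fin n → ℂ, (∀ i < r, eval y (q i) = 0) → eval y ℓ = 0 → y = 0) :
    IsRegular (MvPolynomial (Fin n) ℂ) ((List.range r).map q) := by
  classical
  let p : Ideal (MvPolynomial (Fin n) ℂ) := RingHom.ker (constantCoeff (R := ℂ) (σ := Fin n))
  have hpmax : p.IsMaximal := RingHom.ker_isMaximal_of_surjective _
    fun z => ⟨C z, constantCoeff_C _ z⟩
  have hpp : p.IsPrime := hpmax.isPrime
  have hmem : ∀ {f : MvPolynomial (Fin n) ℂ} {k : ℕ}, f.IsHomogeneous (k + 1) → f ∈ p := by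
    intro f k hf
    rw [RingHom.mem_ker, constantCoeff_eq]
    exact hf.coeff_eq_zero (by simp)
  let A := Localization.AtPrime p
  have hAm : ∀ f, f ∈ p → algebraMap (MvPolynomial (Fin n) ℂ) A f ∈ maximalIdeal A := fun f hf =>
    (IsLocalization.AtPrime.to_map_mem_maximal_iff A p f).2 hf
  have hnoeth : IsNoetherianRing A := IsLocalization.isNoetherianRing p.primeCompl A inferInstance
  let ys : List (MvPolynomial (Fin n) ℂ) := (List.range r).map q ++ [ℓ]
  have hysp : ∀ f ∈ ys, f ∈ p := by
    intro f hf
    rcases List.mem_append.1 hf with hf | hf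
    · obtain ⟨i, -, rfl⟩ := List.mem_map.1 hf
      exact hmem (hq i)
    · rw [List.mem_singleton.1 hf]
      exact hmem (k := 0) hℓ
  have hreg : IsWeaklyRegular A (ys.map (algebraMap _ A)) := by
    refine isWeaklyRegular_of_forall_prime_eq n A
      ((List.ofFn fun k : Fin n => (X k : MvPolynomial _ ℂ)).map (algebraMap _ A)) _
      (by simp) ?_ ?_ (by simp [ys, hr]) ?_ ?_
    · intro x hx
      obtain ⟨f, hf, rfl⟩ := List.mem_map.1 hx
      obtain ⟨k, rfl⟩ := (List.mem_ofFn' _ _).1 hf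
      exact hAm _ (by simp [p])
    · exact (isWeaklyRegular_X n).of_isLocalization A p.primeCompl
    · intro y hy
      obtain ⟨f, hf, rfl⟩ := List.mem_map.1 hy
      exact hAm _ (hysp f hf)
    · intro P hP _ hys
      let P' : Ideal (MvPolynomial (Fin n) ℂ) := P.comap (algebraMap _ A)
      have hP' : P'.IsPrime := inferInstance
      have hle : p ≤ P' := by
        -- By the Nullstellensatz a prime containing the sequence is determined by its zeros, and
        -- the only possible zero is the origin.
        rw [← MvPolynomial.IsPrime.vanishingIdeal_zeroLocus (K := ℂ) P']
        intro f hf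
        rw [mem_vanishingIdeal_iff]
        intro y hy
        rw [mem_zeroLocus_iff] at hy
        have hy0 : y = 0 := by
          refine h0 y (fun i hi => ?_) ?_
          · have := hy (q i) (hys _ (List.mem_map_of_mem (by
              simp only [ys, List.mem_append, List.mem_map, List.mem_range]
              exact Or.inl ⟨i, hi, rfl⟩)))
            rwa [aeval_eq_eval] at this
          · have := hy ℓ (hys _ (List.mem_map_of_mem (by simp [ys])))
            rwa [aeval_eq_eval] at this
        rw [hy0, aeval_zero, hf]
        simp
      have heq : P' = p := (hpmax.eq_of_le hP'.ne_top hle).symm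
      rw [← IsLocalization.map_under p.primeCompl A P]
      change Ideal.map (algebraMap _ A) P' = _
      rw [heq]
      exact Localization.AtPrime.map_eq_maximalIdeal
  have hreg' : IsWeaklyRegular A (((List.range r).map q).map (algebraMap _ A)) := by
    rw [List.map_append, isWeaklyRegular_append_iff] at hreg
    exact hreg.1
  refine ⟨isWeaklyRegular_of_isLocalization _ ?_ p (fun f hf => hf) hreg', ?_⟩
  · intro f hf
    obtain ⟨i, -, rfl⟩ := List.mem_map.1 hf
    exact ⟨_, hq i⟩
  · intro htop
    rw [smul_eq_mul, Ideal.mul_top] at htop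
    have hle : Ideal.ofList ((List.range r).map q) ≤ p := Ideal.span_le.2 fun f hf =>
      hysp f (List.mem_append_left _ hf)
    exact hpp.ne_top (top_le_iff.1 (htop ▸ hle))

end HomogeneousRegular

/-! ### Products of spaces of field elements -/

section ProductSpaces

variable {E K : Type*} [Field E] [Field K] [Algebra E K]

theorem finrank_map_mulLeft (A : Submodule E K) {x : K} (hx : x ≠ 0) :
    Module.finrank E (A.map (LinearMap.mulLeft E x)) = Module.finrank E A :=
  (LinearEquiv.finrank_eq (Submodule.equivMapOfInjective _
    (mul_right_injective₀ hx) A)).symm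

/-- A linear analogue of the Cauchy–Davenport inequality. -/
theorem finrank_add_finrank_le_finrank_mul [IsAlgClosed E] (n : ℕ) :
    ∀ (A B : Submodule E K) [FiniteDimensional E A] [FiniteDimensional E B],
      A ≠ ⊥ → B ≠ ⊥ → Module.finrank E A = n →
      Module.finrank E A + Module.finrank E B ≤ Module.finrank E (A * B : Submodule E K) + 1 := by
  induction n using Nat.strong_induction_on with
  | _ n ih =>
    intro A B _ _ hA hB hn
    have hABfin : FiniteDimensional E (A * B : Submodule E K) :=
      Module.Finite.iff_fg.2 (Submodule.FG.mul (Module.Finite.iff_fg.1 inferInstance)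
        (Module.Finite.iff_fg.1 inferInstance))
    by_cases hex : ∃ x : K, x ≠ 0 ∧ A ⊓ B.comap (LinearMap.mulLeft E x) ≠ ⊥ ∧
        A ⊓ B.comap (LinearMap.mulLeft E x) ≠ A
    -- Dyson's e-transform: replace `A` by `A ∩ x⁻¹B` and `B` by `B + xA`. The sum of the dimensions
    -- is unchanged, the new product lies in `A * B`, and the first factor is smaller.
    · obtain ⟨x, hx, hne, hneA⟩ := hex
      have hAfin : FiniteDimensional E (A ⊓ B.comap (LinearMap.mulLeft E x) : Submodule E K) :=
        Submodule.finiteDimensional_inf_left _ _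
      have hlt : Module.finrank E (A ⊓ B.comap (LinearMap.mulLeft E x) : Submodule E K) < n := by
        rw [← hn]
        exact Submodule.finrank_lt_finrank_of_lt (lt_of_le_of_ne inf_le_left hneA)
      have hmapeq : (A ⊓ B.comap (LinearMap.mulLeft E x)).map (LinearMap.mulLeft E x) =
          B ⊓ A.map (LinearMap.mulLeft E x) := by
        ext z
        constructor
        · rintro ⟨a, ⟨ha, hb⟩, rfl⟩
          exact ⟨hb, a, ha, rfl⟩
        · rintro ⟨hb, a, ha, rfl⟩
          exact ⟨a, ⟨ha, hb⟩, rfl⟩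
      have h1 := Submodule.finrank_sup_add_finrank_inf_eq B (A.map (LinearMap.mulLeft E x))
      rw [← hmapeq, finrank_map_mulLeft _ hx, finrank_map_mulLeft _ hx] at h1
      have h2 := ih _ hlt (A ⊓ B.comap (LinearMap.mulLeft E x))
        (B ⊔ A.map (LinearMap.mulLeft E x)) hne
        (fun h => hB (le_bot_iff.1 (h ▸ le_sup_left))) rfl
      have hle : (A ⊓ B.comap (LinearMap.mulLeft E x)) * (B ⊔ A.map (LinearMap.mulLeft E x)) ≤
          A * B := by
        rw [Submodule.mul_sup, sup_le_iff]
        refine ⟨Submodule.mul_le.2 fun a ha c hc => Submodule.mul_mem_mul ha.1 hc, ?_⟩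
        rw [Submodule.mul_le]
        rintro a ⟨-, ha⟩ _ ⟨c, hc, rfl⟩
        have : a * (LinearMap.mulLeft E x) c = c * (x * a) := by
          simp only [LinearMap.mulLeft_apply]; ring
        rw [this]
        exact Submodule.mul_mem_mul hc ha
      have h3 := Submodule.finrank_mono hle
      omega
    -- No transform is proper. Taking `x = b / a₀` shows that every `a / a₀` maps the
    -- finite-dimensional space `B` to itself, so it is integral over the algebraically closed `E`
    -- and lies in `E`; hence `A` is a line.
    · push Not at hex
      obtain ⟨a₀, ha₀, ha₀0⟩ := Submodule.exists_mem_ne_zero_of_ne_bot hA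
      have hstab : ∀ a ∈ A, ∀ b ∈ B, (a / a₀) • b ∈ B := by
        intro a ha b hb
        by_cases hb0 : b = 0
        · simp [hb0]
        · have h1 := hex (b / a₀) (div_ne_zero hb0 ha₀0) (by
            intro h
            have : a₀ ∈ A ⊓ B.comap (LinearMap.mulLeft E (b / a₀)) := by
              refine ⟨ha₀, ?_⟩
              simp only [Submodule.comap_coe, Set.mem_preimage, LinearMap.mulLeft_apply]
              rw [div_mul_cancel₀ _ ha₀0]
              exact hb
            rw [h] at this
            exact ha₀0 (by simpa using this))
          have h2 : a ∈ A ⊓ B.comap (LinearMap.mulLeft E (b / a₀)) := by rw [h1]; exact ha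
          have h3 : b / a₀ * a ∈ B := h2.2
          rw [smul_eq_mul]
          convert h3 using 1
          ring
      have hAle : A ≤ E ∙ a₀ := by
        intro a ha
        have hint : IsIntegral E (a / a₀) := isIntegral_of_smul_mem_submodule B hB
          (Module.Finite.iff_fg.1 inferInstance) _ (hstab a ha)
        obtain ⟨e, he'⟩ := minpoly.mem_range_of_degree_eq_one E _
          (IsAlgClosed.degree_eq_one_of_irreducible E (minpoly.irreducible hint))
        rw [Submodule.mem_span_singleton]
        refine ⟨e, ?_⟩
        rw [Algebra.smul_def, he', div_mul_cancel₀ _ ha₀0]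
      have h1 : Module.finrank E A ≤ 1 :=
        (Submodule.finrank_mono hAle).trans (finrank_span_singleton ha₀0).le
      have h2 : B.map (LinearMap.mulLeft E a₀) ≤ A * B := by
        rintro _ ⟨b, hb, rfl⟩
        exact Submodule.mul_mem_mul ha₀ hb
      have h3 := Submodule.finrank_mono h2
      rw [finrank_map_mulLeft _ ha₀0] at h3
      omega

theorem mul_add_one_le_finrank_pow [IsAlgClosed E] (W : Submodule E K) [FiniteDimensional E W]
    {b : ℕ} (hW : Module.finrank E W = b + 1) (j : ℕ) :
    b * j + 1 ≤ Module.finrank E (W ^ j : Submodule E K) := by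
  have hW0 : W ≠ ⊥ := by
    rintro rfl
    simp at hW
  have hfin : ∀ j, FiniteDimensional E (W ^ j : Submodule E K) := fun j =>
    Module.Finite.iff_fg.2 (Submodule.FG.pow (Module.Finite.iff_fg.1 inferInstance) j)
  induction j with
  | zero =>
    rw [pow_zero, Submodule.one_eq_span, finrank_span_singleton one_ne_zero]
    simp
  | succ j ih =>
    have := hfin j
    have h1 := finrank_add_finrank_le_finrank_mul _ (W ^ j) W (pow_ne_zero j hW0) hW0 rfl
    rw [pow_succ, mul_add]
    omega

end ProductSpaces

/-! ### Linear disjointness -/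

section LinearDisjointness

/-- The regular representation of the finite algebra `F[w]`: its basis is a common eigenvector of
the transposed multiplication matrices, and the determinant of a combination is a norm, nonzero when
the element is. Relations between the `w β` thus become determinants over `F`. -/
theorem exists_matrix_mulVec_eq_smul {F K ι : Type*} [Field F] [Field K] [Algebra F K] [Finite ι]
    (w : ι → K) (hw : ∀ β, IsIntegral F (w β)) :
    ∃ (n : ℕ) (M : ι → Matrix (Fin n) (Fin n) F) (l : Fin n → K), l ≠ 0 ∧
      (∀ β, ((M β).map (algebraMap F K)).mulVec l = w β • l) ∧
      ∀ (s : Finset ι) (e : ι → F), ∑ β ∈ s, algebraMap F K (e β) * w β ≠ 0 →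
        (∑ β ∈ s, e β • M β).det ≠ 0 := by
  classical
  let S := Algebra.adjoin F (Set.range w)
  have hfin : Module.Finite F S := Module.Finite.iff_fg.2
    (fg_adjoin_of_finite (Set.finite_range w) (by rintro _ ⟨β, rfl⟩; exact hw β))
  let bs := Module.finBasis F S
  let wS : ι → S := fun β => ⟨w β, Algebra.subset_adjoin ⟨β, rfl⟩⟩
  refine ⟨_, fun β => (Algebra.leftMulMatrix bs (wS β)).transpose, fun i => (bs i : K), ?_, ?_, ?_⟩
  · intro h
    have hpos : 0 < Module.finrank F S := Module.finrank_pos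
    have := congrFun h ⟨0, hpos⟩
    exact bs.ne_zero ⟨0, hpos⟩ (Subtype.ext this)
  · intro β
    ext j
    have h1 : wS β * bs j = ∑ i, Algebra.leftMulMatrix bs (wS β) i j • bs i := by
      simp_rw [Algebra.leftMulMatrix_eq_repr_mul]
      exact (bs.sum_repr _).symm
    have h2 := congrArg (Subtype.val : S → K) h1
    simp only [Matrix.mulVec, dotProduct, Matrix.map_apply, Matrix.transpose_apply, Pi.smul_apply,
      smul_eq_mul]
    change w β * (bs j : K) = _ at h2
    rw [h2]
    simp [Algebra.smul_def]
  · intro s e he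
    have h1 : ∑ β ∈ s, e β • (Algebra.leftMulMatrix bs (wS β)).transpose =
        (Algebra.leftMulMatrix bs (∑ β ∈ s, e β • wS β)).transpose := by
      rw [map_sum, Matrix.transpose_sum]
      simp [Matrix.transpose_smul]
    rw [h1, Matrix.det_transpose, ← Algebra.norm_eq_matrix_det]
    refine Algebra.norm_ne_zero_iff.2 fun h => he ?_
    have h2 := congrArg (Subtype.val : S → K) h
    simpa [wS, Algebra.smul_def] using h2

/-- The determinant of a linear combination of matrices of polynomials. -/
noncomputable def combDet {E τ ι : Type*} [CommRing E] [Fintype ι] {n : ℕ}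
    (G : ι → Matrix (Fin n) (Fin n) (MvPolynomial τ E)) {S : Type*} [CommRing S] [Algebra E S]
    (a : ι → S) : MvPolynomial τ S :=
  (∑ β, (C (a β) : MvPolynomial τ S) • (G β).map (MvPolynomial.map (algebraMap E S))).det

theorem map_combDet {E τ ι : Type*} [CommRing E] [Fintype ι] {n : ℕ}
    (G : ι → Matrix (Fin n) (Fin n) (MvPolynomial τ E)) {S S' : Type*} [CommRing S] [Algebra E S]
    [CommRing S'] [Algebra E S'] (φ : S →ₐ[E] S') (a : ι → S) :
    MvPolynomial.map φ.toRingHom (combDet G a) = combDet G (fun β => φ (a β)) := by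
  unfold combDet
  rw [RingHom.map_det]
  congr 1
  refine Matrix.ext fun i j => ?_
  simp only [RingHom.mapMatrix_apply, Matrix.map_apply, Matrix.sum_apply, Matrix.smul_apply,
    map_sum, smul_eq_mul, map_mul, map_C, MvPolynomial.map_map]
  refine Finset.sum_congr rfl fun β _ => ?_
  congr 3
  exact φ.comp_algebraMap

theorem aeval_combDet {E τ ι : Type*} [CommRing E] [Fintype ι] {n : ℕ}
    (G : ι → Matrix (Fin n) (Fin n) (MvPolynomial τ E)) {S K : Type*} [CommRing S] [Algebra E S]
    [CommRing K] [Algebra S K] [Algebra E K] [IsScalarTower E S K] (u : τ → K) (a : ι → S) :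
    aeval u (combDet G a) =
      (∑ β, algebraMap S K (a β) • (G β).map (fun f => (aeval u f : K))).det := by
  unfold combDet
  rw [AlgHom.map_det]
  congr 1
  ext i j
  simp only [AlgHom.mapMatrix_apply, Matrix.map_apply, Matrix.sum_apply, Matrix.smul_apply,
    map_sum, smul_eq_mul, map_mul, aeval_C, aeval_map_algebraMap]

/-- Linear disjointness of the algebraic closure of `E(u)` and of a field `E'` over which `u` is
algebraically independent, where `E` is algebraically closed. -/
theorem linearIndependent_of_algebraicIndependent {E E' K : Type*} [Field E] [Field E'] [Field K]
    [Algebra E E'] [Algebra E' K] [Algebra E K] [IsScalarTower E E' K] [IsAlgClosed E]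
    {τ : Type*} (u : τ → K) (hu : AlgebraicIndependent E' u) {ι : Type*} [Finite ι]
    (w : ι → K) (hw : ∀ β, IsAlgebraic (IntermediateField.adjoin E (Set.range u)) (w β))
    (hli : LinearIndependent E w) : LinearIndependent E' w := by
  classical
  have := Fintype.ofFinite ι
  rw [Fintype.linearIndependent_iff] at hli ⊢
  intro c hc
  by_contra hcon
  push Not at hcon
  obtain ⟨β₀, hβ₀⟩ := hcon
  obtain ⟨n, M, l, hl0, hMl, hdet⟩ := exists_matrix_mulVec_eq_smul w fun β => (hw β).isIntegral
  -- A common denominator makes all matrix entries polynomials in `u` over `E`.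
  have hden : ∃ D : MvPolynomial τ E, aeval u D ≠ 0 ∧
      ∀ β i j, ∃ G : MvPolynomial τ E, aeval u G = aeval u D * (M β i j : K) := by
    have h1 : ∀ z : IntermediateField.adjoin E (Set.range u), ∃ r s : MvPolynomial τ E,
        aeval u s ≠ 0 ∧ aeval u r = aeval u s * (z : K) := by
      intro z
      obtain ⟨r, s, hrs⟩ := (IntermediateField.mem_adjoin_range_iff E u (z : K)).1 z.2
      by_cases hs : aeval u s = 0
      · refine ⟨0, 1, by simp, ?_⟩
        rw [hrs, hs]
        simp
      · exact ⟨r, s, hs, by rw [hrs, mul_div_cancel₀ _ hs]⟩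
    choose r s hs hrs using h1
    refine ⟨∏ x : ι × Fin n × Fin n, s (M x.1 x.2.1 x.2.2), ?_, fun β i j => ?_⟩
    · rw [map_prod]
      exact Finset.prod_ne_zero_iff.2 fun x _ => hs _
    · refine ⟨(∏ x ∈ Finset.univ.erase (β, i, j), s (M x.1 x.2.1 x.2.2)) * r (M β i j), ?_⟩
      rw [← Finset.prod_erase_mul _ _ (Finset.mem_univ (β, i, j)), map_mul, map_mul, hrs]
      ring
  obtain ⟨D, hD, hG⟩ := hden
  choose G' hG using hG
  let G : ι → Matrix (Fin n) (Fin n) (MvPolynomial τ E) := fun β => Matrix.of (G' β)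
  have hGM : ∀ β, (G β).map (fun f => aeval u f) =
      aeval u D • (M β).map (algebraMap (IntermediateField.adjoin E (Set.range u)) K) := by
    intro β
    ext i j
    simp only [G, Matrix.map_apply, Matrix.of_apply, hG, Matrix.smul_apply, smul_eq_mul]
    rfl
  -- The relation with coefficients `c` kills the common eigenvector, so the determinant vanishes at
  -- `u`; since `u` is algebraically independent over `E'`, it vanishes identically.
  have hc0 : combDet G c = 0 := by
    refine (injective_iff_map_eq_zero _).1 hu _ ?_
    rw [aeval_combDet]
    refine Matrix.exists_mulVec_eq_zero_iff.1 ⟨l, hl0, ?_⟩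
    have h1 : ∀ β, (algebraMap E' K (c β) • (G β).map (fun f => aeval u f)).mulVec l =
        (aeval u D * (c β • w β)) • l := by
      intro β
      rw [hGM, Matrix.smul_mulVec, Matrix.smul_mulVec, hMl, smul_smul, smul_smul,
        Algebra.smul_def (c β) (w β)]
      congr 1
      ring
    rw [Matrix.sum_mulVec]
    simp_rw [h1]
    rw [← Finset.sum_smul, ← Finset.mul_sum, hc, mul_zero, zero_smul]
  -- Specialization of `c` to a point `e` over `E`: all polynomial relations over `E` are kept, and
  -- the Nullstellensatz allows `e β₀ ≠ 0`. Independence over `E` then makes the determinant for `e`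
  -- a nonzero norm, a contradiction.
  let p : Ideal (MvPolynomial ι E) := RingHom.ker (aeval c : MvPolynomial ι E →ₐ[E] E')
  have hp : p.IsPrime := RingHom.ker_isPrime _
  have hX : X β₀ ∉ vanishingIdeal E (MvPolynomial.zeroLocus E p) := by
    rw [MvPolynomial.IsPrime.vanishingIdeal_zeroLocus, RingHom.mem_ker, aeval_X]
    exact hβ₀
  rw [mem_vanishingIdeal_iff] at hX
  push Not at hX
  obtain ⟨e, hep, he⟩ := hX
  rw [aeval_X] at he
  have he0 : combDet G e = 0 := by
    have h1 := map_combDet G (aeval e : MvPolynomial ι E →ₐ[E] E) X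
    have h2 := map_combDet G (aeval c : MvPolynomial ι E →ₐ[E] E') X
    simp only [aeval_X] at h1 h2
    rw [hc0] at h2
    rw [← h1]
    ext μ
    have h3 : coeff μ (combDet G (X : ι → MvPolynomial ι E)) ∈ p := by
      have := congrArg (coeff μ) h2
      rwa [coeff_map, coeff_zero] at this
    rw [coeff_map, coeff_zero]
    exact hep _ h3
  have hne : ∑ β, algebraMap (IntermediateField.adjoin E (Set.range u)) K
      (algebraMap E _ (e β)) * w β ≠ 0 := by
    intro h0
    refine he (hli e ?_ β₀)
    rw [← h0]
    refine Finset.sum_congr rfl fun β _ => ?_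
    rw [Algebra.smul_def]
    rfl
  have h4 := hdet Finset.univ (fun β => algebraMap E _ (e β)) hne
  have h5 := congrArg (aeval u) he0
  rw [aeval_combDet, map_zero] at h5
  have h6 : ∑ β, algebraMap E K (e β) • (G β).map (fun f => aeval u f) =
      aeval u D • (algebraMap (IntermediateField.adjoin E (Set.range u)) K).mapMatrix
        (∑ β, (algebraMap E (IntermediateField.adjoin E (Set.range u)) (e β)) • M β) := by
    rw [map_sum, Finset.smul_sum]
    refine Finset.sum_congr rfl fun β _ => ?_
    rw [hGM]
    ext i j
    simp only [Matrix.smul_apply, Matrix.map_apply, RingHom.mapMatrix_apply, smul_eq_mul, map_mul]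
    have : algebraMap E K (e β) = algebraMap (IntermediateField.adjoin E (Set.range u)) K
      (algebraMap E _ (e β)) := rfl
    rw [this]
    ring
  rw [h6, Matrix.det_smul, ← RingHom.map_det] at h5
  rcases mul_eq_zero.1 h5 with h | h
  · exact pow_ne_zero _ hD h
  · exact h4 ((map_eq_zero _).1 h)

end LinearDisjointness

/-! ### Transcendence ranks of finite sets -/

section Rank

open AlgebraicIndependent

variable (k : Type*) {K : Type*} [Field k] [Field K] [Algebra k K]

/-- The relative algebraic closure of the subfield generated by a set. -/
noncomputable def relClosure (S : Set K) : IntermediateField k K :=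
  (algebraicClosure (IntermediateField.adjoin k S) K).restrictScalars k

/-- The transcendence degree of the subfield generated by a (finite) set. -/
noncomputable def trk (S : Set K) : ℕ := ((matroid k K).eRk S).toNat

theorem coe_relClosure (S : Set K) : (relClosure k S : Set K) = (matroid k K).closure S := by
  rw [matroid_closure_eq]
  ext x
  simp only [SetLike.mem_coe, relClosure, IntermediateField.mem_restrictScalars,
    mem_algebraicClosure_iff, Subalgebra.mem_algebraicClosure]
  exact IntermediateField.isAlgebraic_adjoin_iff

theorem mem_relClosure {S : Set K} {x : K} :
    x ∈ relClosure k S ↔ x ∈ (matroid k K).closure S := by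
  rw [← coe_relClosure]
  rfl

theorem mem_relClosure_iff_isAlgebraic {S : Set K} {x : K} :
    x ∈ relClosure k S ↔ IsAlgebraic (IntermediateField.adjoin k S) x := by
  simp only [relClosure, IntermediateField.mem_restrictScalars, mem_algebraicClosure_iff]

instance isAlgClosed_relClosure [IsAlgClosed K] (S : Set K) : IsAlgClosed (relClosure k S) :=
  IsAlgClosure.isAlgClosed (IntermediateField.adjoin k S)
    (K := algebraicClosure (IntermediateField.adjoin k S) K)

theorem subset_relClosure (S : Set K) : S ⊆ relClosure k S := by
  rw [coe_relClosure]
  exact (matroid k K).subset_closure S (by simp)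

theorem relClosure_mono {S T : Set K} (h : S ⊆ relClosure k T) :
    relClosure k S ≤ relClosure k T := by
  rw [← SetLike.coe_subset_coe]
  rw [coe_relClosure] at h
  rw [coe_relClosure, coe_relClosure]
  exact (matroid k K).closure_subset_closure_of_subset_closure h

theorem relClosure_le_of_isAlgebraic {S : Set K} {F : IntermediateField k K} (h : S ⊆ F)
    (hF : ∀ x : K, IsAlgebraic F x → x ∈ F) : relClosure k S ≤ F := by
  intro x hx
  rw [mem_relClosure_iff_isAlgebraic] at hx
  apply hF
  have hle : IntermediateField.adjoin k S ≤ F := IntermediateField.adjoin_le_iff.2 h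
  let _ := (IntermediateField.inclusion hle).toRingHom.toAlgebra
  have : IsScalarTower (IntermediateField.adjoin k S) F K := IsScalarTower.of_algebraMap_eq' rfl
  exact hx.tower_top F

variable {k}

theorem eRk_ne_top {S : Set K} (hS : S.Finite) : (matroid k K).eRk S ≠ ⊤ :=
  ne_top_of_le_ne_top (Set.encard_ne_top_iff.2 hS) ((matroid k K).eRk_le_encard S)

theorem coe_trk {S : Set K} (hS : S.Finite) : (trk k S : ℕ∞) = (matroid k K).eRk S :=
  ENat.natCast_toNat (eRk_ne_top hS)

theorem trk_le_of_subset_relClosure {S T : Set K} (hT : T.Finite) (h : S ⊆ relClosure k T) :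
    trk k S ≤ trk k T := by
  refine ENat.toNat_le_toNat ?_ (eRk_ne_top hT)
  rw [← (matroid k K).eRk_closure_eq T]
  exact (matroid k K).eRk_mono (by rwa [coe_relClosure] at h)

theorem trk_mono {S T : Set K} (hT : T.Finite) (h : S ⊆ T) : trk k S ≤ trk k T :=
  trk_le_of_subset_relClosure hT (h.trans (subset_relClosure k T))

theorem trk_union_le {S T : Set K} (hS : S.Finite) (hT : T.Finite) :
    trk k (S ∪ T) ≤ trk k S + T.ncard := by
  have h := (matroid k K).eRk_union_le_eRk_add_encard S T
  rw [← coe_trk hS, ← coe_trk (hS.union hT), ← hT.cast_ncard_eq] at h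
  exact_mod_cast h

theorem trk_le_ncard {S : Set K} (hS : S.Finite) : trk k S ≤ S.ncard := by
  have h := (matroid k K).eRk_le_encard S
  rw [← coe_trk hS, ← hS.cast_ncard_eq] at h
  exact_mod_cast h

theorem trk_submodular {S T R : Set K} (hS : S.Finite) (hT : T.Finite) (hR : R.Finite)
    (hST : S ⊆ T) : trk k (T ∪ R) + trk k S ≤ trk k T + trk k (S ∪ R) := by
  have h := (matroid k K).eRk_inter_add_eRk_union_le T (S ∪ R)
  have h1 : T ∪ (S ∪ R) = T ∪ R := by rw [← Set.union_assoc, Set.union_eq_self_of_subset_right hST]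
  have h2 := (matroid k K).eRk_mono (Set.subset_inter hST (Set.subset_union_left : S ⊆ S ∪ R))
  rw [h1] at h
  have h3 := (add_le_add h2 le_rfl).trans h
  rw [← coe_trk hS, ← coe_trk hT, ← coe_trk (hS.union hR), ← coe_trk (hT.union hR)] at h3
  have h4 : trk k S + trk k (T ∪ R) ≤ trk k T + trk k (S ∪ R) := by exact_mod_cast h3
  omega

theorem trk_lt_of_notMem {S T : Set K} (hT : T.Finite) (hST : S ⊆ T) {x : K}
    (hxT : x ∈ T) (hx : x ∉ relClosure k S) : trk k S + 1 ≤ trk k T := by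
  have hS := hT.subset hST
  have h := (matroid k K).eRk_insert_eq_add_one (e := x) (X := S)
    ⟨by simp, by rwa [← mem_relClosure]⟩
  have h1 := (matroid k K).eRk_mono (Set.insert_subset hxT hST)
  rw [h, ← coe_trk hS, ← coe_trk hT] at h1
  exact_mod_cast h1

/-- Additivity of the rank means that a transcendence basis of `S` together with `U` is independent.
Hence `U` is independent over the algebra generated by that basis, and so over its algebraic
closure. -/
theorem algebraicIndependent_relClosure {S U : Set K} (hS : S.Finite) (hU : U.Finite)
    (h : trk k (S ∪ U) = trk k S + U.ncard) :
    AlgebraicIndependent (relClosure k S) ((↑) : U → K) := by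
  obtain ⟨I, hI⟩ := (matroid k K).exists_isBasis S
  have hIf : I.Finite := hS.subset hI.subset
  have hc : ((matroid k K).eRk (I ∪ U)) = I.encard + U.encard := by
    rw [hI.eRk_eq_eRk_union, hI.encard_eq_eRk, ← coe_trk hS, ← coe_trk (hS.union hU), h,
      ← hU.cast_ncard_eq]
    rfl
  have hle : I.encard + U.encard ≤ (I ∪ U).encard := by
    rw [← hc]
    exact (matroid k K).eRk_le_encard _
  have hdisj : Disjoint I U := by
    have h1 := Set.encard_union_add_encard_inter I U
    have h2 : (I ∩ U).encard = 0 := by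
      have hfin : (I ∪ U).Finite := hIf.union hU
      have hfin2 : (I ∩ U).Finite := hIf.inter_of_left U
      rw [← hIf.cast_ncard_eq, ← hU.cast_ncard_eq, ← hfin.cast_ncard_eq] at hle h1
      rw [← hfin2.cast_ncard_eq] at h1 ⊢
      norm_cast at *
      omega
    rw [Set.encard_eq_zero] at h2
    exact Set.disjoint_iff_inter_eq_empty.2 h2
  have hind : (matroid k K).Indep (I ∪ U) := by
    rw [Matroid.indep_iff_eRk_eq_encard_of_finite (hIf.union hU), hc,
      Set.encard_union_eq hdisj]
  rw [matroid_indep_iff] at hind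
  have h1 : AlgebraicIndependent (Algebra.adjoin k I) ((↑) : U → K) := by
    have h2 := hind.adjoin_of_disjoint (s := {x | (x : K) ∈ I}) (t := {x | (x : K) ∈ U})
      (Set.disjoint_left.2 fun x h3 h4 => Set.disjoint_left.1 hdisj h3 h4)
    have himg : (fun i : ↥(I ∪ U) => id (i : K)) '' {x | (x : K) ∈ I} = I := by
      ext x
      constructor
      · rintro ⟨y, hy, rfl⟩
        exact hy
      · intro hx
        exact ⟨⟨x, Or.inl hx⟩, hx, rfl⟩
    rw [himg] at h2
    exact h2.comp (fun x : U => ⟨⟨x, Or.inr x.2⟩, x.2⟩) (fun x y hxy => by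
      simpa [Subtype.ext_iff] using hxy)
  have hle' : Algebra.adjoin k I ≤ (relClosure k S).toSubalgebra :=
    Algebra.adjoin_le (hI.subset.trans (subset_relClosure k S))
  let _ : Algebra (Algebra.adjoin k I) (relClosure k S) :=
    (Subalgebra.inclusion hle').toRingHom.toAlgebra
  have : IsScalarTower (Algebra.adjoin k I) (relClosure k S) K :=
    IsScalarTower.of_algebraMap_eq' rfl
  have : Algebra.IsAlgebraic (Algebra.adjoin k I) (relClosure k S) := by
    constructor
    intro x
    have hx := x.2
    rw [mem_relClosure, ← hI.closure_eq_closure, matroid_closure_eq] at hx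
    exact (isAlgebraic_algHom_iff (IsScalarTower.toAlgHom (Algebra.adjoin k I) (relClosure k S) K)
      Subtype.val_injective).1 hx
  exact h1.extendScalars _

theorem exists_subset_trk_union_eq {S P : Set K} (hS : S.Finite) (hP : P.Finite) :
    ∃ U ⊆ P, trk k (S ∪ U) = trk k (S ∪ P) ∧ trk k (S ∪ P) = trk k S + U.ncard ∧
      P ⊆ relClosure k (S ∪ U) := by
  obtain ⟨I, hI⟩ := (matroid k K).exists_isBasis S
  obtain ⟨J, hJ, hIJ⟩ := hI.indep.subset_isBasis_of_subset
    (hI.subset.trans (Set.subset_union_left : S ⊆ S ∪ P))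
  have hJf : J.Finite := (hS.union hP).subset hJ.subset
  have hIf := hS.subset hI.subset
  have hJS : J ⊆ S ∪ (J \ I) := by
    intro x hx
    by_cases h : x ∈ I
    · exact Or.inl (hI.subset h)
    · exact Or.inr ⟨hx, h⟩
  have hUP : J \ I ⊆ P := by
    rintro x ⟨hxJ, hxI⟩
    rcases hJ.subset hxJ with h | h
    · exact absurd (hI.mem_of_insert_indep h (hJ.indep.subset (Set.insert_subset hxJ hIJ))) hxI
    · exact h
  have hcl : S ∪ P ⊆ relClosure k (S ∪ (J \ I)) := by
    rw [coe_relClosure]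
    exact hJ.subset_closure.trans ((matroid k K).closure_subset_closure hJS)
  refine ⟨J \ I, hUP, ?_, ?_, Set.subset_union_right.trans hcl⟩
  · apply le_antisymm
    · exact trk_mono (hS.union hP) (Set.union_subset_union_right S hUP)
    · exact trk_le_of_subset_relClosure (hS.union (hP.subset hUP)) hcl
  · have h1 := hJ.encard_eq_eRk
    have h2 := hI.encard_eq_eRk
    rw [← coe_trk (hS.union hP), ← hJf.cast_ncard_eq] at h1
    rw [← coe_trk hS, ← hIf.cast_ncard_eq] at h2
    have h3 := Set.ncard_sdiff_add_ncard_of_subset hIJ hJf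
    norm_cast at h1 h2
    omega

/-- A linear relation over a field determines some of its coefficients. -/
theorem trk_union_range_add_le {S : Set K} (hS : S.Finite) {ι : Type*} [Fintype ι] (w c : ι → K)
    (B : Finset ι) (a : ι → ι → K) (E : IntermediateField k K)
    (hB : LinearIndependent E (fun β : B => w β))
    (haS : ∀ i j, a i j ∈ relClosure k S) (haE : ∀ i j, a i j ∈ E)
    (hw : ∀ i ∉ B, w i = ∑ β ∈ B, a i β * w β) (hc : ∀ i, c i ∈ E) (hsum : ∑ i, c i * w i = 0) :
    trk k (S ∪ Set.range c) + B.card ≤ trk k S + Fintype.card ι := by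
  classical
  -- Rewriting the relation in the independent family `w β` makes every coefficient vanish, so the
  -- `c β` with `β ∈ B` depend on the other `c i` and on `S`.
  have hcoef : ∀ β ∈ B, c β = - ∑ i ∈ Bᶜ, c i * a i β := by
    have h1 : ∑ β ∈ B, (c β + ∑ i ∈ Bᶜ, c i * a i β) * w β = 0 := by
      rw [← Finset.sum_add_sum_compl B] at hsum
      rw [← hsum]
      simp_rw [add_mul, Finset.sum_add_distrib, Finset.sum_mul]
      congr 1
      rw [Finset.sum_comm]
      refine Finset.sum_congr rfl fun i hi => ?_
      rw [hw i (Finset.mem_compl.1 hi), Finset.mul_sum]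
      simp_rw [mul_assoc]
    rw [Fintype.linearIndependent_iff] at hB
    intro β hβ
    have h2 := hB (fun β => ⟨c β + ∑ i ∈ Bᶜ, c i * a i β,
      add_mem (hc _) (sum_mem fun i _ => mul_mem (hc i) (haE i β))⟩) (by
        rw [← h1, ← Finset.sum_coe_sort B]
        rfl) ⟨β, hβ⟩
    have h3 := congrArg Subtype.val h2
    exact eq_neg_of_add_eq_zero_left h3
  have hsub : S ∪ Set.range c ⊆ relClosure k (S ∪ c '' (Bᶜ : Finset ι)) := by
    have hS1 : S ⊆ relClosure k (S ∪ c '' (Bᶜ : Finset ι)) :=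
      Set.subset_union_left.trans (subset_relClosure k _)
    have hc1 : ∀ i ∈ Bᶜ, c i ∈ relClosure k (S ∪ c '' (Bᶜ : Finset ι)) := fun i hi =>
      subset_relClosure k _ (Or.inr ⟨i, hi, rfl⟩)
    refine Set.union_subset hS1 ?_
    rintro _ ⟨i, rfl⟩
    by_cases hi : i ∈ B
    · rw [SetLike.mem_coe, hcoef i hi]
      exact neg_mem (sum_mem fun j hj => mul_mem (hc1 j hj) (relClosure_mono k hS1 (haS j i)))
    · exact hc1 i (Finset.mem_compl.2 hi)
  have hfin : (c '' (Bᶜ : Finset ι)).Finite := (Finset.finite_toSet _).image _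
  have h1 := trk_le_of_subset_relClosure (hS.union hfin) hsub
  have h2 := trk_union_le hS hfin (k := k)
  have h3 : (c '' (Bᶜ : Finset ι)).ncard ≤ (Bᶜ : Finset ι).card := by
    rw [← Set.ncard_coe_finset]
    exact Set.ncard_image_le (Finset.finite_toSet _)
  have h4 := Finset.card_compl_add_card B
  omega

end Rank

/-! ### Monomials in field elements -/

section Monomials

variable {E K : Type*} [Field E] [Field K] [Algebra E K]

theorem prod_pow_mem_pow {κ : Type*} (W : Submodule E K) (g : κ → K) (hg : ∀ i, g i ∈ W)
    (e : κ → ℕ) (s : Finset κ) : ∏ i ∈ s, g i ^ e i ∈ W ^ (∑ i ∈ s, e i) := by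
  classical
  induction s using Finset.induction_on with
  | empty => simp [Submodule.one_le.1 le_rfl]
  | insert a s ha ih =>
    rw [Finset.prod_insert ha, Finset.sum_insert ha, pow_add]
    exact Submodule.mul_mem_mul (Submodule.pow_mem_pow W (hg a) _) ih

/-- As `1 ∈ W`, the power `W ^ j` contains all monomials in `u` of degree at most `j`, and these are
linearly independent. -/
theorem choose_le_finrank_pow {τ : Type*} [Fintype τ] (W : Submodule E K) [FiniteDimensional E W]
    (h1 : (1 : K) ∈ W) (u : τ → K) (hu : AlgebraicIndependent E u) (huW : ∀ t, u t ∈ W) (j : ℕ) :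
    (Fintype.card τ + j).choose j ≤ Module.finrank E (W ^ j : Submodule E K) := by
  classical
  have hfin : FiniteDimensional E (W ^ j : Submodule E K) :=
    Module.Finite.iff_fg.2 (Submodule.FG.pow (Module.Finite.iff_fg.1 inferInstance) j)
  -- The index `none` stands for the element 1 and homogenizes monomials of degree at most `j`.
  let A := (Finset.univ : Finset (Option τ)).finsuppAntidiag j
  let v : A → K := fun e => aeval u (monomial (e.1.some) (1 : E))
  have hv : LinearIndependent E v := by
    have h2 : Function.Injective (fun e : A => (e.1 : Option τ →₀ ℕ).some) := by
      intro e f hef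
      have he := (Finset.mem_finsuppAntidiag.1 e.2).1
      have hf := (Finset.mem_finsuppAntidiag.1 f.2).1
      rw [Fintype.sum_option] at he hf
      have h3 : ∀ t, e.1 (some t) = f.1 (some t) := fun t => DFunLike.congr_fun hef t
      refine Subtype.ext (Finsupp.ext fun o => ?_)
      cases o with
      | none =>
        simp_rw [h3] at he
        omega
      | some t => exact h3 t
    have h3 := ((basisMonomials τ E).linearIndependent.comp _ h2).map'
      (aeval u : MvPolynomial τ E →ₐ[E] K).toLinearMap
      (LinearMap.ker_eq_bot.2 hu)
    exact h3
  have hmem : ∀ e, v e ∈ W ^ j := by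
    intro e
    have he := (Finset.mem_finsuppAntidiag.1 e.2).1
    have h4 := prod_pow_mem_pow W (fun o : Option τ => o.elim 1 u)
      (fun o => by cases o with
        | none => exact h1
        | some t => exact huW t) (fun o => e.1 o) Finset.univ
    rw [he, Fintype.prod_option] at h4
    simp only [Option.elim_none, one_pow, one_mul, Option.elim_some] at h4
    convert h4
    simp only [v, aeval_monomial, map_one, one_mul]
    rw [Finsupp.prod_fintype _ _ (by simp)]
    rfl
  have hli : LinearIndependent E (fun e : A => (⟨v e, hmem e⟩ : (W ^ j : Submodule E K))) :=
    LinearIndependent.of_comp (Submodule.subtype _) hv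
  have h5 := hli.fintype_card_le_finrank
  rw [Fintype.card_coe, Finset.card_finsuppAntidiag_nat_eq_choose, Finset.card_univ,
    Fintype.card_option, show Fintype.card τ + 1 + j - 1 = Fintype.card τ + j by omega] at h5
  exact h5

theorem span_monomials_eq_pow {κ : Type*} [Fintype κ] (y : κ → K) (j : ℕ) :
    Submodule.span E (Set.range fun e : {e : κ → ℕ // ∑ i, e i = j} => ∏ i, y i ^ e.1 i) =
      Submodule.span E (Set.range y) ^ j := by
  classical
  apply le_antisymm
  · rw [Submodule.span_le]
    rintro _ ⟨e, rfl⟩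
    have := prod_pow_mem_pow (Submodule.span E (Set.range y)) y
      (fun i => Submodule.subset_span ⟨i, rfl⟩) e.1 Finset.univ
    rwa [e.2] at this
  · induction j with
    | zero =>
      rw [pow_zero, Submodule.one_le]
      exact Submodule.subset_span ⟨⟨0, by simp⟩, by simp⟩
    | succ j ih =>
      rw [pow_succ]
      refine (mul_le_mul_left ih _).trans ?_
      rw [Submodule.span_mul_span, Submodule.span_le]
      rintro _ ⟨_, ⟨e, rfl⟩, _, ⟨k, rfl⟩, rfl⟩
      refine Submodule.subset_span ⟨⟨e.1 + Pi.single k 1, ?_⟩, ?_⟩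
      · simp [Finset.sum_add_distrib, e.2]
      · simp only [Pi.add_apply, pow_add, Finset.prod_mul_distrib]
        congr 1
        rw [Finset.prod_eq_single k]
        · simp
        · intro b _ hb
          simp [hb]
        · simp

/-- A basis of the span of a finite family, extracted from the family, with the coordinates of the
members of the family. -/
theorem exists_finset_linearIndependent {V : Type*} [AddCommGroup V] [Module E V] {ι : Type*}
    [Fintype ι] (w : ι → V) (B₀ : Finset ι) (hB₀ : LinearIndepOn E w (B₀ : Set ι)) :
    ∃ B : Finset ι, B₀ ⊆ B ∧ LinearIndependent E (fun β : B => w β) ∧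
      B.card = Module.finrank E (Submodule.span E (Set.range w)) ∧
      ∃ a : ι → ι → E, ∀ i, w i = ∑ β ∈ B, a i β • w β := by
  classical
  obtain ⟨b, -, hb0, hspan, hb⟩ := exists_linearIndepOn_extension hB₀ (Set.subset_univ _)
  let B : Finset ι := b.toFinset
  have hBb : (B : Set ι) = b := by simp [B]
  have hli : LinearIndependent E (fun β : B => w β) := by
    rw [← hBb] at hb
    exact hb
  have hsp : Submodule.span E (Set.range w) = Submodule.span E (Set.range fun β : B => w β) := by
    apply le_antisymm
    · rw [Submodule.span_le, ← Set.image_univ]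
      refine hspan.trans ?_
      rw [← hBb, Set.image_eq_range]
      exact le_rfl
    · apply Submodule.span_mono
      rintro _ ⟨β, rfl⟩
      exact ⟨_, rfl⟩
  have hcoord : ∀ i, ∃ a : ι → E, w i = ∑ β ∈ B, a β • w β := by
    intro i
    have h1 : w i ∈ Submodule.span E (w '' (B : Set ι)) := by
      rw [hBb]
      exact hspan ⟨i, trivial, rfl⟩
    obtain ⟨a, ha⟩ := (Submodule.mem_span_image_finset_iff_exists_fun E).1 h1
    refine ⟨fun β => if h : β ∈ B then a ⟨β, h⟩ else 0, ?_⟩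
    rw [← ha, ← Finset.sum_coe_sort B]
    refine Finset.sum_congr rfl fun β _ => ?_
    simp
  choose a ha using hcoord
  refine ⟨B, ?_, hli, ?_, a, ha⟩
  · rw [← Finset.coe_subset, hBb]
    exact hb0
  · rw [hsp, finrank_span_eq_card hli, Fintype.card_coe]

end Monomials

/-! ### The cost in rank of a linear relation between monomials -/

section RankStep

theorem isAlgebraic_of_forall_mem {k E K : Type*} [Field k] [Field E] [Field K] [Algebra k K]
    [Algebra E K] (L : IntermediateField k K) (L' : IntermediateField E K)
    (h : ∀ x ∈ L, x ∈ L') {x : K} (hx : IsAlgebraic L x) : IsAlgebraic L' x := by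
  let f : L →+* L' := L.toSubfield.subtype.codRestrict L' (fun x => h x x.2)
  let _ : Algebra L L' := f.toAlgebra
  have : IsScalarTower L L' K := IsScalarTower.of_algebraMap_eq' rfl
  exact hx.tower_top L'

theorem isAlgebraic_adjoin_of_mem_relClosure_union {k K : Type*} [Field k] [Field K] [Algebra k K]
    {S U : Set K} (E : IntermediateField k K) (hE : S ⊆ E) {x : K}
    (hx : x ∈ relClosure k (S ∪ U)) : IsAlgebraic (IntermediateField.adjoin E U) x := by
  refine isAlgebraic_of_forall_mem _ _ ?_ ((mem_relClosure_iff_isAlgebraic k).1 hx)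
  have hle : IntermediateField.adjoin k (S ∪ U) ≤
      (IntermediateField.adjoin E U).restrictScalars k := by
    rw [IntermediateField.adjoin_le_iff]
    apply Set.union_subset
    · intro s hs
      exact IntermediateField.algebraMap_mem (IntermediateField.adjoin E U) ⟨s, hE hs⟩
    · exact IntermediateField.subset_adjoin _ _
  exact fun x hx => hle hx

variable {k K : Type*} [Field k] [Field K] [Algebra k K]

/-- A basis of the `E`-span of the `w i` remains independent over `E'` by linear disjointness, so
the relation determines as many of the `c i` as the basis has elements. -/
theorem trk_union_range_add_finrank_le {S U : Set K} (hS : S.Finite) {ι : Type*} [Fintype ι]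
    (w c : ι → K) (E E' : IntermediateField k K) [IsAlgClosed E] (hEE' : E ≤ E')
    (hE : ∀ x ∈ E, x ∈ relClosure k S) (hc : ∀ i, c i ∈ E')
    (hind : AlgebraicIndependent E' ((↑) : U → K))
    (hw : ∀ i, IsAlgebraic (IntermediateField.adjoin E U) (w i))
    (hsum : ∑ i, c i * w i = 0) :
    trk k (S ∪ Set.range c) + Module.finrank E (Submodule.span E (Set.range w)) ≤
      trk k S + Fintype.card ι := by
  classical
  obtain ⟨B, -, hli, hcard, a, ha⟩ := exists_finset_linearIndependent (E := E) w ∅ (by simp)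
  let _ : Algebra E E' := (IntermediateField.inclusion hEE').toRingHom.toAlgebra
  have : IsScalarTower E E' K := IsScalarTower.of_algebraMap_eq' rfl
  have hli' := linearIndependent_of_algebraicIndependent (E := E)
    (E' := E') ((↑) : U → K) hind (fun β : B => w β)
    (fun β => by rw [Subtype.range_coe]; exact hw β) hli
  rw [← hcard]
  exact trk_union_range_add_le hS w c B (fun i β => (a i β : K))
    E' hli' (fun i β => hE _ (a i β).2) (fun i β => hEE' (a i β).2)
    (fun i _ => by
      conv_lhs => rw [ha i]
      rfl) hc hsum

/-- The rank drops by the dimension of the span of monomials, when the transcendence degree of the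
point does not drop. -/
theorem trk_step [IsAlgClosed K] {S : Set K} (hS : S.Finite) {κ ι : Type*} [Fintype κ] [Fintype ι] (y : κ → K)
    (w c : ι → K)
    (hw : ∀ i, ∀ L : IntermediateField k K, Set.range y ⊆ L → w i ∈ L)
    (hsum : ∑ i, c i * w i = 0)
    (hstay : trk k (S ∪ Set.range y) + trk k (S ∪ Set.range c) ≤
      trk k (S ∪ Set.range c ∪ Set.range y) + trk k S) :
    trk k (S ∪ Set.range c) +
      Module.finrank (relClosure k S) (Submodule.span (relClosure k S) (Set.range w)) ≤
      trk k S + Fintype.card ι := by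
  classical
  have hyf : (Set.range y).Finite := Set.finite_range y
  have hcf : (Set.range c).Finite := Set.finite_range c
  have hS' : (S ∪ Set.range c).Finite := hS.union hcf
  obtain ⟨U, hUP, hU1, hU2, hU3⟩ := exists_subset_trk_union_eq (k := k) hS hyf
  have hUf := hyf.subset hUP
  have hle : relClosure k S ≤ relClosure k (S ∪ Set.range c) :=
    relClosure_mono k (Set.subset_union_left.trans (subset_relClosure k _))
  -- The transcendence basis `U` of `y` over `S` stays independent after adjoining `c`, precisely
  -- because the transcendence degree of `y` has not dropped.
  have hrk : trk k (S ∪ Set.range c ∪ U) = trk k (S ∪ Set.range c) + U.ncard := by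
    apply le_antisymm (trk_union_le hS' hUf)
    have h1 : trk k (S ∪ Set.range c ∪ Set.range y) ≤ trk k (S ∪ Set.range c ∪ U) := by
      refine trk_le_of_subset_relClosure (hS'.union hUf) (Set.union_subset
        (Set.subset_union_left.trans (subset_relClosure k _)) (hU3.trans ?_))
      exact relClosure_mono k ((Set.union_subset_union_left U Set.subset_union_left).trans
        (subset_relClosure k _))
    omega
  exact trk_union_range_add_finrank_le hS w c _ _ hle (fun _ => id)
    (fun i => subset_relClosure k _ (Or.inr ⟨i, rfl⟩))
    (algebraicIndependent_relClosure hS' hUf hrk)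
    (fun i => isAlgebraic_adjoin_of_mem_relClosure_union _ (subset_relClosure k S) (hw i _ hU3))
    hsum

end RankStep

/-! ### Ranks of the coefficients of forms with a given zero -/

section RankChain

variable {k K : Type*} [Field k] [Field K] [Algebra k K]

theorem relClosure_le {S : Set K} {F : IntermediateField k K} (h : S ⊆ F)
    (hF : ∀ x : K, IsAlgebraic F x → x ∈ F) : relClosure k S ≤ F :=
  relClosure_le_of_isAlgebraic k h hF

theorem span_monomials_eq_pow_of_range_eq {E : Type*} [Field E] [Algebra E K] {κ ι : Type*}
    [Fintype κ] (y : κ → K) (j : ℕ) (e : ι → κ → ℕ) (he : Set.range e = {f | ∑ i, f i = j}) :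
    Submodule.span E (Set.range fun i => ∏ l, y l ^ e i l) =
      Submodule.span E (Set.range y) ^ j := by
  rw [← span_monomials_eq_pow]
  congr 1
  ext x
  constructor
  · rintro ⟨i, rfl⟩
    exact ⟨⟨e i, he.subset ⟨i, rfl⟩⟩, rfl⟩
  · rintro ⟨f, rfl⟩
    obtain ⟨i, hi⟩ := he.superset f.2
    exact ⟨i, by simp only [hi]⟩

/-- Descending chain of rank estimates, in degrees `2 ≤ j < D`. -/
theorem trk_chain_le [IsAlgClosed K] (F : IntermediateField k K)
    (hF : ∀ x : K, IsAlgebraic F x → x ∈ F) {κ : Type*} [Fintype κ] (y : κ → K) (m l : κ)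
    (hm : y m = 1) (hl : y l ∉ F) (b D : ℕ) (hb : 1 ≤ b) (hbD : b + 2 ≤ D)
    {ι : ℕ → Type*} [∀ j, Fintype (ι j)] (e : ∀ j, ι j → κ → ℕ)
    (he : ∀ j < D, Set.range (e j) = {f | ∑ i, f i = j}) (c : ∀ j, ι j → K)
    (hcF : ∀ j < D, ∀ i, c j i ∈ F)
    (hsum : ∀ j, 2 ≤ j → j < D → ∑ i, c j i * ∏ a, y a ^ e j i a = 0)
    (S : ℕ → Set K) (hS1 : (S 1).Finite) (hS1F : S 1 ⊆ F)
    (hS : ∀ j, 1 ≤ j → S (j + 1) = S j ∪ Set.range (c (j + 1)))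
    (hfr : ∀ E : IntermediateField k K, S 1 ⊆ E → E ≤ F →
      Module.finrank E (Submodule.span E (Set.range y)) = b + 1)
    (hrk : trk k (S 1 ∪ Set.range y) ≤ trk k (S 1) + b) :
    2 * (trk k (S (D - 1)) : ℤ) + ((D : ℤ) ^ 2 - 3 * D + 6 + 2 * (b + 1) * (D - 2 - b)) ≤
      2 * trk k (S 1) + 2 * ∑ j ∈ Finset.Ico 2 D, (Fintype.card (ι j) : ℤ) := by
  classical
  have hPf : (Set.range y).Finite := Set.finite_range y
  have hfin : ∀ j, 1 ≤ j → (S j).Finite := by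
    intro j hj
    induction j, hj using Nat.le_induction with
    | base => exact hS1
    | succ j hj ih =>
      rw [hS j hj]
      exact ih.union (Set.finite_range _)
  have hSF : ∀ j, 1 ≤ j → j < D → S j ⊆ F := by
    intro j hj
    induction j, hj using Nat.le_induction with
    | base => exact fun _ => hS1F
    | succ j hj ih =>
      intro hD
      rw [hS j hj]
      refine Set.union_subset (ih (by omega)) ?_
      rintro _ ⟨i, rfl⟩
      exact hcF _ hD i
  have hS1S : ∀ j, 1 ≤ j → S 1 ⊆ S j := by
    intro j hj
    induction j, hj using Nat.le_induction with
    | base => exact subset_rfl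
    | succ j hj ih =>
      rw [hS j hj]
      exact ih.trans Set.subset_union_left
  have hclF : ∀ j, 1 ≤ j → j < D → relClosure k (S j) ≤ F := fun j hj hD =>
    relClosure_le (hSF j hj hD) hF
  -- The transcendence degree of `y` over the coefficients known before degree `j`. A step at which
  -- it drops is credited no cost; otherwise the cost is the dimension of the span of the monomials
  -- of degree `j`.
  let t : ℕ → ℕ := fun j => trk k (S (j - 1) ∪ Set.range y) - trk k (S (j - 1))
  let cost : ℕ → ℕ := fun j => if t (j + 1) + 1 ≤ t j then 0 else
    Module.finrank (relClosure k (S (j - 1)))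
      (Submodule.span (relClosure k (S (j - 1))) (Set.range y) ^ j :
        Submodule (relClosure k (S (j - 1))) K)
  have hmono : ∀ j, 1 ≤ j → trk k (S j) ≤ trk k (S j ∪ Set.range y) := fun j hj =>
    trk_mono ((hfin j hj).union hPf) Set.subset_union_left
  have hfr' : ∀ j, 1 ≤ j → j < D → Module.finrank (relClosure k (S j))
      (Submodule.span (relClosure k (S j)) (Set.range y)) = b + 1 := fun j hj hD =>
    hfr _ ((hS1S j hj).trans (subset_relClosure k _)) (hclF j hj hD)
  have htle : ∀ j, 2 ≤ j → j < D → t (j + 1) ≤ t j := by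
    intro j hj hD
    obtain ⟨i, rfl⟩ : ∃ i, j = i + 1 := ⟨j - 1, by omega⟩
    have h1 := trk_submodular (k := k) (hfin i (by omega)) (hfin (i + 1) (by omega)) hPf
      (by rw [hS i (by omega)]; exact Set.subset_union_left)
    have h2 := hmono i (by omega)
    simp only [t, Nat.add_sub_cancel]
    omega
  have hstep : ∀ j, 2 ≤ j → j < D →
      trk k (S j) + cost j ≤ trk k (S (j - 1)) + Fintype.card (ι j) := by
    intro j hj hD
    obtain ⟨i, rfl⟩ : ∃ i, j = i + 1 := ⟨j - 1, by omega⟩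
    rw [Nat.add_sub_cancel, hS i (by omega)]
    by_cases h : t (i + 1 + 1) + 1 ≤ t (i + 1)
    · simp only [cost, if_pos h, add_zero]
      refine (trk_union_le (hfin i (by omega)) (Set.finite_range _)).trans ?_
      gcongr
      have h1 := Set.ncard_image_le (f := c (i + 1)) (Set.finite_univ (α := ι (i + 1)))
      rwa [Set.image_univ, Set.ncard_univ, Nat.card_eq_fintype_card] at h1
    · simp only [cost, if_neg h]
      rw [← span_monomials_eq_pow_of_range_eq y (i + 1) (e (i + 1)) (he _ hD)]
      refine trk_step (hfin i (by omega)) y _ _ ?_ (hsum _ hj hD) ?_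
      · intro a L hL
        exact prod_mem fun x _ => pow_mem (hL ⟨x, rfl⟩) _
      · rw [← hS i (by omega)]
        simp only [t, Nat.add_sub_cancel] at h
        have h2 := hmono i (by omega)
        have h3 := hmono (i + 1) (by omega)
        omega
  have hnum := codim_le_sum_cost b D hb hbD t cost ?_ ?_ ?_
  · have htel : ∀ J, 2 ≤ J → J ≤ D → trk k (S (J - 1)) + ∑ j ∈ Finset.Ico 2 J, cost j ≤
        trk k (S 1) + ∑ j ∈ Finset.Ico 2 J, Fintype.card (ι j) := by
      intro J hJ
      induction J, hJ using Nat.le_induction with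
      | base => simp
      | succ J hJ ih =>
        intro hD
        rw [Finset.sum_Ico_succ_top hJ, Finset.sum_Ico_succ_top hJ, Nat.add_sub_cancel]
        have h1 := ih (by omega)
        have h2 := hstep J hJ (by omega)
        omega
    have h1 := htel D (by omega) le_rfl
    have h2 : (trk k (S (D - 1)) : ℤ) + ∑ j ∈ Finset.Ico 2 D, (cost j : ℤ) ≤
        trk k (S 1) + ∑ j ∈ Finset.Ico 2 D, (Fintype.card (ι j) : ℤ) := by exact_mod_cast h1
    linarith
  · intro j hj hD
    -- All coefficients are in the algebraically closed `F` and `y l` is not, so `y` never becomes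
    -- algebraic over them.
    have h1 := trk_lt_of_notMem (k := k) (S := S (j - 1)) (x := y l)
      ((hfin (j - 1) (by omega)).union hPf) Set.subset_union_left (Or.inr ⟨l, rfl⟩)
      (fun h => hl (hclF (j - 1) (by omega) (by omega) h))
    simp only [t]
    omega
  · simp only [t]
    have : 2 - 1 = 1 := rfl
    rw [this]
    omega
  · intro j hj hD
    by_cases h : t (j + 1) + 1 ≤ t j
    · exact Or.inl h
    · right
      obtain ⟨i, rfl⟩ : ∃ i, j = i + 1 := ⟨j - 1, by omega⟩
      refine ⟨htle _ hj hD, ?_⟩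
      simp only [cost, if_neg h]
      have hW := hfr' i (by omega) (by omega)
      have hWf : FiniteDimensional (relClosure k (S i))
          (Submodule.span (relClosure k (S i)) (Set.range y)) :=
        FiniteDimensional.span_of_finite _ hPf
      refine ⟨mul_add_one_le_finrank_pow _ hW _, ?_⟩
      obtain ⟨U, hUP, hU1, hU2, -⟩ := exists_subset_trk_union_eq (k := k) (hfin i (by omega)) hPf
      have hUf := hPf.subset hUP
      have hUfin : Fintype U := hUf.fintype
      have hind := algebraicIndependent_relClosure (hfin i (by omega)) hUf (by rw [hU1, hU2])
      have h1 := choose_le_finrank_pow (Submodule.span (relClosure k (S i)) (Set.range y))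
        (Submodule.subset_span ⟨m, hm⟩) _ hind (fun x => Submodule.subset_span (hUP x.2)) (i + 1)
      have h2 : t (i + 1) = Fintype.card U := by
        simp only [t, Nat.add_sub_cancel]
        rw [hU2, Nat.add_sub_cancel_left, ← Nat.card_eq_fintype_card]
        rfl
      rw [h2]
      exact h1

/-- Equations of the span of a point, over a subfield: a set `S` of coefficients generating a field
over which the point spans a space of the same dimension `b + 1`. -/
theorem exists_coefficients (F : IntermediateField k K) {κ : Type*} [Fintype κ] (y : κ → K)
    (m l : κ) (hm : y m = 1) (hl : y l ∉ F) :
    ∃ (b : ℕ) (S : Set K), S.Finite ∧ S ⊆ F ∧ 1 ≤ b ∧ b + 1 ≤ Fintype.card κ ∧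
      trk k S ≤ (b + 1) * (Fintype.card κ - (b + 1)) ∧
      (∀ E : IntermediateField k K, S ⊆ E → E ≤ F →
        Module.finrank E (Submodule.span E (Set.range y)) = b + 1) ∧
      (∀ T : Set K, T.Finite → S ⊆ T → trk k (T ∪ Set.range y) ≤ trk k T + b) ∧
      ∀ c : κ → K, (∀ i, c i ∈ F) → ∑ i, c i * y i = 0 →
        trk k (S ∪ Set.range c) + (b + 1) ≤ trk k S + Fintype.card κ ∧
        ((∃ i, c i ≠ 0) → b + 2 ≤ Fintype.card κ) := by
  classical
  -- The basis is made to contain `y m = 1`: this member contributes nothing to the transcendence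
  -- degree of `y`, which is then at most `b`.
  obtain ⟨B, hmB, hli, -, a, ha⟩ := exists_finset_linearIndependent (E := F) y {m}
    (by
      rw [Finset.coe_singleton]
      exact LinearIndepOn.singleton (by rw [hm]; exact one_ne_zero))
  have hmB : m ∈ B := by simpa using hmB
  have hcard : 1 < B.card := by
    by_contra hcon
    have hB1 : B = {m} := by
      refine Finset.eq_singleton_iff_unique_mem.2 ⟨hmB, fun x hx => ?_⟩
      exact Finset.card_le_one.1 (not_lt.1 hcon) x hx m hmB
    apply hl
    rw [ha l, hB1, Finset.sum_singleton, hm, IntermediateField.smul_def, smul_eq_mul, mul_one]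
    exact (a l m).2
  obtain ⟨b, hbB⟩ : ∃ b, B.card = b + 1 := ⟨B.card - 1, by omega⟩
  -- Only the coordinates of the members outside the basis are kept: an affine chart of the
  -- Grassmannian.
  let S : Set K := (fun p : κ × κ => (a p.1 p.2 : K)) '' ((Bᶜ ×ˢ B : Finset (κ × κ)) : Set (κ × κ))
  have hSf : S.Finite := (Finset.finite_toSet _).image _
  have hSF : S ⊆ F := by
    rintro _ ⟨p, -, rfl⟩
    exact (a p.1 p.2).2
  have haS : ∀ i ∉ B, ∀ β ∈ B, (a i β : K) ∈ S := fun i hi β hβ =>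
    ⟨(i, β), by simp [hi, hβ], rfl⟩
  have hy : ∀ i, y i = ∑ β ∈ B, (a i β : K) * y β := fun i => by
    conv_lhs => rw [ha i]
    rfl
  refine ⟨b, S, hSf, hSF, by omega, hbB ▸ Finset.card_le_univ B, ?_, ?_, ?_, ?_⟩
  · refine (trk_le_ncard hSf).trans ((Set.ncard_image_le (Finset.finite_toSet _)).trans ?_)
    rw [Set.ncard_coe_finset, Finset.card_product, Finset.card_compl, hbB, mul_comm]
  · intro E hSE hEF
    have hliE : LinearIndependent E (fun β : B => y β) := by
      let _ : Algebra E F := (IntermediateField.inclusion hEF).toRingHom.toAlgebra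
      have : IsScalarTower E F K := IsScalarTower.of_algebraMap_eq' rfl
      exact hli.restrict_scalars (fun x y hxy => (IntermediateField.inclusion hEF).injective (by
        have h1 : algebraMap E F x * 1 = algebraMap E F y * 1 := by
          rw [← Algebra.smul_def, ← Algebra.smul_def]
          exact hxy
        rw [mul_one, mul_one] at h1
        exact h1))
    have hsp : Submodule.span E (Set.range y) = Submodule.span E (Set.range fun β : B => y β) := by
      apply le_antisymm
      · rw [Submodule.span_le]
        rintro _ ⟨i, rfl⟩
        by_cases hi : i ∈ B
        · exact Submodule.subset_span ⟨⟨i, hi⟩, rfl⟩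
        · rw [SetLike.mem_coe, hy i]
          refine Submodule.sum_mem _ fun β hβ => ?_
          exact Submodule.smul_mem _ (⟨a i β, hSE (haS i hi β hβ)⟩ : E)
            (Submodule.subset_span ⟨⟨β, hβ⟩, rfl⟩)
      · apply Submodule.span_mono
        rintro _ ⟨β, rfl⟩
        exact ⟨_, rfl⟩
    rw [hsp, finrank_span_eq_card hliE, Fintype.card_coe, hbB]
  · intro T hT hST
    have hU : (y '' (B.erase m : Finset κ)).Finite := (Finset.finite_toSet _).image _
    have hcl : ∀ β ∈ B, y β ∈ relClosure k (T ∪ y '' (B.erase m : Finset κ)) := by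
      intro β hβ
      by_cases h : β = m
      · rw [h, hm]
        exact one_mem _
      · exact subset_relClosure k _ (Or.inr ⟨β, by simp [h, hβ], rfl⟩)
    have hTcl : T ⊆ relClosure k (T ∪ y '' (B.erase m : Finset κ)) :=
      Set.subset_union_left.trans (subset_relClosure k _)
    have h1 : T ∪ Set.range y ⊆ relClosure k (T ∪ y '' (B.erase m : Finset κ)) := by
      refine Set.union_subset hTcl ?_
      rintro _ ⟨i, rfl⟩
      by_cases hi : i ∈ B
      · exact hcl i hi
      · rw [SetLike.mem_coe, hy i]
        exact sum_mem fun β hβ => mul_mem (hTcl (hST (haS i hi β hβ))) (hcl β hβ)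
    refine (trk_le_of_subset_relClosure (hT.union hU) h1).trans
      ((trk_union_le hT hU).trans ?_)
    gcongr
    refine (Set.ncard_image_le (Finset.finite_toSet _)).trans ?_
    rw [Set.ncard_coe_finset, Finset.card_erase_of_mem hmB, hbB, Nat.add_sub_cancel]
  · intro c hcF hsum
    constructor
    · have h1 := trk_union_range_add_le (k := k) hSf y c B
        (fun i β => if i ∉ B ∧ β ∈ B then (a i β : K) else 0) F hli
        (fun i β => by
          split_ifs with h
          · exact subset_relClosure k _ (haS i h.1 β h.2)
          · exact zero_mem _)
        (fun i β => by
          split_ifs with h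
          · exact (a i β).2
          · exact zero_mem _)
        (fun i hi => by
          conv_lhs => rw [hy i]
          refine Finset.sum_congr rfl fun β hβ => ?_
          rw [if_pos ⟨hi, hβ⟩]) hcF hsum
      rwa [hbB] at h1
    · rintro ⟨i, hi⟩
      by_contra hcon
      have h1 := Finset.card_le_univ B
      have hBu : B = Finset.univ := by
        rw [← Finset.card_eq_iff_eq_univ]
        omega
      subst hBu
      rw [Fintype.linearIndependent_iff] at hli
      have h2 := hli (fun β => ⟨c β, hcF β⟩) (by
        rw [← hsum, ← Finset.sum_coe_sort Finset.univ (fun i => c i * y i)]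
        rfl) ⟨i, Finset.mem_univ i⟩
      exact hi (congrArg Subtype.val h2)

end RankChain

/-! ### Exponents -/

section Exponents

variable {M : ℕ}

instance finite_exponent : Finite (Exponent M) := by
  refine Finite.of_injective
    (fun d : Exponent M => (⟨d.1, ?_⟩ : (Finset.univ : Finset (Fin (M + 1))).finsuppAntidiag M))
    fun d e h => Subtype.ext (by simpa using h)
  rw [Finset.mem_finsuppAntidiag]
  exact ⟨(Finsupp.degree_eq_sum d.1).symm.trans d.2, Finset.subset_univ _⟩

noncomputable instance fintypeExponent : Fintype (Exponent M) := Fintype.ofFinite _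

/-- Exponents `d` whose part outside the variable `i` has degree `j`. -/
abbrev FiberExponent (i : Fin (M + 1)) (j : ℕ) : Type := {d : Exponent M // d.1 i + j = M}

noncomputable instance fintypeFiberExponent (i : Fin (M + 1)) (j : ℕ) :
    Fintype (FiberExponent i j) := Fintype.ofFinite _

theorem exponent_sum (d : Exponent M) (i : Fin (M + 1)) :
    d.1 i + ∑ a : {a // a ≠ i}, d.1 a = M := by
  have h := d.2
  rwa [Finsupp.degree_eq_sum, Fintype.sum_eq_add_sum_subtype_ne _ i] at h

/-- The exponent with given part outside the variable `i`. -/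
noncomputable def mkExponent (i : Fin (M + 1)) (f : {a // a ≠ i} → ℕ) (hf : ∑ a, f a ≤ M) :
    Exponent M :=
  ⟨Finsupp.equivFunOnFinite.symm fun a => if h : a = i then M - ∑ a, f a else f ⟨a, h⟩, by
    rw [Finsupp.degree_eq_sum, Fintype.sum_eq_add_sum_subtype_ne _ i]
    have : ∀ a : {a // a ≠ i}, (Finsupp.equivFunOnFinite.symm
        fun a => if h : a = i then M - ∑ a, f a else f ⟨a, h⟩) a.1 = f a := by
      intro a
      simp [a.2]
    simp_rw [this]
    rw [Finsupp.equivFunOnFinite_symm_apply_apply, dif_pos rfl]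
    exact Nat.sub_add_cancel hf⟩

theorem mkExponent_self (i : Fin (M + 1)) (f : {a // a ≠ i} → ℕ) (hf : ∑ a, f a ≤ M) :
    (mkExponent i f hf).1 i = M - ∑ a, f a := by
  simp [mkExponent]

theorem mkExponent_ne (i : Fin (M + 1)) (f : {a // a ≠ i} → ℕ) (hf : ∑ a, f a ≤ M)
    (a : {a // a ≠ i}) : (mkExponent i f hf).1 a = f a := by
  simp [mkExponent, a.2]

theorem exponent_ext (i : Fin (M + 1)) {d e : Exponent M}
    (h : ∀ a : {a // a ≠ i}, d.1 a = e.1 a) : d = e := by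
  have h1 := exponent_sum d i
  have h2 := exponent_sum e i
  simp_rw [h] at h1
  refine Subtype.ext (Finsupp.ext fun a => ?_)
  by_cases ha : a = i
  · subst ha
    omega
  · exact h ⟨a, ha⟩

theorem range_fiberExponent (i : Fin (M + 1)) (j : ℕ) (hj : j ≤ M) :
    Set.range (fun (d : FiberExponent i j) (a : {a // a ≠ i}) => d.1.1 a) =
      {f | ∑ a, f a = j} := by
  ext f
  constructor
  · rintro ⟨d, rfl⟩
    have := exponent_sum d.1 i
    have := d.2
    simp only [Set.mem_ofPred_eq]
    omega
  · intro (hf : _ = _)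
    have hfM : ∑ a, f a ≤ M := hf.trans_le hj
    refine ⟨⟨mkExponent i f hfM, ?_⟩, ?_⟩
    · rw [mkExponent_self]
      omega
    · ext a
      exact mkExponent_ne i f hfM a

/-- The exponent of `X_i ^ (M - 1) * X_a`. -/
noncomputable def linExponent (hM : 1 ≤ M) (i : Fin (M + 1)) (a : {a // a ≠ i}) : FiberExponent i 1 :=
  ⟨mkExponent i (Pi.single a 1) (by simpa using hM), by
    rw [mkExponent_self]
    simp
    omega⟩

theorem linExponent_bijective (hM : 1 ≤ M) (i : Fin (M + 1)) :
    Function.Bijective (linExponent hM i) := by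
  constructor
  · intro a b hab
    by_contra hne
    have h1 := mkExponent_ne i (Pi.single a 1) (by simpa using hM) a
    have h2 := mkExponent_ne i (Pi.single b 1) (by simpa using hM) a
    have h3 : (linExponent hM i a).1.1 a = (linExponent hM i b).1.1 a := by rw [hab]
    simp only [linExponent] at h3
    rw [h1, h2] at h3
    simp [hne] at h3
  · intro d
    have h1 := exponent_sum d.1 i
    have h2 := d.2
    have h3 : ∑ a : {a // a ≠ i}, d.1.1 a = 1 := by omega
    obtain ⟨a, -, ha⟩ : ∃ a ∈ (Finset.univ : Finset {a // a ≠ i}), d.1.1 a ≠ 0 := by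
      apply Finset.exists_ne_zero_of_sum_ne_zero
      omega
    have h4 := Finset.add_sum_erase Finset.univ (fun a : {a // a ≠ i} => d.1.1 a)
      (Finset.mem_univ a)
    refine ⟨a, Subtype.ext (exponent_ext i fun b => ?_)⟩
    rw [linExponent, mkExponent_ne]
    by_cases hb : b = a
    · subst hb
      simp only [Pi.single_eq_same]
      omega
    · have h5 := Finset.single_le_sum (f := fun a : {a // a ≠ i} => d.1.1 a)
        (fun _ _ => Nat.zero_le _) (Finset.mem_erase.2 ⟨hb, Finset.mem_univ b⟩)
      rw [Pi.single_eq_of_ne hb]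
      omega

/-- Exponents are sorted by their degree outside `i`; there are `M` of degree 1 and at least one of
degree 0. -/
theorem sum_card_fiberExponent_le (hM : 1 ≤ M) (i : Fin (M + 1)) :
    1 + M + ∑ j ∈ Finset.Ico 2 (M + 1), Fintype.card (FiberExponent i j) ≤
      Fintype.card (Exponent M) := by
  classical
  have h1 : Fintype.card (Exponent M) =
      ∑ j ∈ Finset.range (M + 1), Fintype.card (FiberExponent i j) := by
    rw [← Finset.card_univ, Finset.card_eq_sum_card_fiberwise (f := fun d => M - d.1 i)
      (t := Finset.range (M + 1))]
    · refine Finset.sum_congr rfl fun j hj => ?_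
      rw [Finset.mem_range] at hj
      rw [Fintype.card_subtype]
      congr 1
      ext d
      have := exponent_sum d i
      simp only [Finset.mem_filter, Finset.mem_univ, true_and]
      omega
    · intro d _
      simp only [Finset.coe_range, Set.mem_Iio]
      omega
  have h2 : 0 < Fintype.card (FiberExponent i 0) := by
    rw [Fintype.card_pos_iff]
    refine ⟨⟨mkExponent i 0 (by simp), ?_⟩⟩
    rw [mkExponent_self]
    simp
  have h3 : Fintype.card (FiberExponent i 1) = M := by
    rw [← Fintype.card_of_bijective (linExponent_bijective hM i)]
    simp
  have h4 : ∑ j ∈ Finset.range (M + 1), Fintype.card (FiberExponent i j) =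
      Fintype.card (FiberExponent i 0) + (Fintype.card (FiberExponent i 1) +
        ∑ j ∈ Finset.Ico 2 (M + 1), Fintype.card (FiberExponent i j)) := by
    rw [Finset.range_eq_Ico, Finset.sum_eq_sum_Ico_succ_bot (by omega),
      Finset.sum_eq_sum_Ico_succ_bot (by omega)]
  rw [h1, h4, h3]
  omega

end Exponents

/-! ### The rank of the coefficients of a bad form -/

section BadForms

variable {k K : Type*} [Field k] [Field K] [Algebra k K] {M : ℕ}

/-- The part of degree `j` outside the variable `i` of the form with coefficients `u`, at `y`. -/
noncomputable def fiberForm {R : Type*} [CommRing R] (i : Fin (M + 1)) (u : Exponent M → R)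
    (j : ℕ) (y : {a // a ≠ i} → R) : R :=
  ∑ d : FiberExponent i j, u d.1 * ∏ a : {a // a ≠ i}, y a ^ d.1.1 a

theorem fiberForm_one {R : Type*} [CommRing R] (hM : 1 ≤ M) (i : Fin (M + 1)) (u : Exponent M → R)
    (y : {a // a ≠ i} → R) : fiberForm i u 1 y = ∑ a, u (linExponent hM i a).1 * y a := by
  rw [fiberForm, ← Function.Bijective.sum_comp (linExponent_bijective hM i)]
  refine Finset.sum_congr rfl fun a _ => ?_
  congr 1
  rw [Finset.prod_eq_single a]
  · rw [linExponent, mkExponent_ne]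
    simp
  · intro b _ hb
    rw [linExponent, mkExponent_ne]
    simp [hb]
  · simp

/-- The chain is used with `D = M`. The nonzero linear part forces `b + 2 ≤ M`, which is the range
in which the numerical estimate holds. -/
theorem two_mul_trk_range_add_le_of_smooth [IsAlgClosed K] (hM : 2 ≤ M) (F : IntermediateField k K)
    (hF : ∀ x : K, IsAlgebraic F x → x ∈ F) (i : Fin (M + 1)) (u : Exponent M → K)
    (huF : ∀ d, u d ∈ F) (y : {a // a ≠ i} → K) (m l : {a // a ≠ i}) (hm : y m = 1)
    (hl : y l ∉ F) (h0 : ∀ d : Exponent M, d.1 i = M → u d = 0)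
    (h1 : ∃ d : Exponent M, d.1 i + 1 = M ∧ u d ≠ 0)
    (hsum : ∀ j, 1 ≤ j → j < M → fiberForm i u j y = 0) :
    2 * (trk k (Set.range u) : ℤ) + ((M : ℤ) ^ 2 - 3 * M + 6) ≤
      2 * (Fintype.card (Exponent M) - 1) := by
  classical
  obtain ⟨b, S₀, hS₀, hS₀F, hb, hbn, hrk, hfr, hrkT, hrel⟩ := exists_coefficients F y m l hm hl
  have hcκ : Fintype.card {a // a ≠ i} = M := by simp
  rw [hcκ] at hbn hrk hrel
  let c₁ : {a // a ≠ i} → K := fun a => u (linExponent (by omega) i a).1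
  have hc₁ : ∃ a, c₁ a ≠ 0 := by
    obtain ⟨d, hd, hud⟩ := h1
    obtain ⟨a, ha⟩ := (linExponent_bijective (by omega) i).2 ⟨d, hd⟩
    refine ⟨a, ?_⟩
    simp only [c₁, ha]
    exact hud
  obtain ⟨hr1, hr2⟩ := hrel c₁ (fun a => huF _)
    (by rw [← fiberForm_one]; exact hsum 1 le_rfl (by omega))
  have hbM := hr2 hc₁
  let c : ∀ j, FiberExponent i j → K := fun j d => u d.1
  let S : ℕ → Set K := fun j => (S₀ ∪ Set.range c₁) ∪ ⋃ a ∈ Finset.Ico 2 (j + 1), Set.range (c a)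
  have hS1 : S 1 = S₀ ∪ Set.range c₁ := by
    simp only [S]
    rw [Finset.Ico_self]
    simp
  have hc₁F : Set.range c₁ ⊆ F := by
    rintro _ ⟨a, rfl⟩
    exact huF _
  have hSs : ∀ j, 1 ≤ j → S (j + 1) = S j ∪ Set.range (c (j + 1)) := by
    intro j hj
    simp only [S]
    rw [show Finset.Ico 2 (j + 1 + 1) = insert (j + 1) (Finset.Ico 2 (j + 1)) by
      ext; simp only [Finset.mem_Ico, Finset.mem_insert]; omega, Finset.set_biUnion_insert,
      Set.union_comm (Set.range _), ← Set.union_assoc]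
  have hS1f : (S 1).Finite := by
    rw [hS1]
    exact hS₀.union (Set.finite_range _)
  have hchain := trk_chain_le (k := k) F hF y m l hm hl b M hb hbM
    (fun (j : ℕ) (d : FiberExponent i j) (a : {a // a ≠ i}) => d.1.1 a)
    (fun j hj => range_fiberExponent i j hj.le) c (fun j _ d => huF _)
    (fun j h2 hj => hsum j (by omega) hj) S hS1f
    (by rw [hS1]; exact Set.union_subset hS₀F hc₁F) hSs
    (fun E hE hEF => hfr E (subset_trans (by rw [hS1]; exact Set.subset_union_left) hE) hEF)
    (hrkT _ hS1f (by rw [hS1]; exact Set.subset_union_left))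
  have hSf : (S (M - 1)).Finite := by
    refine (hS₀.union (Set.finite_range _)).union ?_
    exact Set.Finite.biUnion (Finset.finite_toSet _) fun _ _ => Set.finite_range _
  -- The part of degree `M` is not required to vanish at `y`, so all its coefficients are counted as
  -- free.
  have hlast : trk k (Set.range u) ≤ trk k (S (M - 1)) + Fintype.card (FiberExponent i M) := by
    have hcf : (Set.range (c M)).Finite := Set.finite_range _
    have h2 := trk_union_le (k := k) hSf hcf
    have h3 : (Set.range (c M)).ncard ≤ Fintype.card (FiberExponent i M) := by
      rw [← Set.image_univ, ← Nat.card_eq_fintype_card, ← Set.ncard_univ]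
      exact Set.ncard_image_le Set.finite_univ
    refine le_trans (trk_le_of_subset_relClosure (hSf.union hcf) ?_) (h2.trans (by gcongr))
    rintro _ ⟨d, rfl⟩
    have hd := exponent_sum d i
    rcases Nat.lt_or_ge (d.1 i) (M - 1) with h | h
    · refine subset_relClosure k _ ?_
      rcases Nat.eq_zero_or_pos (d.1 i) with h0 | h0
      · exact Or.inr ⟨⟨d, by omega⟩, rfl⟩
      · refine Or.inl (Or.inr ?_)
        rw [Set.mem_iUnion₂]
        exact ⟨M - d.1 i, by rw [Finset.mem_Ico]; omega, ⟨d, by omega⟩, rfl⟩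
    · rcases Nat.lt_or_ge (d.1 i) M with h5 | h5
      · refine subset_relClosure k _ (Or.inl (Or.inl (Or.inr ?_)))
        obtain ⟨a, ha⟩ := (linExponent_bijective (by omega) i).2 ⟨d, by omega⟩
        exact ⟨a, by simp only [c₁, ha]⟩
      · rw [SetLike.mem_coe, h0 d (by omega)]
        exact zero_mem _
  have hcard := sum_card_fiberExponent_le (by omega : 1 ≤ M) i
  rw [Finset.sum_Ico_succ_top hM] at hcard
  rw [hS1] at hchain
  have e1 : ((M - (b + 1) : ℕ) : ℤ) = M - (b + 1) := by
    rw [Nat.cast_sub (by omega)]; push_cast; ring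
  have hrk' : (trk k S₀ : ℤ) ≤ (b + 1) * (M - (b + 1)) := by
    rw [← e1]; exact_mod_cast hrk
  have hr1' : (trk k (S₀ ∪ Set.range c₁) : ℤ) + (b + 1) ≤ trk k S₀ + M := by exact_mod_cast hr1
  have hlast' : (trk k (Set.range u) : ℤ) ≤ trk k (S (M - 1)) +
    Fintype.card (FiberExponent i M) := by exact_mod_cast hlast
  have hcard' : 1 + (M : ℤ) + (∑ j ∈ Finset.Ico 2 M, (Fintype.card (FiberExponent i j) : ℤ) +
    Fintype.card (FiberExponent i M)) ≤ Fintype.card (Exponent M) := by exact_mod_cast hcard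
  -- The parameters of the span of `y`, minus the `b + 1` conditions on the linear part, cancel
  -- exactly against the extra term of the numerical estimate.
  have e2 : 2 * ((b : ℤ) + 1) * (M - 2 - b) = 2 * ((b + 1) * (M - (b + 1))) - 2 * (b + 1) := by
    ring
  rw [e2] at hchain
  linarith

/-- The linear part is zero and the part of degree `M` vanishes at `y` too, so the chain is used
with `D = M + 1`. The extra term of the estimate is now exactly the number of parameters of the
span. -/
theorem two_mul_trk_range_add_le_of_singular [IsAlgClosed K] (hM : 2 ≤ M)
    (F : IntermediateField k K)
    (hF : ∀ x : K, IsAlgebraic F x → x ∈ F) (i : Fin (M + 1)) (u : Exponent M → K)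
    (huF : ∀ d, u d ∈ F) (y : {a // a ≠ i} → K) (m l : {a // a ≠ i}) (hm : y m = 1)
    (hl : y l ∉ F) (h0 : ∀ d : Exponent M, M ≤ d.1 i + 1 → u d = 0)
    (hsum : ∀ j, 1 ≤ j → j ≤ M → fiberForm i u j y = 0) :
    2 * (trk k (Set.range u) : ℤ) + ((M : ℤ) ^ 2 - M + 4) ≤
      2 * (Fintype.card (Exponent M) - 1 - M) := by
  classical
  obtain ⟨b, S₀, hS₀, hS₀F, hb, hbn, hrk, hfr, hrkT, -⟩ := exists_coefficients F y m l hm hl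
  have hcκ : Fintype.card {a // a ≠ i} = M := by simp
  rw [hcκ] at hbn hrk
  let c : ∀ j, FiberExponent i j → K := fun j d => u d.1
  let S : ℕ → Set K := fun j => S₀ ∪ ⋃ a ∈ Finset.Ico 2 (j + 1), Set.range (c a)
  have hS1 : S 1 = S₀ := by
    simp only [S]
    rw [Finset.Ico_self]
    simp
  have hSs : ∀ j, 1 ≤ j → S (j + 1) = S j ∪ Set.range (c (j + 1)) := by
    intro j hj
    simp only [S]
    rw [show Finset.Ico 2 (j + 1 + 1) = insert (j + 1) (Finset.Ico 2 (j + 1)) by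
      ext; simp only [Finset.mem_Ico, Finset.mem_insert]; omega, Finset.set_biUnion_insert,
      Set.union_comm (Set.range _), ← Set.union_assoc]
  have hchain := trk_chain_le (k := k) F hF y m l hm hl b (M + 1) hb (by omega)
    (fun (j : ℕ) (d : FiberExponent i j) (a : {a // a ≠ i}) => d.1.1 a)
    (fun j hj => range_fiberExponent i j (by omega)) c (fun j _ d => huF _)
    (fun j h2 hj => hsum j (by omega) (by omega)) S (by rwa [hS1])
    (by rwa [hS1]) hSs
    (fun E hE hEF => hfr E (by rwa [hS1] at hE) hEF)
    (by rw [hS1]; exact hrkT _ hS₀ subset_rfl)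
  have hSf : (S M).Finite :=
    hS₀.union (Set.Finite.biUnion (Finset.finite_toSet _) fun _ _ => Set.finite_range _)
  have hlast : trk k (Set.range u) ≤ trk k (S M) := by
    refine trk_le_of_subset_relClosure hSf ?_
    rintro _ ⟨d, rfl⟩
    have hd := exponent_sum d i
    rcases Nat.lt_or_ge (d.1 i + 1) M with h | h
    · refine subset_relClosure k _ (Or.inr ?_)
      rw [Set.mem_iUnion₂]
      exact ⟨M - d.1 i, by rw [Finset.mem_Ico]; omega, ⟨d, by omega⟩, rfl⟩
    · rw [SetLike.mem_coe, h0 d h]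
      exact zero_mem _
  have hcard := sum_card_fiberExponent_le (by omega : 1 ≤ M) i
  rw [hS1, Nat.add_sub_cancel] at hchain
  have e1 : ((M - (b + 1) : ℕ) : ℤ) = M - (b + 1) := by
    rw [Nat.cast_sub (by omega)]; push_cast; ring
  have hrk' : (trk k S₀ : ℤ) ≤ (b + 1) * (M - (b + 1)) := by
    rw [← e1]; exact_mod_cast hrk
  have hlast' : (trk k (Set.range u) : ℤ) ≤ trk k (S M) := by exact_mod_cast hlast
  have hcard' : 1 + (M : ℤ) + ∑ j ∈ Finset.Ico 2 (M + 1),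
    (Fintype.card (FiberExponent i j) : ℤ) ≤ Fintype.card (Exponent M) := by exact_mod_cast hcard
  push_cast at hchain
  have e2 : 2 * ((b : ℤ) + 1) * (M + 1 - 2 - b) = 2 * ((b + 1) * (M - (b + 1))) := by
    ring
  rw [e2] at hchain
  have e3 : ((M : ℤ) + 1) ^ 2 = M ^ 2 + 2 * M + 1 := by ring
  rw [e3] at hchain
  linarith

end BadForms

/-! ### Krull dimension and transcendence rank -/

section KrullDim

theorem ringKrullDim_le_of_isIntegral {R S : Type*} [CommRing R] [CommRing S] (g : R →+* S)
    (hg : g.IsIntegral) : ringKrullDim S ≤ ringKrullDim R := by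
  let _ : Algebra R S := g.toAlgebra
  refine Order.krullDim_le_of_strictMono (PrimeSpectrum.comap g) ?_
  intro p q hpq
  obtain ⟨hle, hne⟩ := SetLike.lt_iff_le_and_exists.1 (show p.asIdeal < q.asIdeal from hpq)
  obtain ⟨x, hxq, hxp⟩ := hne
  exact Ideal.comap_lt_comap_of_integral_mem_sdiff hle ⟨hxq, hxp⟩ (hg x)

/-- The quotient by `P` is a quotient of `k[v]`. By Noether normalization this ring is integral over
a polynomial ring, whose variables map to algebraically independent elements of `k[v]`. -/
theorem ringKrullDim_quotient_le_trk {k K : Type*} [Field k] [Field K] [Algebra k K] {σ : Type*}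
    [Finite σ] (v : σ → K) (P : Ideal (MvPolynomial σ k))
    (hP : ∀ G, aeval v G = 0 → G ∈ P) :
    ringKrullDim (MvPolynomial σ k ⧸ P) ≤ trk k (Set.range v) := by
  let A := (aeval v : MvPolynomial σ k →ₐ[k] K).range
  have hvA : ∀ s, v s ∈ A := fun s => ⟨X s, by simp⟩
  have : Algebra.FiniteType k A := Algebra.FiniteType.of_surjective
    (aeval v : MvPolynomial σ k →ₐ[k] K).rangeRestrict
    (AlgHom.rangeRestrict_surjective _)
  obtain ⟨s, g, hginj, hgint⟩ := exists_integral_inj_algHom_of_fg k A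
  have h1 : ringKrullDim (MvPolynomial σ k ⧸ P) ≤ ringKrullDim A := by
    let f : MvPolynomial σ k ⧸ RingHom.ker (aeval v : MvPolynomial σ k →ₐ[k] K) →+*
      MvPolynomial σ k ⧸ P := Ideal.Quotient.factor hP
    have h2 := ringKrullDim_le_of_surjective f (Ideal.Quotient.factor_surjective hP)
    refine h2.trans (le_of_eq ?_)
    exact ringKrullDim_eq_of_ringEquiv
      (Ideal.quotientKerAlgEquivOfSurjective (AlgHom.rangeRestrict_surjective
        (aeval v : MvPolynomial σ k →ₐ[k] K)) |>.toRingEquiv |> fun e =>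
        (Ideal.quotEquivOfEq (by
          ext G
          simp only [RingHom.mem_ker]
          rw [Subtype.ext_iff]
          rfl)).trans e)
  have h2 := ringKrullDim_le_of_isIntegral g.toRingHom hgint
  rw [ringKrullDim_of_isNoetherianRing, ringKrullDim_eq_zero_of_field, zero_add,
    Nat.card_eq_fintype_card, Fintype.card_fin] at h2
  refine h1.trans (h2.trans ?_)
  let z : Fin s → K := fun i => (g (X i) : K)
  have hz : AlgebraicIndependent k z := by
    have h3 : (aeval z : MvPolynomial (Fin s) k →ₐ[k] K) = A.val.comp g := by
      ext i
      simp [z]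
    rw [AlgebraicIndependent, h3]
    exact Subtype.val_injective.comp hginj
  have hzr : (AlgebraicIndependent.matroid k K).Indep (Set.range z) := by
    rw [AlgebraicIndependent.matroid_indep_iff]
    exact AlgebraicIndependent.to_subtype_range hz
  have hs : trk k (Set.range z) = s := by
    rw [trk, hzr.eRk_eq_encard, ← Set.image_univ, hz.injective.encard_image, Set.encard_univ]
    simp
  have hle : trk k (Set.range z) ≤ trk k (Set.range v) := by
    refine trk_le_of_subset_relClosure (Set.finite_range v) ?_
    rintro _ ⟨i, rfl⟩
    obtain ⟨G, hG⟩ := (g (X i)).2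
    have h4 : A ≤ (relClosure k (Set.range v)).toSubalgebra := by
      rintro _ ⟨G, rfl⟩
      change aeval v G ∈ _
      induction G using MvPolynomial.induction_on with
      | C a =>
        rw [aeval_C]
        exact IntermediateField.algebraMap_mem _ a
      | add p q hp hq =>
        rw [map_add]
        exact add_mem hp hq
      | mul_X p n hp =>
        rw [map_mul, aeval_X]
        exact mul_mem hp (subset_relClosure k _ ⟨n, rfl⟩)
    exact h4 (g (X i)).2
  rw [hs] at hle
  exact_mod_cast hle

end KrullDim

/-! ### Quotients of rings of functions -/

section Functions

/-- The coefficients of a monic polynomial lift to functions, and a root may be chosen at each point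
separately. -/
theorem isAlgClosed_of_surjective {k Ω L : Type*} [Field k] [IsAlgClosed k] [Field L]
    (φ : (Ω → k) →+* L) (hφ : Function.Surjective φ) : IsAlgClosed L := by
  refine IsAlgClosed.of_exists_root L fun p hp hirr => ?_
  choose f hf using fun n => hφ (p.coeff n)
  have hdeg : 0 < p.natDegree := hirr.natDegree_pos
  have hroot : ∀ ω, ∃ r : k, r ^ p.natDegree + ∑ n ∈ Finset.range p.natDegree, f n ω * r ^ n = 0 := by
    intro ω
    let q : Polynomial k := Polynomial.X ^ p.natDegree +
      ∑ n ∈ Finset.range p.natDegree, Polynomial.C (f n ω) * Polynomial.X ^ n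
    have hlt : (∑ n ∈ Finset.range p.natDegree, Polynomial.C (f n ω) * Polynomial.X ^ n).degree <
        (p.natDegree : WithBot ℕ) := by
      refine (Polynomial.degree_sum_le _ _).trans_lt ?_
      rw [Finset.sup_lt_iff (WithBot.bot_lt_coe _)]
      intro n hn
      refine (Polynomial.degree_C_mul_X_pow_le _ _).trans_lt ?_
      exact_mod_cast Finset.mem_range.1 hn
    have hq : q.degree = (p.natDegree : WithBot ℕ) := by
      rw [Polynomial.degree_add_eq_left_of_degree_lt]
      · exact Polynomial.degree_X_pow _
      · rwa [Polynomial.degree_X_pow]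
    obtain ⟨r, hr⟩ := IsAlgClosed.exists_root q (by
      rw [hq]
      exact_mod_cast hdeg.ne')
    refine ⟨r, ?_⟩
    simpa [q, Polynomial.eval_finsetSum] using hr
  choose r hr using hroot
  refine ⟨φ r, ?_⟩
  rw [hp.as_sum]
  simp only [Polynomial.eval_add, Polynomial.eval_pow, Polynomial.eval_X, Polynomial.eval_finsetSum,
    Polynomial.eval_mul, Polynomial.eval_C, ← hf, ← map_pow, ← map_mul, ← map_sum, ← map_add]
  rw [← map_zero φ]
  congr 1
  ext ω
  simpa using hr ω

theorem isMaximal_of_isPrime_pi {k Ω : Type*} [Field k] (I : Ideal (Ω → k)) [hI : I.IsPrime] :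
    I.IsMaximal := by
  refine Ideal.Quotient.maximal_of_isField I
    { exists_pair_ne := ⟨0, 1, zero_ne_one⟩, mul_comm := mul_comm, mul_inv_cancel := ?_ }
  intro a ha
  obtain ⟨f, rfl⟩ := Ideal.Quotient.mk_surjective a
  refine ⟨Ideal.Quotient.mk I f⁻¹, ?_⟩
  have h1 : Ideal.Quotient.mk I f * (Ideal.Quotient.mk I f * Ideal.Quotient.mk I f⁻¹ - 1) = 0 := by
    have h2 : f * (f * f⁻¹ - 1) = 0 := by
      ext ω
      by_cases h : f ω = 0
      · simp [h]
      · simp [h]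
    rw [← map_one (Ideal.Quotient.mk I), ← map_mul, ← map_sub, ← map_mul, h2, map_zero]
  rcases mul_eq_zero.1 h1 with h | h
  · exact absurd h ha
  · exact sub_eq_zero.1 h

/-- A maximal ideal of a ring of functions, generic for a prime `P` containing the equations of
the family `w` and for points in infinite sets depending on the parameter of the family. -/
theorem exists_generic_ideal {k T σ : Type*} [Field k] (w : T → σ → k) (R : T → Set k)
    (hR : ∀ τ, (R τ).Infinite) (P : Ideal (MvPolynomial σ k)) [hP : P.IsPrime]
    (hwP : ∀ G, (∀ τ, eval (w τ) G = 0) → G ∈ P) :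
    ∃ I : Ideal ((Σ τ, R τ) → k), I.IsMaximal ∧
      (∀ G ∉ P, (fun ω : Σ τ, R τ => eval (w ω.1) G) ∉ I) ∧
      ∀ g : T → k, (fun ω : Σ τ, R τ => (ω.2 : k) - g ω.1) ∉ I := by
  classical
  -- Functions that vanish nowhere on some generic locus: off a hypersurface not containing the
  -- zeros of `P`, and with `ρ` off finitely many functions of the parameter. Such a locus is
  -- nonempty as each `R τ` is infinite, so a prime ideal avoids `S`.
  let S : Submonoid ((Σ τ, R τ) → k) :=
    { carrier := {f | ∃ G ∉ P, ∃ A : Finset (T → k), ∀ ω : Σ τ, R τ, eval (w ω.1) G ≠ 0 →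
        (∀ g ∈ A, (ω.2 : k) ≠ g ω.1) → f ω ≠ 0}
      one_mem' := ⟨1, fun h => hP.ne_top ((Ideal.eq_top_iff_one _).2 h), ∅, fun ω _ _ => by simp⟩
      mul_mem' := by
        rintro f f' ⟨G, hG, A, hA⟩ ⟨G', hG', A', hA'⟩
        refine ⟨G * G', fun h => (hP.mem_or_mem h).elim hG hG', A ∪ A', fun ω h1 h2 => ?_⟩
        rw [map_mul] at h1
        exact mul_ne_zero
          (hA ω (left_ne_zero_of_mul h1) fun g hg => h2 g (Finset.mem_union_left _ hg))
          (hA' ω (right_ne_zero_of_mul h1) fun g hg => h2 g (Finset.mem_union_right _ hg)) }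
  have hdisj : Disjoint ((⊥ : Ideal ((Σ τ, R τ) → k)) : Set ((Σ τ, R τ) → k)) S := by
    rw [Set.disjoint_left]
    rintro f hf ⟨G, hG, A, hA⟩
    have hf0 : f = 0 := by simpa using hf
    obtain ⟨τ, hτ⟩ : ∃ τ, eval (w τ) G ≠ 0 := by
      by_contra hcon
      push Not at hcon
      exact hG (hwP G hcon)
    obtain ⟨ρ, hρR, hρ⟩ := (hR τ).exists_notMem_finset (A.image fun g => g τ)
    refine hA ⟨τ, ρ, hρR⟩ hτ (fun g hg h => hρ ?_) (by rw [hf0]; rfl)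
    rw [Finset.mem_image]
    exact ⟨g, hg, h.symm⟩
  obtain ⟨I, hI, -, hIS⟩ := Ideal.exists_le_prime_disjoint ⊥ S hdisj
  refine ⟨I, isMaximal_of_isPrime_pi I, ?_, ?_⟩
  · intro G hG h
    exact Set.disjoint_left.1 hIS h ⟨G, hG, ∅, fun ω h1 _ => h1⟩
  · intro g h
    refine Set.disjoint_left.1 hIS h ⟨1, fun h => hP.ne_top ((Ideal.eq_top_iff_one _).2 h), {g},
      fun ω _ h2 => sub_ne_zero.2 (h2 g (by simp))⟩

end Functions

/-! ### Families of forms with many lines through a point -/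

section Families

variable {M : ℕ}

/-- The form with given coefficients. -/
noncomputable def formOf {R : Type*} [CommRing R] (u : Exponent M → R) :
    MvPolynomial (Fin (M + 1)) R :=
  ∑ d : Exponent M, monomial d.1 (u d)

/-- The linear substitution moving the coordinate point of index `i` to the point with affine
coordinates `x`. -/
noncomputable def shift {R : Type*} [CommRing R] (i : Fin (M + 1)) (x : {a // a ≠ i} → R) :
    MvPolynomial (Fin (M + 1)) R →ₐ[R] MvPolynomial (Fin (M + 1)) R :=
  aeval fun j => if h : j = i then X i else X j + C (x ⟨j, h⟩) * X i

/-- The coefficients of the substituted form. -/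
noncomputable def shiftCoeff {R : Type*} [CommRing R] (i : Fin (M + 1)) (x : {a // a ≠ i} → R)
    (u : Exponent M → R) : Exponent M → R :=
  fun d => coeff d.1 (shift i x (formOf u))

theorem map_formOf {R R' : Type*} [CommRing R] [CommRing R'] (f : R →+* R') (u : Exponent M → R) :
    MvPolynomial.map f (formOf u) = formOf (fun d => f (u d)) := by
  simp [formOf, map_sum, map_monomial]

theorem map_shift {R R' : Type*} [CommRing R] [CommRing R'] (f : R →+* R') (i : Fin (M + 1))
    (x : {a // a ≠ i} → R) (G : MvPolynomial (Fin (M + 1)) R) :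
    MvPolynomial.map f (shift i x G) = shift i (fun a => f (x a)) (MvPolynomial.map f G) := by
  induction G using MvPolynomial.induction_on with
  | C a => simp [shift]
  | add p q hp hq => simp [hp, hq]
  | mul_X p n hp =>
    rw [map_mul, map_mul, map_mul, map_mul, hp, map_X]
    congr 1
    simp only [shift, aeval_X]
    split_ifs <;> simp

theorem map_shiftCoeff {R R' : Type*} [CommRing R] [CommRing R'] (f : R →+* R') (i : Fin (M + 1))
    (x : {a // a ≠ i} → R) (u : Exponent M → R) (d : Exponent M) :
    f (shiftCoeff i x u d) = shiftCoeff i (fun a => f (x a)) (fun d => f (u d)) d := by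
  rw [shiftCoeff, shiftCoeff, ← coeff_map, map_shift, map_formOf]

theorem map_fiberForm {R R' : Type*} [CommRing R] [CommRing R'] (f : R →+* R') (i : Fin (M + 1))
    (u : Exponent M → R) (j : ℕ) (y : {a // a ≠ i} → R) :
    f (fiberForm i u j y) = fiberForm i (fun d => f (u d)) j (fun a => f (y a)) := by
  simp [fiberForm]

/-- The coefficients of the translated form are polynomials in `u` and in the `M` coordinates of
`x`. -/
theorem trk_range_shiftCoeff_le {k K : Type*} [Field k] [Field K] [Algebra k K] (i : Fin (M + 1))
    (x : {a // a ≠ i} → K) (u : Exponent M → K) :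
    trk k (Set.range (shiftCoeff i x u)) ≤ M + trk k (Set.range u) := by
  have hx : (Set.range x).Finite := Set.finite_range x
  have hu : (Set.range u).Finite := Set.finite_range u
  have h1 := trk_union_le (k := k) hu hx
  have h2 : (Set.range x).ncard ≤ M := by
    have := Set.ncard_image_le (f := x) (Set.finite_univ)
    rw [Set.image_univ, Set.ncard_univ, Nat.card_eq_fintype_card] at this
    simpa using this
  have h3 : trk k (Set.range (shiftCoeff i x u)) ≤ trk k (Set.range u ∪ Set.range x) := by
    refine trk_le_of_subset_relClosure (hu.union hx) ?_
    rintro _ ⟨d, rfl⟩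
    let L := relClosure k (Set.range u ∪ Set.range x)
    have hxL : ∀ a, x a ∈ L := fun a => subset_relClosure k _ (Or.inr ⟨a, rfl⟩)
    have huL : ∀ a, u a ∈ L := fun a => subset_relClosure k _ (Or.inl ⟨a, rfl⟩)
    have h4 := map_shiftCoeff L.toSubfield.subtype i (fun a => ⟨x a, hxL a⟩)
      (fun a => ⟨u a, huL a⟩) d
    have h5 : shiftCoeff i x u d = L.toSubfield.subtype
      (shiftCoeff i (fun a => ⟨x a, hxL a⟩) (fun a => ⟨u a, huL a⟩) d) := h4.symm
    rw [h5]
    exact (shiftCoeff i (fun a => (⟨x a, hxL a⟩ : L)) (fun a => ⟨u a, huL a⟩) d).2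
  omega

theorem exists_residue_field {k A : Type} [Field k] [CommRing A] [Algebra k A] (I : Ideal A)
    [I.IsMaximal] : ∃ (K : Type) (_ : Field K) (_ : Algebra k K) (π : A →ₐ[k] K),
      Function.Surjective π ∧ ∀ f, π f = 0 ↔ f ∈ I := by
  let _ : Field (A ⧸ I) := Ideal.Quotient.field I
  exact ⟨A ⧸ I, inferInstance, inferInstance, Ideal.Quotient.mkₐ k I,
    Ideal.Quotient.mkₐ_surjective k I, fun f => Ideal.Quotient.eq_zero_iff_mem⟩

/-- A generic member of a family of forms with infinitely many lines through a point. -/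
theorem exists_generic_form (i : Fin (M + 1)) (m l : {a // a ≠ i}) (J : Set ℕ)
    (C : Set (Exponent M → ℂ))
    (hC : ∀ u ∈ C, {ρ : ℂ | ∃ y : {a // a ≠ i} → ℂ, y m = 1 ∧ y l = ρ ∧
      ∀ j ∈ J, fiberForm i u j y = 0}.Infinite)
    (P : Ideal (MvPolynomial (Exponent M) ℂ)) [P.IsPrime]
    (hP : ∀ G, (∀ x, ∀ u ∈ C, eval (shiftCoeff i x u) G = 0) → G ∈ P) :
    ∃ (K : Type) (_ : Field K) (_ : Algebra ℂ K) (_ : IsAlgClosed K) (F : IntermediateField ℂ K)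
      (u : Exponent M → K) (y : {a // a ≠ i} → K),
      (∀ x : K, IsAlgebraic F x → x ∈ F) ∧ (∀ d, u d ∈ F) ∧ y m = 1 ∧ y l ∉ F ∧
      (∀ j ∈ J, fiberForm i u j y = 0) ∧ (∀ d, (∀ u ∈ C, u d = 0) → u d = 0) ∧
      (∀ d, (∀ u ∈ C, u d ≠ 0) → u d ≠ 0) ∧
      ringKrullDim (MvPolynomial (Exponent M) ℂ ⧸ P) ≤ ((M + trk ℂ (Set.range u) : ℕ) : ℕ∞) := by
  classical
  let T := ({a // a ≠ i} → ℂ) × C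
  obtain ⟨I, hImax, hI1, hI2⟩ := exists_generic_ideal (T := T)
    (fun τ => shiftCoeff i τ.1 (τ.2 : Exponent M → ℂ)) _ (fun τ => hC _ τ.2.2) P
    (fun G hG => hP G fun x u hu => hG (x, ⟨u, hu⟩))
  let Ω := Σ τ : T, {ρ : ℂ | ∃ y : {a // a ≠ i} → ℂ, y m = 1 ∧ y l = ρ ∧
      ∀ j ∈ J, fiberForm i (τ.2 : Exponent M → ℂ) j y = 0}
  change Ideal (Ω → ℂ) at I
  choose Y hY1 hY2 hY3 using fun ω : Ω => ω.2.2
  obtain ⟨K, _, _, π, hπs, hπ⟩ := exists_residue_field (k := ℂ) I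
  let fst : (T → ℂ) →ₐ[ℂ] (Ω → ℂ) :=
    AlgHom.pi fun ω => Pi.evalAlgHom ℂ (fun _ : T => ℂ) ω.1
  -- The classes of functions of the parameter `τ` alone. The coefficients `u` are among them, while
  -- `y l` is generically different from every such function. Inverses are taken pointwise, with the
  -- value 0 at zeros.
  let F : IntermediateField ℂ K := (π.comp fst).range.toIntermediateField (by
    rintro _ ⟨g, rfl⟩
    by_cases h : π (fst g) = 0
    · exact ⟨0, by
        rw [map_zero]
        change 0 = (π (fst g))⁻¹
        rw [h, inv_zero]⟩
    · refine ⟨g⁻¹, eq_inv_of_mul_eq_one_right ?_⟩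
      change π (fst g) * π (fst g⁻¹) = 1
      have h1 : fst g * fst g⁻¹ * fst g = fst g := by
        ext ω
        change g ω.1 * (g ω.1)⁻¹ * g ω.1 = g ω.1
        exact mul_inv_mul_cancel _
      have h2 := congrArg π h1
      rw [map_mul, map_mul] at h2
      exact mul_right_cancel₀ h (by rw [h2, one_mul]))
  have hFmem : ∀ g : T → ℂ, π (fst g) ∈ F := fun g => ⟨g, rfl⟩
  have hFalg : IsAlgClosed F := by
    refine isAlgClosed_of_surjective (Ω := T)
      ((π.comp fst).rangeRestrict : (T → ℂ) →+* (π.comp fst).range) ?_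
    exact AlgHom.rangeRestrict_surjective _
  let uΩ : Exponent M → Ω → ℂ := fun d ω => (ω.1.2 : Exponent M → ℂ) d
  let xΩ : {a // a ≠ i} → Ω → ℂ := fun a ω => ω.1.1 a
  let yΩ : {a // a ≠ i} → Ω → ℂ := fun a ω => Y ω a
  have hshift : ∀ d, π (shiftCoeff i xΩ uΩ d) =
      shiftCoeff i (fun a => π (xΩ a)) (fun d => π (uΩ d)) d := by
    intro d
    have h1 := map_shiftCoeff (π : (Ω → ℂ) →+* K) i xΩ uΩ d
    exact h1
  refine ⟨K, inferInstance, inferInstance,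
    isAlgClosed_of_surjective (π : (Ω → ℂ) →+* K) hπs, F,
    fun d => π (uΩ d), fun a => π (yΩ a), ?_, ?_, ?_, ?_, ?_, ?_, ?_, ?_⟩
  · intro x hx
    obtain ⟨e, he⟩ := minpoly.mem_range_of_degree_eq_one F x
      (IsAlgClosed.degree_eq_one_of_irreducible F (minpoly.irreducible hx.isIntegral))
    rw [← he]
    exact e.2
  · intro d
    exact hFmem fun τ => (τ.2 : Exponent M → ℂ) d
  · have : yΩ m = 1 := funext fun ω => hY1 ω
    change π (yΩ m) = 1
    rw [this, map_one]
  · rintro ⟨g, hg⟩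
    refine hI2 g ?_
    rw [← hπ]
    have : (fun ω : Ω => (ω.2 : ℂ) - g ω.1) = yΩ l - fst g := by
      ext ω
      rw [Pi.sub_apply]
      change _ = Y ω l - g ω.1
      rw [hY2]
    rw [this, map_sub, sub_eq_zero]
    exact hg.symm
  · intro j hj
    have h1 := map_fiberForm (π : (Ω → ℂ) →+* K) i uΩ j yΩ
    have h2 : fiberForm i uΩ j yΩ = 0 := by
      ext ω
      have h3 := map_fiberForm (Pi.evalRingHom (fun _ : Ω => ℂ) ω) i uΩ j yΩ
      exact h3.trans (hY3 ω j hj)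
    rw [h2, map_zero] at h1
    exact h1.symm
  · intro d hd
    have : uΩ d = 0 := funext fun ω => hd _ ω.1.2.2
    change π (uΩ d) = 0
    rw [this, map_zero]
  · intro d hd h0
    replace h0 : π (uΩ d) = 0 := h0
    have h1 : uΩ d * (uΩ d)⁻¹ = 1 := funext fun ω => mul_inv_cancel₀ (hd _ ω.1.2.2)
    have h2 := congrArg π h1
    rw [map_mul, h0, zero_mul, map_one] at h2
    exact zero_ne_one h2
  · refine (ringKrullDim_quotient_le_trk
      (shiftCoeff i (fun a => π (xΩ a)) (fun d => π (uΩ d))) P ?_).trans ?_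
    · intro G hG
      by_contra hGP
      refine hI1 G hGP ?_
      rw [← hπ, ← hG]
      have h1 : (shiftCoeff i (fun a => π (xΩ a)) (fun d => π (uΩ d))) =
          fun d => π (shiftCoeff i xΩ uΩ d) := funext fun d => (hshift d).symm
      rw [h1, show (aeval (fun d => π (shiftCoeff i xΩ uΩ d)) G) =
        π (aeval (fun d => shiftCoeff i xΩ uΩ d) G) from ((comp_aeval_apply _ π G).symm)]
      refine congrArg π (funext fun ω => ?_)
      have h2 : ∀ d, shiftCoeff i xΩ uΩ d ω = shiftCoeff i ω.1.1 (ω.1.2 : Exponent M → ℂ) d :=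
        fun d => map_shiftCoeff (Pi.evalRingHom (fun _ : Ω => ℂ) ω) i xΩ uΩ d
      have h3 := comp_aeval_apply (fun d => shiftCoeff i xΩ uΩ d)
        (Pi.evalAlgHom ℂ (fun _ : Ω => ℂ) ω) G
      refine Eq.trans ?_ h3.symm
      rw [← coe_aeval_eq_eval]
      exact congrArg (fun v => aeval v G) (funext h2).symm
    · exact_mod_cast trk_range_shiftCoeff_le i _ _

/-- Forms singular at a coordinate point, with infinitely many lines through it. -/
def singularForms (i : Fin (M + 1)) (m l : {a // a ≠ i}) : Set (Exponent M → ℂ) :=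
  {u | (∀ d : Exponent M, M ≤ d.1 i + 1 → u d = 0) ∧
    {ρ : ℂ | ∃ y : {a // a ≠ i} → ℂ, y m = 1 ∧ y l = ρ ∧
      ∀ j ∈ Set.Icc 1 M, fiberForm i u j y = 0}.Infinite}

/-- Forms smooth at a coordinate point, with a positive-dimensional scheme of lines of high contact
through it. -/
def smoothForms (i : Fin (M + 1)) (m l : {a // a ≠ i}) (e : Exponent M) : Set (Exponent M → ℂ) :=
  {u | (∀ d : Exponent M, d.1 i = M → u d = 0) ∧ (e.1 i + 1 = M ∧ u e ≠ 0) ∧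
    {ρ : ℂ | ∃ y : {a // a ≠ i} → ℂ, y m = 1 ∧ y l = ρ ∧
      ∀ j ∈ Set.Ico 1 M, fiberForm i u j y = 0}.Infinite}

theorem two_mul_codim (hM : 5 ≤ M) :
    2 * ((M * (M - 5) / 2 + 4 : ℕ) : ℤ) = (M : ℤ) ^ 2 - 5 * M + 8 := by
  have h1 : 2 ∣ M * (M - 5) := by
    rcases Nat.even_or_odd M with h | h
    · exact h.two_dvd.mul_right _
    · exact (Nat.Odd.sub_odd h (by decide)).two_dvd.mul_left _
  have h2 : 2 * (M * (M - 5) / 2 + 4) = M * (M - 5) + 8 := by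
    rw [mul_add, Nat.mul_div_cancel' h1]
  generalize M * (M - 5) / 2 + 4 = c at h2 ⊢
  have h3 : 2 * (c : ℤ) = ((M * (M - 5) + 8 : ℕ) : ℤ) := by exact_mod_cast h2
  rw [h3]
  push_cast [Nat.cast_sub hM]
  ring

theorem ringKrullDim_add_le {A : Type*} [CommRing A] {r c n : ℕ}
    (h : ringKrullDim A ≤ ((r : ℕ) : ℕ∞)) (hr : r + c ≤ n) :
    ringKrullDim A + (c : WithBot ℕ∞) ≤ n := by
  calc ringKrullDim A + (c : WithBot ℕ∞) ≤ ((r : ℕ∞) : WithBot ℕ∞) + (c : WithBot ℕ∞) := by gcongr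
    _ = ((r + c : ℕ) : WithBot ℕ∞) := by push_cast; rfl
    _ ≤ n := by exact_mod_cast hr

theorem ringKrullDim_le_of_smoothForms (hM : 5 ≤ M) (i : Fin (M + 1)) (m l : {a // a ≠ i})
    (e : Exponent M) (P : Ideal (MvPolynomial (Exponent M) ℂ)) [P.IsPrime]
    (hP : ∀ G, (∀ x, ∀ u ∈ smoothForms i m l e, eval (shiftCoeff i x u) G = 0) → G ∈ P) :
    ringKrullDim (MvPolynomial (Exponent M) ℂ ⧸ P) + ((M * (M - 5) / 2 + 4 : ℕ) : WithBot ℕ∞) ≤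
      Fintype.card (Exponent M) := by
  by_cases he : e.1 i + 1 = M
  · obtain ⟨K, _, _, _, F, u, y, hF, huF, hm, hl, hsum, h0, h1, hdim⟩ :=
      exists_generic_form i m l (Set.Ico 1 M) (smoothForms i m l e) (fun u hu => hu.2.2) P hP
    refine ringKrullDim_add_le hdim ?_
    have h2 := two_mul_trk_range_add_le_of_smooth (by omega) F hF i u huF y m l hm hl
      (fun d hd => h0 d fun u hu => hu.1 d hd) ⟨e, he, h1 e fun u hu => hu.2.1.2⟩
      (fun j hj1 hj2 => hsum j ⟨hj1, hj2⟩)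
    have h3 := two_mul_codim hM
    generalize M * (M - 5) / 2 + 4 = c at h3 ⊢
    zify
    linarith
  · exfalso
    -- For such an exponent `e` the family is empty.
    refine Ideal.IsPrime.ne_top ‹P.IsPrime› ((Ideal.eq_top_iff_one _).2 (hP 1 ?_))
    intro x u hu
    exact absurd hu.2.1.1 he

theorem ringKrullDim_le_of_singularForms (hM : 5 ≤ M) (i : Fin (M + 1)) (m l : {a // a ≠ i})
    (P : Ideal (MvPolynomial (Exponent M) ℂ)) [P.IsPrime]
    (hP : ∀ G, (∀ x, ∀ u ∈ singularForms i m l, eval (shiftCoeff i x u) G = 0) → G ∈ P) :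
    ringKrullDim (MvPolynomial (Exponent M) ℂ ⧸ P) + ((M * (M - 5) / 2 + 4 : ℕ) : WithBot ℕ∞) ≤
      Fintype.card (Exponent M) := by
  obtain ⟨K, _, _, _, F, u, y, hF, huF, hm, hl, hsum, h0, -, hdim⟩ :=
    exists_generic_form i m l (Set.Icc 1 M) (singularForms i m l) (fun u hu => hu.2) P hP
  refine ringKrullDim_add_le hdim ?_
  have h2 := two_mul_trk_range_add_le_of_singular (by omega) F hF i u huF y m l hm hl
    (fun d hd => h0 d fun u hu => hu.1 d hd) (fun j hj1 hj2 => hsum j ⟨hj1, hj2⟩)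
  have h3 := two_mul_codim hM
  generalize M * (M - 5) / 2 + 4 = c at h3 ⊢
  zify
  have h4 : (5 : ℤ) ≤ M := by exact_mod_cast hM
  linarith

/-- Coefficients of forms which are bad at some point. -/
def badCoeffs (M : ℕ) : Set (Exponent M → ℂ) :=
  {w | ∃ (i : Fin (M + 1)) (m l : {a // a ≠ i}) (x : {a // a ≠ i} → ℂ) (u : Exponent M → ℂ),
    ((∃ e, u ∈ smoothForms i m l e) ∨ u ∈ singularForms i m l) ∧ w = shiftCoeff i x u}

theorem exists_le_of_forall_iInf {R : Type*} [CommRing R] {ι : Type*} [Finite ι] (P : Ideal R)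
    [P.IsPrime] (I : ι → Ideal R) (h : ∀ G, (∀ i, G ∈ I i) → G ∈ P) : ∃ i, I i ≤ P := by
  have := Fintype.ofFinite ι
  by_contra hcon
  push Not at hcon
  choose G hG hGP using fun i => SetLike.not_le_iff_exists.1 (hcon i)
  have h1 : ∏ i, G i ∈ P := h _ fun i =>
    Ideal.mem_of_dvd (I i) (Finset.dvd_prod_of_mem G (Finset.mem_univ i)) (hG i)
  obtain ⟨i, -, hi⟩ := (Ideal.IsPrime.prod_mem_iff).1 h1
  exact hGP i hi

theorem ringKrullDim_le_of_badCoeffs (hM : 5 ≤ M) (P : Ideal (MvPolynomial (Exponent M) ℂ))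
    [P.IsPrime] (hP : ∀ G, (∀ w ∈ badCoeffs M, eval w G = 0) → G ∈ P) :
    ringKrullDim (MvPolynomial (Exponent M) ℂ ⧸ P) + ((M * (M - 5) / 2 + 4 : ℕ) : WithBot ℕ∞) ≤
      Fintype.card (Exponent M) := by
  let C : (Σ i : Fin (M + 1), {a // a ≠ i} × {a // a ≠ i} × Option (Exponent M)) →
      Set (Exponent M → ℂ) := fun θ =>
    θ.2.2.2.elim (singularForms θ.1 θ.2.1 θ.2.2.1) (smoothForms θ.1 θ.2.1 θ.2.2.1)
  obtain ⟨⟨i, m, l, o⟩, hθ⟩ := exists_le_of_forall_iInf P (fun θ =>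
    ⨅ x, ⨅ u ∈ C θ, RingHom.ker (eval (shiftCoeff θ.1 x u))) (by
      intro G hG
      refine hP G ?_
      rintro w ⟨i, m, l, x, u, hu, rfl⟩
      rcases hu with ⟨e, he⟩ | hu
      · have h1 := hG ⟨i, m, l, some e⟩
        simp only [Ideal.mem_iInf] at h1
        exact h1 x u he
      · have h1 := hG ⟨i, m, l, none⟩
        simp only [Ideal.mem_iInf] at h1
        exact h1 x u hu)
  cases o with
  | none =>
    refine ringKrullDim_le_of_singularForms hM i m l P fun G hG => hθ ?_
    simp only [Ideal.mem_iInf]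
    exact fun x u hu => hG x u hu
  | some e =>
    refine ringKrullDim_le_of_smoothForms hM i m l e P fun G hG => hθ ?_
    simp only [Ideal.mem_iInf]
    exact fun x u hu => hG x u hu

end Families

/-! ### Forms in coordinates centred at a point -/

section Centred

variable {M : ℕ}

theorem formOf_coeff {R : Type*} [CommRing R] {g : MvPolynomial (Fin (M + 1)) R}
    (hg : g.IsHomogeneous M) : formOf (fun d : Exponent M => coeff d.1 g) = g := by
  classical
  ext e
  rw [formOf, coeff_sum]
  by_cases he : e.degree = M
  · rw [Finset.sum_eq_single ⟨e, he⟩]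
    · simp
    · intro d _ hd
      rw [coeff_monomial, if_neg fun h => hd (Subtype.ext h)]
    · simp
  · rw [hg.coeff_eq_zero he, Finset.sum_eq_zero]
    intro d _
    rw [coeff_monomial, if_neg]
    rintro rfl
    exact he d.2

theorem eval_formOf {R : Type*} [CommRing R] (i : Fin (M + 1)) (u : Exponent M → R)
    (p : Fin (M + 1) → R) : eval p (formOf u) =
      ∑ j ∈ Finset.range (M + 1), p i ^ (M - j) * fiberForm i u j (fun a => p a) := by
  classical
  rw [formOf, map_sum, ← Finset.sum_fiberwise_of_maps_to (g := fun d : Exponent M => M - d.1 i)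
    (t := Finset.range (M + 1)) (fun d _ => by rw [Finset.mem_range]; omega)]
  refine Finset.sum_congr rfl fun j hj => ?_
  rw [Finset.mem_range] at hj
  rw [fiberForm, Finset.mul_sum]
  have h1 : (Finset.univ.filter fun d : Exponent M => M - d.1 i = j) =
      Finset.univ.filter fun d : Exponent M => d.1 i + j = M := by
    ext d
    have := exponent_sum d i
    simp only [Finset.mem_filter, Finset.mem_univ, true_and]
    omega
  rw [h1, Finset.sum_subtype (p := fun d : Exponent M => d.1 i + j = M) _ (by simp)]
  refine Finset.sum_congr rfl fun d _ => ?_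
  rw [eval_monomial, Finsupp.prod_fintype _ _ (by simp),
    Fintype.prod_eq_mul_prod_subtype_ne _ i, show d.1.1 i = M - j by have := d.2; omega]
  ring

theorem isHomogeneous_shift {R : Type*} [CommRing R] (i : Fin (M + 1)) (x : {a // a ≠ i} → R)
    {g : MvPolynomial (Fin (M + 1)) R} (hg : g.IsHomogeneous M) :
    (shift i x g).IsHomogeneous M := by
  have h : (shift i x g).IsHomogeneous (1 * M) := by
    refine hg.aeval _ fun j => ?_
    split_ifs with h
    · exact isHomogeneous_X _ _
    · refine (isHomogeneous_X _ _).add ?_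
      exact (isHomogeneous_C (Fin (M + 1)) (x ⟨j, h⟩)).mul (isHomogeneous_X R i)
  rwa [one_mul] at h

theorem shift_neg_shift {R : Type*} [CommRing R] (i : Fin (M + 1)) (x : {a // a ≠ i} → R)
    (g : MvPolynomial (Fin (M + 1)) R) : shift i (-x) (shift i x g) = g := by
  have h : (shift i (-x)).comp (shift i x) = AlgHom.id R _ := by
    ext1 j
    by_cases hj : j = i
    · simp [shift, hj]
    · simp [shift, hj]
  exact DFunLike.congr_fun h g

theorem eval_shift {R : Type*} [CommRing R] (i : Fin (M + 1)) (x : {a // a ≠ i} → R)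
    (g : MvPolynomial (Fin (M + 1)) R) (p q : Fin (M + 1) → R) (hi : q i = p i)
    (ha : ∀ a : {a // a ≠ i}, q a = p a + x a * p i) : eval p (shift i x g) = eval q g := by
  have h : ((aeval p : MvPolynomial (Fin (M + 1)) R →ₐ[R] R).comp (shift i x)) = aeval q := by
    ext1 j
    by_cases hj : j = i
    · simp [shift, hj, hi]
    · simp [shift, hj, ha ⟨j, hj⟩]
  have h2 := DFunLike.congr_fun h g
  simpa [coe_aeval_eq_eval] using h2

/-- For `a ≠ i` the variable `X a` occurs only in the image of `X a`, with coefficient 1. -/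
theorem pderiv_shift {R : Type*} [CommRing R] (i : Fin (M + 1)) (x : {a // a ≠ i} → R)
    (a : Fin (M + 1)) (ha : a ≠ i) (g : MvPolynomial (Fin (M + 1)) R) :
    pderiv a (shift i x g) = shift i x (pderiv a g) := by
  classical
  induction g using MvPolynomial.induction_on with
  | C r => simp [shift]
  | add p q hp hq => simp [hp, hq]
  | mul_X p n hp =>
    have h1 : pderiv a (shift i x (X n)) = shift i x (pderiv a (X n)) := by
      by_cases hn : n = i
      · subst hn
        simp [shift, pderiv_X_of_ne ha.symm]
      · by_cases hna : n = a
        · subst hna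
          simp [shift, hn, pderiv_X_of_ne (Ne.symm hn)]
        · simp [shift, hn, pderiv_X_of_ne (Ne.symm ha), pderiv_X_of_ne hna]
    rw [map_mul, pderiv_mul, hp, h1, pderiv_mul, map_add, map_mul, map_mul]

theorem eval_single_of_isHomogeneous {R : Type*} [CommRing R] {n : ℕ} (i : Fin (M + 1))
    {g : MvPolynomial (Fin (M + 1)) R} (hg : g.IsHomogeneous n) :
    eval (Pi.single i 1) g = coeff (Finsupp.single i n) g := by
  classical
  rw [eval_eq', Finset.sum_eq_single (Finsupp.single i n)]
  · rw [Finset.prod_eq_one, mul_one]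
    intro b _
    by_cases hb : b = i
    · subst hb
      simp
    · simp [Finsupp.single_eq_of_ne hb]
  · intro d hd hne
    have h1 : ∃ b, b ≠ i ∧ d b ≠ 0 := by
      by_contra hcon
      push Not at hcon
      apply hne
      have h2 : d = Finsupp.single i (d i) := by
        ext b
        by_cases hb : b = i
        · subst hb
          simp
        · rw [hcon b hb, Finsupp.single_eq_of_ne hb]
      have h3 := hg (mem_support_iff.1 hd)
      have h4 : d.degree = n := by
        rw [Finsupp.degree_eq_weight_one]
        exact h3
      rw [h2] at h4 ⊢
      simp at h4
      rw [h4]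
    obtain ⟨b, hb, hdb⟩ := h1
    rw [Finset.prod_eq_zero (Finset.mem_univ b), mul_zero]
    rw [Pi.single_eq_of_ne hb, zero_pow hdb]
  · intro h
    rw [notMem_support_iff.1 h, zero_mul]

/-- The coefficients of a form in coordinates centred at the point with affine coordinates `x`. -/
noncomputable def centredCoeff {R : Type*} [CommRing R] (i : Fin (M + 1)) (x : {a // a ≠ i} → R)
    (f : MvPolynomial (Fin (M + 1)) R) : Exponent M → R :=
  fun d => coeff d.1 (shift i x f)

/-- Undoing the translation presents any form as a translate of its centred version, which is how
bad forms enter `badCoeffs`. -/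
theorem coeff_eq_shiftCoeff {R : Type*} [CommRing R] (i : Fin (M + 1)) (x : {a // a ≠ i} → R)
    {f : MvPolynomial (Fin (M + 1)) R} (hf : f.IsHomogeneous M) :
    (fun d : Exponent M => coeff d.1 f) = shiftCoeff i (-x) (centredCoeff i x f) := by
  ext d
  rw [shiftCoeff, show formOf (centredCoeff i x f) = shift i x f from
    formOf_coeff (isHomogeneous_shift i x hf), shift_neg_shift]

theorem eval_eq_sum_fiberForm {R : Type*} [CommRing R] (i : Fin (M + 1)) (x : {a // a ≠ i} → R)
    {f : MvPolynomial (Fin (M + 1)) R} (hf : f.IsHomogeneous M) (p : Fin (M + 1) → R) :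
    eval p f = ∑ j ∈ Finset.range (M + 1),
      p i ^ (M - j) * fiberForm i (centredCoeff i x f) j (fun a => p a - p i * x a) := by
  classical
  let q : Fin (M + 1) → R := fun j => if h : j = i then p i else p j - p i * x ⟨j, h⟩
  have hq : ∀ a : {a // a ≠ i}, q a = p a - p i * x a := fun a => by simp [q, a.2]
  have hqi : q i = p i := by simp [q]
  have h1 := eval_formOf i (centredCoeff i x f) q
  rw [show formOf (centredCoeff i x f) = shift i x f from formOf_coeff (isHomogeneous_shift i x hf),
    eval_shift i x f q p hqi.symm (fun a => by rw [hq, hqi]; ring)] at h1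
  simp only [hq, hqi] at h1
  exact h1

theorem exponent_eq_single (i : Fin (M + 1)) (d : Exponent M) (hd : d.1 i = M) :
    d.1 = Finsupp.single i M := by
  have h1 := exponent_sum d i
  have h2 : ∑ a : {a // a ≠ i}, d.1 a = 0 := by omega
  rw [Finset.sum_eq_zero_iff] at h2
  ext b
  by_cases hb : b = i
  · subst hb
    simp [hd]
  · rw [Finsupp.single_eq_of_ne hb]
    exact h2 ⟨b, hb⟩ (Finset.mem_univ _)

theorem centredCoeff_eq_eval {R : Type*} [CommRing R] (i : Fin (M + 1)) (p : Fin (M + 1) → R)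
    (hp : p i = 1) {f : MvPolynomial (Fin (M + 1)) R} (hf : f.IsHomogeneous M) (d : Exponent M)
    (hd : d.1 i = M) : centredCoeff i (fun a => p a) f d = eval p f := by
  rw [centredCoeff, exponent_eq_single i d hd,
    ← eval_single_of_isHomogeneous i (isHomogeneous_shift i _ hf)]
  refine eval_shift i _ f _ p (by simp [hp]) fun a => ?_
  simp [a.2]

theorem linExponent_eq (hM : 1 ≤ M) (i : Fin (M + 1)) (a : {a // a ≠ i}) :
    (linExponent hM i a).1.1 = Finsupp.single i (M - 1) + Finsupp.single (a : Fin (M + 1)) 1 := by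
  classical
  ext b
  by_cases hb : b = i
  · subst hb
    rw [linExponent, mkExponent_self]
    simp [Finsupp.single_eq_of_ne a.2.symm]
  · have h1 := mkExponent_ne i (Pi.single a 1) (by simpa using hM) ⟨b, hb⟩
    rw [linExponent]
    refine h1.trans ?_
    rw [Finsupp.add_apply, Finsupp.single_eq_of_ne hb, zero_add, Finsupp.single_apply,
      Pi.single_apply]
    simp [Subtype.ext_iff, eq_comm]

theorem centredCoeff_linExponent (hM : 1 ≤ M) (i : Fin (M + 1)) (p : Fin (M + 1) → ℂ)
    (hp : p i = 1) {f : MvPolynomial (Fin (M + 1)) ℂ} (hf : f.IsHomogeneous M) (a : {a // a ≠ i}) :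
    centredCoeff i (fun a => p a) f (linExponent hM i a).1 = eval p (pderiv (a : Fin (M + 1)) f) := by
  classical
  have h1 := coeff_pderiv (i := (a : Fin (M + 1))) (shift i (fun a => p a) f)
    (Finsupp.single i (M - 1))
  rw [Finsupp.single_eq_of_ne a.2] at h1
  simp only [CharP.cast_eq_zero, zero_add, mul_one] at h1
  rw [centredCoeff, linExponent_eq, ← h1,
    ← eval_single_of_isHomogeneous i (isHomogeneous_shift i _ hf).pderiv, pderiv_shift _ _ _ a.2]
  refine eval_shift i _ _ _ p (by simp [hp]) fun a => ?_
  simp [a.2]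

theorem fiberForm_smul {R : Type*} [CommRing R] (i : Fin (M + 1)) (u : Exponent M → R) (j : ℕ)
    (s : R) (y : {a // a ≠ i} → R) : fiberForm i u j (s • y) = s ^ j * fiberForm i u j y := by
  rw [fiberForm, fiberForm, Finset.mul_sum]
  refine Finset.sum_congr rfl fun d _ => ?_
  have h1 := exponent_sum d.1 i
  have h2 := d.2
  simp only [Pi.smul_apply, smul_eq_mul, mul_pow, Finset.prod_mul_distrib]
  rw [Finset.prod_pow_eq_pow_sum, show ∑ a : {a // a ≠ i}, d.1.1 a = j by omega]
  ring

theorem fiberForm_smul_left {R : Type*} [CommRing R] (i : Fin (M + 1)) (u : Exponent M → R) (j : ℕ)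
    (s : R) (y : {a // a ≠ i} → R) : fiberForm i (s • u) j y = s * fiberForm i u j y := by
  rw [fiberForm, fiberForm, Finset.mul_sum]
  refine Finset.sum_congr rfl fun d _ => ?_
  simp only [Pi.smul_apply, smul_eq_mul]
  ring

theorem shiftCoeff_smul {R : Type*} [CommRing R] (i : Fin (M + 1)) (x : {a // a ≠ i} → R)
    (u : Exponent M → R) (s : R) : shiftCoeff i x (s • u) = s • shiftCoeff i x u := by
  have h : formOf (s • u) = s • formOf u := by
    simp [formOf, Finset.smul_sum, smul_monomial]
  ext d
  rw [shiftCoeff, h, map_smul, coeff_smul]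
  rfl

theorem smul_mem_badCoeffs {w : Exponent M → ℂ} (hw : w ∈ badCoeffs M) {s : ℂ} (hs : s ≠ 0) :
    s • w ∈ badCoeffs M := by
  obtain ⟨i, m, l, x, u, hu, rfl⟩ := hw
  refine ⟨i, m, l, x, s • u, ?_, (shiftCoeff_smul i x u s).symm⟩
  have h : ∀ j y, fiberForm i (s • u) j y = 0 ↔ fiberForm i u j y = 0 := fun j y => by
    rw [fiberForm_smul_left, mul_eq_zero, or_iff_right hs]
  rcases hu with ⟨e, h1, h2, h3⟩ | ⟨h1, h3⟩
  · refine Or.inl ⟨e, fun d hd => ?_, ⟨h2.1, ?_⟩, ?_⟩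
    · simp [h1 d hd]
    · simpa using ⟨hs, h2.2⟩
    · simpa only [h] using h3
  · refine Or.inr ⟨fun d hd => ?_, ?_⟩
    · simp [h1 d hd]
    · simpa only [h] using h3

/-- Polynomials in `s` which are constant for all but one value of `s`. -/
theorem eq_zero_of_sum_pow_eq_const (a : ℕ → ℂ) (n : ℕ) (c s₀ : ℂ)
    (h : ∀ s, s ≠ s₀ → ∑ j ∈ Finset.range (n + 1), s ^ (n - j) * a j = c) (j : ℕ) (hj : j < n) :
    a j = 0 := by
  let p : Polynomial ℂ := ∑ j ∈ Finset.range (n + 1), Polynomial.monomial (n - j) (a j)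
  have hp : p = Polynomial.C c := by
    refine Polynomial.eq_of_infinite_eval_eq _ _ ((Set.infinite_univ.sdiff
      (Set.finite_singleton s₀)).mono ?_)
    rintro s ⟨-, hs⟩
    rw [Set.mem_ofPred_eq, Polynomial.eval_C, ← h s hs, Polynomial.eval_finsetSum]
    refine Finset.sum_congr rfl fun j _ => ?_
    rw [Polynomial.eval_monomial, mul_comm]
  have h1 := congrArg (Polynomial.coeff · (n - j)) hp
  simp only [p, Polynomial.finsetSum_coeff, Polynomial.coeff_monomial, Polynomial.coeff_C] at h1
  rw [if_neg (by omega), Finset.sum_eq_single j] at h1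
  · simpa using h1
  · intro b hb hbj
    rw [Finset.mem_range] at hb
    rw [if_neg (by omega)]
  · intro hj'
    exact absurd (Finset.mem_range.2 (by omega)) hj'

end Centred

/-! ### Bad hypersurfaces have bad coefficients -/

section BadPoints

variable {M : ℕ}

/-- Otherwise the normalized points would lie in a finite union of finite boxes. -/
theorem exists_infinite_coordinate {κ : Type*} [Finite κ] (Z : Set (κ → ℂ))
    (hZ : {y ∈ Z | ∃ m, y m = 1}.Infinite) :
    ∃ m l, {ρ : ℂ | ∃ y ∈ Z, y m = 1 ∧ y l = ρ}.Infinite := by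
  by_contra hcon
  push Not at hcon
  refine hZ ?_
  refine Set.Finite.subset (Set.finite_iUnion fun m => Set.Finite.pi (hcon m)) ?_
  rintro y ⟨hy, m, hm⟩
  rw [Set.mem_iUnion]
  exact ⟨m, fun l _ => ⟨y, hy, hm, rfl⟩⟩

/-- For finitely many nonzero vectors some linear form vanishes at none of them, so a cone that
meets every hyperplane nontrivially has infinitely many directions. -/
theorem infinite_of_forall_dual {κ : Type*} [Finite κ] (Z : Set (κ → ℂ))
    (hs : ∀ y ∈ Z, ∀ s : ℂ, s • y ∈ Z)
    (hZ : ∀ L : Module.Dual ℂ (κ → ℂ), ∃ y ∈ Z, y ≠ 0 ∧ L y = 0) :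
    {y ∈ Z | ∃ m, y m = 1}.Infinite := by
  intro hfin
  have := hfin.to_subtype
  obtain ⟨L, hL⟩ := Module.exists_dual_forall_apply_ne_zero (K := ℂ)
    (fun y : {y ∈ Z | ∃ m, y m = 1} => (y : κ → ℂ)) (by
      rintro ⟨y, hy, m, hm⟩ h
      rw [show y = 0 from h] at hm
      exact zero_ne_one hm)
  obtain ⟨y, hyZ, hy0, hLy⟩ := hZ L
  obtain ⟨m, hm⟩ := Function.ne_iff.1 hy0
  refine hL ⟨(y m)⁻¹ • y, hs y hyZ _, m, ?_⟩ ?_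
  · simpa using inv_mul_cancel₀ hm
  · change L ((y m)⁻¹ • y) = 0
    rw [map_smul, hLy, smul_zero]

theorem eval_smul_of_isHomogeneous {R σ : Type*} [CommRing R] [Fintype σ] {n : ℕ}
    {g : MvPolynomial σ R} (hg : g.IsHomogeneous n) (s : R) (p : σ → R) :
    eval (s • p) g = s ^ n * eval p g := by
  rw [eval_eq', eval_eq', Finset.mul_sum]
  refine Finset.sum_congr rfl fun d hd => ?_
  have h6 : ∑ a, d a = n := by
    rw [← Finsupp.degree_eq_sum, Finsupp.degree_eq_weight_one]
    exact hg (mem_support_iff.1 hd)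
  simp only [Pi.smul_apply, smul_eq_mul, mul_pow, Finset.prod_mul_distrib]
  rw [Finset.prod_pow_eq_pow_sum, h6]
  ring

theorem eval_add_smul_eq_sum_localPart {b : Module.Basis (Fin (M + 1)) ℂ (Fin (M + 1) → ℂ)}
    {f : MvPolynomial (Fin (M + 1)) ℂ} (hf : f.IsHomogeneous M) (z : Fin M → ℂ) (s : ℂ) :
    eval (b 0 + s • ∑ k, z k • b k.succ) f =
      ∑ j ∈ Finset.range (M + 1), s ^ j * eval z (localPart b f j) := by
  have h1 : eval (b 0 + s • ∑ k, z k • b k.succ) f = eval (s • z) (localEquation b f) := by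
    rw [localEquation, ← coe_aeval_eq_eval (s • z), RingHom.coe_coe, comp_aeval_apply,
      ← coe_aeval_eq_eval, RingHom.coe_coe]
    congr 2
    ext j
    simp only [Pi.add_apply, Pi.smul_apply, smul_eq_mul, Finset.sum_apply, map_add, map_sum,
      map_mul, aeval_C, aeval_X, Algebra.algebraMap_self, RingHom.id_apply, Finset.mul_sum]
    congr 1
    refine Finset.sum_congr rfl fun k _ => ?_
    ring
  have hdeg : (localEquation b f).totalDegree ≤ M := by
    have h2 : (localEquation b f) = ∑ d ∈ f.support, C (coeff d f) *
        ∏ j, (C (b 0 j) + ∑ k : Fin M, C (b k.succ j) * X k) ^ d j := by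
      rw [localEquation, aeval_def, eval₂_eq']
      rfl
    rw [h2]
    refine totalDegree_finsetSum_le fun d hd => ?_
    refine (totalDegree_mul _ _).trans ?_
    rw [totalDegree_C, zero_add]
    refine (totalDegree_finsetProd _ _).trans ?_
    have h3 : ∑ j, d j = M := by
      rw [← Finsupp.degree_eq_sum, Finsupp.degree_eq_weight_one]
      exact hf (mem_support_iff.1 hd)
    refine le_trans ?_ h3.le
    refine Finset.sum_le_sum fun j _ => ?_
    refine (totalDegree_pow _ _).trans ?_
    refine (Nat.mul_le_mul_left _ ?_).trans (mul_one _).le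
    refine (totalDegree_add _ _).trans (max_le ?_ ?_)
    · rw [totalDegree_C]
      exact zero_le_one
    · refine totalDegree_finsetSum_le fun k _ => ?_
      refine (totalDegree_mul _ _).trans ?_
      rw [totalDegree_C, totalDegree_X, zero_add]
  have h4 : localEquation b f = ∑ j ∈ Finset.range (M + 1), localPart b f j := by
    conv_lhs => rw [← sum_homogeneousComponent (localEquation b f)]
    refine Finset.sum_subset (by
      intro j
      simp only [Finset.mem_range]
      omega) fun j _ hj => ?_
    rw [Finset.mem_range, not_lt] at hj
    exact homogeneousComponent_eq_zero _ _ (by omega)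
  rw [h1, h4, map_sum]
  refine Finset.sum_congr rfl fun j _ => ?_
  exact eval_smul_of_isHomogeneous (homogeneousComponent_isHomogeneous j _) s z

/-- Points of high contact, in centred coordinates. -/
theorem fiberForm_eq_zero_of_localPart (hM : 1 ≤ M)
    {b : Module.Basis (Fin (M + 1)) ℂ (Fin (M + 1) → ℂ)} {f : MvPolynomial (Fin (M + 1)) ℂ}
    (hf : f.IsHomogeneous M) (i : Fin (M + 1)) (p : Fin (M + 1) → ℂ) (hp : p i = 1) (s : ℂ)
    (hs : s ≠ 0) (hb : b 0 = s • p) (hb0 : eval (b 0) f = 0) (z : Fin M → ℂ)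
    (hz : ∀ j, j < M - 1 → eval z (localPart b f (j + 1)) = 0) (j : ℕ) (hj : j < M) :
    fiberForm i (centredCoeff i (fun a : {a // a ≠ i} => p a) f) j
      (fun a => (∑ k, z k • b k.succ) a - (∑ k, z k • b k.succ) i * p a) = 0 := by
  set v : Fin (M + 1) → ℂ := ∑ k, z k • b k.succ with hv
  have hq0 : eval z (localPart b f 0) = 0 := by
    have h1 := eval_add_smul_eq_sum_localPart hf z 0 (b := b)
    rw [zero_smul, add_zero, hb0, Finset.sum_eq_single 0] at h1
    · simpa using h1.symm
    · intro j _ hj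
      rw [zero_pow hj, zero_mul]
    · simp
  have h1 : ∀ t : ℂ, eval (b 0 + t • v) f = t ^ M * eval z (localPart b f M) := by
    intro t
    rw [eval_add_smul_eq_sum_localPart hf z t, Finset.sum_eq_single M]
    · intro j hj hjM
      rw [Finset.mem_range] at hj
      rcases Nat.eq_zero_or_pos j with h0 | h0
      · rw [h0, hq0, mul_zero]
      · have h2 := hz (j - 1) (by omega)
        rw [Nat.sub_add_cancel h0] at h2
        rw [h2, mul_zero]
    · simp
  refine eq_zero_of_sum_pow_eq_const (fun j => fiberForm i (centredCoeff i (fun a : {a // a ≠ i} => p a) f) j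
      (fun a => v a - v i * p a)) M (eval z (localPart b f M)) (v i) ?_ j hj
  -- For `t ≠ v i` the point `v + (t - v i) • p` is a multiple of a point of the line `b 0 + ℂ v`.
  -- On this line only the part of degree `M` survives, and the scalar factors cancel, so the value
  -- of `f` does not depend on `t`.
  intro t ht
  have ht' : t - v i ≠ 0 := sub_ne_zero.2 ht
  have h2 := eval_eq_sum_fiberForm i (fun a : {a // a ≠ i} => p a) hf (v + (t - v i) • p)
  have h3 : (v + (t - v i) • p) i = t := by simp [hp]
  have h4 : (fun a : {a // a ≠ i} => (v + (t - v i) • p) a - t * p a) =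
      fun a : {a // a ≠ i} => v a - v i * p a := by
    ext a
    simp only [Pi.add_apply, Pi.smul_apply, smul_eq_mul]
    ring
  rw [h3, h4] at h2
  rw [← h2]
  have h5 : v + (t - v i) • p = ((t - v i) / s) • (b 0 + (s / (t - v i)) • v) := by
    rw [smul_add, smul_smul, hb, smul_smul]
    rw [show (t - v i) / s * s = t - v i by field_simp,
      show (t - v i) / s * (s / (t - v i)) = 1 by field_simp, one_smul]
    exact add_comm _ _
  rw [h5, eval_smul_of_isHomogeneous hf, h1, ← mul_assoc, ← mul_pow,
    show (t - v i) / s * (s / (t - v i)) = 1 by field_simp, one_pow, one_mul]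

theorem coeff_mem_badCoeffs_of_not_isRegular (hM : 2 ≤ M)
    {b : Module.Basis (Fin (M + 1)) ℂ (Fin (M + 1) → ℂ)} {f : MvPolynomial (Fin (M + 1)) ℂ}
    (hf : f.IsHomogeneous M) (hb0 : eval (b 0) f = 0) (hsm : ∃ j, eval (b 0) (pderiv j f) ≠ 0)
    (hreg : ¬ RingTheory.Sequence.IsRegular (MvPolynomial (Fin M) ℂ)
      ((List.range (M - 1)).map fun i => localPart b f (i + 1))) :
    (fun d : Exponent M => coeff d.1 f) ∈ badCoeffs M := by
  classical
  obtain ⟨i, hi⟩ := Function.ne_iff.1 (b.ne_zero 0)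
  rw [Pi.zero_apply] at hi
  set s := b 0 i with hs
  let p : Fin (M + 1) → ℂ := s⁻¹ • b 0
  have hp : p i = 1 := by
    simp only [p, Pi.smul_apply, smul_eq_mul]
    exact inv_mul_cancel₀ hi
  have hbp : b 0 = s • p := by
    simp only [p, smul_smul, mul_inv_cancel₀ hi, one_smul]
  have hp0 : eval p f = 0 := by
    simp only [p]
    rw [eval_smul_of_isHomogeneous hf, hb0, mul_zero]
  -- Euler's identity at a zero `p` with `p i = 1`: if all the other partial derivatives vanish, so
  -- does the one in direction `i`.
  obtain ⟨a, ha⟩ : ∃ a : {a // a ≠ i}, eval p (pderiv (a : Fin (M + 1)) f) ≠ 0 := by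
    by_contra hcon
    push Not at hcon
    have h1 := congrArg (eval p) (hf.sum_X_mul_pderiv)
    rw [map_sum, map_nsmul, hp0, smul_zero, Fintype.sum_eq_add_sum_subtype_ne _ i] at h1
    simp only [map_mul, eval_X, hcon, mul_zero, Finset.sum_const_zero, add_zero, hp, one_mul] at h1
    obtain ⟨j, hj⟩ := hsm
    apply hj
    rw [hbp, eval_smul_of_isHomogeneous (hf.pderiv (i := j))]
    by_cases hji : j = i
    · rw [hji, h1, mul_zero]
    · rw [hcon ⟨j, hji⟩, mul_zero]
  set u := centredCoeff i (fun a : {a // a ≠ i} => p a) f with hu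
  let Z : Set ({a // a ≠ i} → ℂ) := {y | ∀ j ∈ Set.Ico 1 M, fiberForm i u j y = 0}
  have hinf : {y ∈ Z | ∃ m, y m = 1}.Infinite := by
    refine infinite_of_forall_dual Z (fun y hy t j hj => ?_) fun L => ?_
    · rw [fiberForm_smul, hy j hj, mul_zero]
    · by_contra hcon
      push Not at hcon
      apply hreg
      -- Directions are compared modulo `p`: the given basis yields an isomorphism with the centred
      -- affine coordinates, and `L` is pulled back along it.
      let Y : Fin M → {a // a ≠ i} → ℂ := fun k a => b k.succ a - b k.succ i * p a
      refine isRegular_of_forall_eq_zero (by omega) (fun i => localPart b f (i + 1))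
        (fun j => homogeneousComponent_isHomogeneous _ _) (∑ k, C (L (Y k)) * X k) ?_ ?_
      · refine IsHomogeneous.sum _ _ _ fun k _ => ?_
        exact (isHomogeneous_C (Fin M) (L (Y k))).mul (isHomogeneous_X ℂ k)
      · intro z hz hℓ
        have hy : (fun a : {a // a ≠ i} => (∑ k, z k • b k.succ) a -
            (∑ k, z k • b k.succ) i * p a) = ∑ k, z k • Y k := by
          ext a
          simp only [Y, Finset.sum_apply, Pi.smul_apply, smul_eq_mul, mul_sub,
            Finset.sum_sub_distrib, Finset.sum_mul, mul_assoc]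
        have hyZ : ∑ k, z k • Y k ∈ Z := by
          intro j hj
          rw [← hy]
          exact fiberForm_eq_zero_of_localPart (by omega) hf i p hp s hi hbp hb0 z hz j hj.2
        have hL : L (∑ k, z k • Y k) = 0 := by
          rw [map_sum, ← hℓ, map_sum]
          refine Finset.sum_congr rfl fun k _ => ?_
          rw [map_smul, map_mul, eval_C, eval_X, smul_eq_mul, mul_comm]
        have hy0 : ∑ k, z k • Y k = 0 := by
          by_contra h0
          exact hcon _ hyZ h0 hL
        have hv : ∑ k, z k • b k.succ = ((∑ k, z k • b k.succ) i * s⁻¹) • b 0 := by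
          ext c
          by_cases hc : c = i
          · rw [hc, Pi.smul_apply, smul_eq_mul, mul_assoc, inv_mul_cancel₀ hi, mul_one]
          · have h1 := congrFun (hy.trans hy0) ⟨c, hc⟩
            simp only [Pi.zero_apply] at h1
            rw [sub_eq_zero.1 h1]
            simp only [p, Pi.smul_apply, smul_eq_mul, mul_assoc]
        have hli := Fintype.linearIndependent_iff.1 b.linearIndependent
          (Fin.cons (-((∑ k, z k • b k.succ) i * s⁻¹)) z) (by
            rw [Fin.sum_univ_succ]
            simp only [Fin.cons_zero, Fin.cons_succ]
            rw [neg_smul, ← hv, neg_add_cancel])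
        ext k
        simpa using hli k.succ
  obtain ⟨m, l, hml⟩ := exists_infinite_coordinate Z hinf
  refine ⟨i, m, l, -(fun a : {a // a ≠ i} => p a), u, Or.inl ⟨(linExponent (by omega) i a).1, ?_, ⟨?_, ?_⟩, ?_⟩,
    coeff_eq_shiftCoeff i _ hf⟩
  · intro d hd
    rw [hu, centredCoeff_eq_eval i p hp hf d hd, hp0]
  · exact (linExponent (by omega) i a).2
  · rw [hu, centredCoeff_linExponent (by omega) i p hp hf]
    exact ha
  · refine hml.mono ?_
    rintro ρ ⟨y, hy, h1, h2⟩
    exact ⟨y, h1, h2, hy⟩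

theorem coeff_mem_badCoeffs_of_infinite (hM : 2 ≤ M) {f : MvPolynomial (Fin (M + 1)) ℂ}
    (hf : f.IsHomogeneous M) (r : Fin (M + 1) → ℂ) (hr : r ≠ 0) (hr0 : eval r f = 0)
    (hsing : ∀ j, eval r (pderiv j f) = 0)
    (hinf : {L : Submodule ℂ (Fin (M + 1) → ℂ) | Module.finrank ℂ L = 2 ∧ r ∈ L ∧
      ∀ v ∈ L, eval v f = 0}.Infinite) :
    (fun d : Exponent M => coeff d.1 f) ∈ badCoeffs M := by
  classical
  obtain ⟨i, hi⟩ := Function.ne_iff.1 hr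
  rw [Pi.zero_apply] at hi
  let p : Fin (M + 1) → ℂ := (r i)⁻¹ • r
  have hp : p i = 1 := by
    simp only [p, Pi.smul_apply, smul_eq_mul]
    exact inv_mul_cancel₀ hi
  have hp0 : eval p f = 0 := by
    simp only [p]
    rw [eval_smul_of_isHomogeneous hf, hr0, mul_zero]
  have hpd : ∀ j, eval p (pderiv j f) = 0 := fun j => by
    simp only [p]
    rw [eval_smul_of_isHomogeneous hf.pderiv, hsing, mul_zero]
  set u := centredCoeff i (fun a : {a // a ≠ i} => p a) f with hu
  let Z : Set ({a // a ≠ i} → ℂ) := {y | ∀ j ∈ Set.Icc 1 M, fiberForm i u j y = 0}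
  have hZ : {y ∈ Z | ∃ m, y m = 1}.Infinite := by
    intro hfin
    -- A line through `p` is recovered from a normalized direction in the hyperplane of vectors with
    -- zero `i`-th coordinate.
    refine hinf ((hfin.image fun y => Submodule.span ℂ
      {p, fun c => if h : c = i then 0 else y ⟨c, h⟩}).subset ?_)
    rintro L ⟨hL2, hrL, hLf⟩
    have hpL : p ∈ L := L.smul_mem _ hrL
    have hpn : p ≠ 0 := by
      intro h
      rw [h] at hp
      exact zero_ne_one hp
    obtain ⟨v, hvL, hv⟩ : ∃ v ∈ L, v ∉ Submodule.span ℂ {p} := by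
      by_contra hcon
      push Not at hcon
      have h1 := Submodule.finrank_mono (show L ≤ Submodule.span ℂ {p} from hcon)
      rw [hL2, finrank_span_singleton hpn] at h1
      omega
    have hyv : v - v i • p ≠ 0 := by
      intro h
      apply hv
      rw [sub_eq_zero.1 h]
      exact Submodule.smul_mem _ _ (Submodule.mem_span_singleton_self p)
    obtain ⟨c, hc⟩ := Function.ne_iff.1 hyv
    rw [Pi.zero_apply] at hc
    have hci : c ≠ i := by
      rintro rfl
      apply hc
      simp [hp]
    set w : Fin (M + 1) → ℂ := ((v - v i • p) c)⁻¹ • (v - v i • p) with hw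
    have hwL : w ∈ L := L.smul_mem _ (L.sub_mem hvL (L.smul_mem _ hpL))
    have hwi : w i = 0 := by simp [hw, hp]
    have hwc : w c = 1 := by
      rw [hw, Pi.smul_apply, smul_eq_mul]
      exact inv_mul_cancel₀ hc
    have hwe : (fun c => if h : c = i then 0 else (fun a : {a // a ≠ i} => w a) ⟨c, h⟩) = w := by
      ext a
      by_cases h : a = i
      · rw [dif_pos h, h, hwi]
      · rw [dif_neg h]
    refine ⟨fun a : {a // a ≠ i} => w a, ⟨?_, ⟨c, hci⟩, hwc⟩, ?_⟩
    · have hsum : ∀ t : ℂ, ∑ j ∈ Finset.range (M + 1),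
          t ^ (M - j) * fiberForm i u j (fun a : {a // a ≠ i} => w a) = 0 := by
        intro t
        have h1 := eval_eq_sum_fiberForm i (fun a : {a // a ≠ i} => p a) hf (t • p + w)
        rw [hLf _ (L.add_mem (L.smul_mem _ hpL) hwL)] at h1
        have h2 : (t • p + w) i = t := by simp [hp, hwi]
        have h3 : (fun a : {a // a ≠ i} => (t • p + w) a - t * p a) =
            fun a : {a // a ≠ i} => w a := by
          ext a
          simp
        rw [h2, h3] at h1
        exact h1.symm
      rintro j ⟨-, hj⟩
      rcases hj.lt_or_eq with hj | rfl
      · exact eq_zero_of_sum_pow_eq_const _ M 0 0 (fun t _ => hsum t) j hj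
      · have h1 := hsum 0
        rw [Finset.sum_eq_single j] at h1
        · simpa using h1
        · intro a ha haj
          rw [Finset.mem_range] at ha
          rw [zero_pow (by omega), zero_mul]
        · simp
    · dsimp only
      rw [hwe]
      refine Submodule.eq_of_le_of_finrank_eq ?_ ?_
      · rw [Submodule.span_le]
        rintro _ (rfl | rfl)
        · exact hpL
        · exact hwL
      · rw [hL2]
        have hli : LinearIndependent ℂ ![p, w] := by
          rw [LinearIndependent.pair_iff]
          intro a b hab
          have h1 := congrFun hab i
          simp only [Pi.add_apply, Pi.smul_apply, smul_eq_mul, hp, hwi, mul_zero, add_zero, mul_one,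
            Pi.zero_apply] at h1
          have h2 := congrFun hab c
          simp only [Pi.add_apply, Pi.smul_apply, smul_eq_mul, hwc, h1, zero_mul, zero_add, mul_one,
            Pi.zero_apply] at h2
          exact ⟨h1, h2⟩
        have h1 := finrank_span_eq_card hli
        rw [Matrix.range_cons, Matrix.range_cons, Matrix.range_empty, Set.union_empty,
          Set.singleton_union, Fintype.card_fin] at h1
        exact h1
  obtain ⟨m, l, hml⟩ := exists_infinite_coordinate Z hZ
  refine ⟨i, m, l, -(fun a : {a // a ≠ i} => p a), u, Or.inr ⟨?_, ?_⟩, coeff_eq_shiftCoeff i _ hf⟩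
  · intro d hd
    have h1 := exponent_sum d i
    rcases Nat.lt_or_ge (d.1 i) M with h | h
    · obtain ⟨a, ha⟩ := (linExponent_bijective (by omega) i).2 ⟨d, by omega⟩
      have h2 : d = (linExponent (by omega) i a).1 := by rw [ha]
      rw [h2, hu, centredCoeff_linExponent (by omega) i p hp hf, hpd]
    · rw [hu, centredCoeff_eq_eval i p hp hf d (by omega), hp0]
  · refine hml.mono ?_
    rintro ρ ⟨y, hy, h1, h2⟩
    exact ⟨y, h1, h2, hy⟩

theorem isHomogeneous_equation (V : ParamSpace M) : V.equation.IsHomogeneous M :=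
  (Projectivization.rep V : homogeneousSubmodule (Fin (M + 1)) ℂ M).2

theorem coords_mem_badCoeffs (hM : 2 ≤ M) {V : ParamSpace M} (hV : V ∉ regularLocus M) :
    V.coords ∈ badCoeffs M := by
  have hf := isHomogeneous_equation V
  simp only [regularLocus, Set.mem_ofPred_eq, not_and_or] at hV
  push Not at hV
  rcases hV with ⟨x, ⟨hx0, j, hxj⟩, hx⟩ | ⟨x, ⟨hx0, hx⟩, hinf⟩
  · simp only [RegularAt, not_forall] at hx
    obtain ⟨b, hb, hreg⟩ := hx
    have h1 : Projectivization.mk ℂ (b 0) (b.ne_zero 0) =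
        Projectivization.mk ℂ x.rep x.rep_nonzero := by rw [hb, Projectivization.mk_rep]
    obtain ⟨c, hc⟩ := (Projectivization.mk_eq_mk_iff ℂ _ _ _ _).1 h1
    have hc' : b 0 = (c : ℂ) • x.rep := hc.symm
    refine coeff_mem_badCoeffs_of_not_isRegular hM hf ?_ ⟨j, ?_⟩ hreg
    · rw [hc', eval_smul_of_isHomogeneous hf, show eval x.rep V.equation = 0 from hx0, mul_zero]
    · rw [hc', eval_smul_of_isHomogeneous hf.pderiv]
      exact mul_ne_zero (pow_ne_zero _ c.ne_zero) hxj
  · refine coeff_mem_badCoeffs_of_infinite hM hf x.rep x.rep_nonzero hx0 hx ?_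
    have h1 : (linesThrough V.equation x).Infinite := hinf
    refine h1.mono ?_
    rintro L ⟨hL, hxL, hLf⟩
    refine ⟨hL, hxL ?_, hLf⟩
    rw [Projectivization.submodule_eq]
    exact Submodule.mem_span_singleton_self _

end BadPoints

/-! ### Cones over closed subsets of the parameter space -/

section Cones

variable {M : ℕ}

/-- The restriction of a polynomial to the line spanned by `w`. -/
noncomputable def lineRestrict {κ : Type*} (w : κ → ℂ) : MvPolynomial κ ℂ →ₐ[ℂ] Polynomial ℂ :=
  aeval fun e => Polynomial.C (w e) * Polynomial.X

theorem eval_lineRestrict {κ : Type*} (w : κ → ℂ) (t : ℂ) (G : MvPolynomial κ ℂ) :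
    (lineRestrict w G).eval t = eval (t • w) G := by
  have h : ((Polynomial.aeval t).comp (lineRestrict w) : MvPolynomial κ ℂ →ₐ[ℂ] ℂ) =
      aeval (t • w) := by
    ext1 e
    simp only [lineRestrict, AlgHom.comp_apply, aeval_X, map_mul, Polynomial.aeval_C,
      Polynomial.aeval_X, Algebra.algebraMap_self, RingHom.id_apply, Pi.smul_apply, smul_eq_mul]
    exact mul_comm _ _
  have h2 := DFunLike.congr_fun h G
  simpa [coe_aeval_eq_eval] using h2

theorem lineRestrict_eq_zero_iff {κ : Type*} (w : κ → ℂ) (G : MvPolynomial κ ℂ) :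
    lineRestrict w G = 0 ↔ ∀ t : ℂ, t ≠ 0 → eval (t • w) G = 0 := by
  refine ⟨fun h t _ => by rw [← eval_lineRestrict, h, Polynomial.eval_zero], fun h => ?_⟩
  refine Polynomial.eq_zero_of_infinite_isRoot _ ((Set.finite_singleton (0 : ℂ)).infinite_compl.mono
    fun t ht => ?_)
  change (lineRestrict w G).eval t = 0
  rw [eval_lineRestrict]
  exact h t ht

/-- Vanishing on a line through the origin therefore means vanishing of every homogeneous component,
which is a closed condition in projective space. -/
theorem coeff_lineRestrict {κ : Type*} (w : κ → ℂ) (n : ℕ) (G : MvPolynomial κ ℂ) :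
    (lineRestrict w G).coeff n = eval w (homogeneousComponent n G) := by
  classical
  induction G using MvPolynomial.induction_on' with
  | add p q hp hq => rw [map_add, Polynomial.coeff_add, hp, hq, map_add, map_add]
  | monomial d c =>
    have h1 : lineRestrict w (monomial d c) =
        Polynomial.C (eval w (monomial d c)) * Polynomial.X ^ d.degree := by
      rw [lineRestrict, aeval_monomial, eval_monomial, Finsupp.prod, Finsupp.prod,
        Finsupp.degree_apply, ← Finset.prod_pow_eq_pow_sum, map_mul, map_prod, mul_assoc,
        ← Finset.prod_mul_distrib]
      simp only [mul_pow, map_pow, Polynomial.algebraMap_eq]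
    rw [h1, Polynomial.coeff_C_mul_X_pow, homogeneousComponent_of_mem (isHomogeneous_monomial c rfl)]
    split_ifs <;> simp_all

theorem isClosed_iff {Z : Set (ParamSpace M)} : IsClosed Z ↔ IsZariskiClosed Z := by
  rw [← isOpen_compl_iff]
  change IsZariskiClosed Zᶜᶜ ↔ _
  rw [compl_compl]

theorem isClosed_setOf_lineRestrict_eq_zero (G : MvPolynomial (Exponent M) ℂ) :
    IsClosed {V : ParamSpace M | lineRestrict V.coords G = 0} := by
  rw [isClosed_iff]
  refine ⟨Set.range fun n => homogeneousComponent n G, ?_, ?_⟩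
  · rintro _ ⟨n, rfl⟩
    exact ⟨n, homogeneousComponent_isHomogeneous n G⟩
  · ext V
    simp only [zeroLocus, Set.mem_ofPred_eq, Set.forall_mem_range, Polynomial.ext_iff,
      coeff_lineRestrict, Polynomial.coeff_zero]

/-- The ideal of the cone over a set of points of the parameter space. -/
noncomputable def coneIdeal (Z : Set (ParamSpace M)) : Ideal (MvPolynomial (Exponent M) ℂ) :=
  ⨅ V ∈ Z, RingHom.ker (lineRestrict V.coords)

theorem mem_coneIdeal {Z : Set (ParamSpace M)} {G : MvPolynomial (Exponent M) ℂ} :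
    G ∈ coneIdeal Z ↔ Z ⊆ {V : ParamSpace M | lineRestrict V.coords G = 0} := by
  simp only [coneIdeal, Submodule.mem_iInf, RingHom.mem_ker]
  rfl

theorem coneIdeal_isPrime {Z : Set (ParamSpace M)} (hZ : IsIrreducible Z) :
    (coneIdeal Z).IsPrime := by
  refine ⟨?_, fun {F G} h => ?_⟩
  · rw [Ne, Ideal.eq_top_iff_one, mem_coneIdeal]
    obtain ⟨V, hV⟩ := hZ.1
    intro h
    have h1 : lineRestrict V.coords 1 = 0 := h hV
    rw [map_one] at h1
    exact one_ne_zero h1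
  · simp only [mem_coneIdeal] at h ⊢
    refine isPreirreducible_iff_isClosed_union_isClosed.1 hZ.2 _ _
      (isClosed_setOf_lineRestrict_eq_zero F) (isClosed_setOf_lineRestrict_eq_zero G) ?_
    intro V hV
    have h1 : lineRestrict V.coords (F * G) = 0 := h hV
    rw [map_mul] at h1
    exact mul_eq_zero.1 h1

theorem lineRestrict_eq_zero_of_isHomogeneous {w : Exponent M → ℂ} {n : ℕ}
    {G : MvPolynomial (Exponent M) ℂ} (hG : G.IsHomogeneous n) :
    lineRestrict w G = 0 ↔ eval w G = 0 := by
  rw [lineRestrict_eq_zero_iff]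
  refine ⟨fun h => ?_, fun h t _ => ?_⟩
  · simpa using h 1 one_ne_zero
  · rw [eval_smul_of_isHomogeneous hG, h, mul_zero]

/-- A closed set is recovered from its cone ideal, since it is cut out by homogeneous polynomials.
-/
theorem coneIdeal_lt_coneIdeal {Z W : Set (ParamSpace M)} (hZ : IsClosed Z) (h : Z ⊂ W) :
    coneIdeal W < coneIdeal Z := by
  refine lt_of_le_of_ne (fun G hG => mem_coneIdeal.2 (h.1.trans (mem_coneIdeal.1 hG)))
    fun heq => h.2 ?_
  obtain ⟨S, hS, rfl⟩ := isClosed_iff.1 hZ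
  intro V hV G hG
  obtain ⟨n, hn⟩ := hS G hG
  have h1 : G ∈ coneIdeal (zeroLocus S) := mem_coneIdeal.2 fun V' hV' =>
    (lineRestrict_eq_zero_of_isHomogeneous hn).2 (hV' G hG)
  rw [← heq, mem_coneIdeal] at h1
  exact (lineRestrict_eq_zero_of_isHomogeneous hn).1 (h1 hV)

theorem coords_ne_zero (V : ParamSpace M) : V.coords ≠ 0 := by
  intro h
  have h1 : V.equation = 0 := by
    rw [← formOf_coeff (isHomogeneous_equation V)]
    simp only [formOf]
    refine Finset.sum_eq_zero fun d _ => ?_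
    have h2 : coeff d.1 V.equation = 0 := congrFun h d
    rw [h2, monomial_zero]
  exact Projectivization.rep_nonzero V (Subtype.ext h1)

theorem exists_coords_eq_smul {w : Exponent M → ℂ} (hw : w ≠ 0) :
    ∃ (V : ParamSpace M) (s : ℂ), s ≠ 0 ∧ V.coords = s • w := by
  classical
  have hc : ∀ d : Exponent M, coeff d.1 (formOf w) = w d := by
    intro d
    rw [formOf, coeff_sum, Finset.sum_eq_single d]
    · simp
    · intro e _ he
      rw [coeff_monomial, if_neg fun h => he (Subtype.ext h)]
    · simp
  have hh : (formOf w).IsHomogeneous M :=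
    IsHomogeneous.sum _ _ _ fun d _ => isHomogeneous_monomial _ d.2
  have hne : (⟨formOf w, hh⟩ : homogeneousSubmodule (Fin (M + 1)) ℂ M) ≠ 0 := by
    intro h
    apply hw
    ext d
    rw [← hc d, show formOf w = 0 from congrArg Subtype.val h, coeff_zero, Pi.zero_apply]
  obtain ⟨a, ha⟩ := Projectivization.exists_smul_eq_mk_rep ℂ _ hne
  let V : ParamSpace M := Projectivization.mk ℂ _ hne
  have h1 : (a : ℂ) • formOf w = V.equation := congrArg Subtype.val ha
  refine ⟨V, a, a.ne_zero, ?_⟩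
  ext d
  change coeff d.1 V.equation = _
  rw [← h1, coeff_smul, hc, Pi.smul_apply]

theorem coneIdeal_lt_ker {Z : Set (ParamSpace M)} (hZ : Z.Nonempty) :
    coneIdeal Z < RingHom.ker (constantCoeff : MvPolynomial (Exponent M) ℂ →+* ℂ) := by
  obtain ⟨V, hV⟩ := hZ
  rw [SetLike.lt_iff_le_and_exists]
  refine ⟨fun G hG => ?_, ?_⟩
  · have h1 : lineRestrict V.coords G = 0 := mem_coneIdeal.1 hG hV
    have h2 := congrArg (Polynomial.eval 0) h1
    rw [eval_lineRestrict, zero_smul, Polynomial.eval_zero] at h2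
    rw [RingHom.mem_ker, ← h2, eval_zero]
  · obtain ⟨d, hd⟩ := Function.ne_iff.1 (coords_ne_zero V)
    refine ⟨X d, by simp [RingHom.mem_ker], fun h => hd ?_⟩
    have h1 : lineRestrict V.coords (X d) = 0 := mem_coneIdeal.1 h hV
    rw [lineRestrict_eq_zero_of_isHomogeneous (isHomogeneous_X ℂ d), eval_X] at h1
    exact h1

/-- The cone ideals of the members of the chain form a chain of primes above that of the largest
member. The latter contains every polynomial vanishing on the bad coefficients, so the dimension
bound for such primes applies. -/
theorem length_add_codim_lt (hM : 5 ≤ M)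
    (p : LTSeries (TopologicalSpace.IrreducibleCloseds ↥(closure (regularLocus M)ᶜ))) :
    p.length + (M * (M - 5) / 2 + 4) + 1 ≤ Fintype.card (Exponent M) := by
  let Z : Fin (p.length + 1) → Set (ParamSpace M) := fun i => 
    Subtype.val '' (p i : Set ↥(closure (regularLocus M)ᶜ))
  have hcl : ∀ i, IsClosed (Z i) := fun i =>
    isClosed_closure.isClosedEmbedding_subtypeVal.isClosedMap _ (p i).isClosed
  have hirr : ∀ i, IsIrreducible (Z i) := fun i =>
    (p i).isIrreducible.image _ continuous_subtype_val.continuousOn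
  have hlt : ∀ i j, i < j → Z i ⊂ Z j := fun i j hij => by
    have h1 : p i < p j := p.strictMono hij
    have h2 : (p i : Set ↥(closure (regularLocus M)ᶜ)) ⊂ p j := h1
    exact Subtype.val_injective.image_strictMono h2
  have hP := coneIdeal_isPrime (hirr (Fin.last _))
  let Q : Fin (p.length + 1) → PrimeSpectrum (MvPolynomial (Exponent M) ℂ) := fun i =>
    ⟨coneIdeal (Z i.rev), coneIdeal_isPrime (hirr _)⟩
  have hQ : ∀ i j, i < j → Q i < Q j := fun i j hij =>
    coneIdeal_lt_coneIdeal (hcl _) (hlt _ _ (Fin.rev_lt_rev.2 hij))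
  have hQP : ∀ i, Q i ∈ PrimeSpectrum.zeroLocus
      (coneIdeal (Z (Fin.last _)) : Set (MvPolynomial (Exponent M) ℂ)) := fun i => by
    change coneIdeal _ ≤ coneIdeal _
    rcases (Fin.le_last i.rev).eq_or_lt with h | h
    · rw [h]
    · exact (coneIdeal_lt_coneIdeal (hcl _) (hlt _ _ h)).le
  let q : LTSeries (PrimeSpectrum.zeroLocus
      (coneIdeal (Z (Fin.last _)) : Set (MvPolynomial (Exponent M) ℂ))) :=
    LTSeries.mk p.length (fun i => ⟨Q i, hQP i⟩) (fun i j hij => hQ i j hij)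
  have hm : Q (Fin.last _) <
      ⟨RingHom.ker (constantCoeff : MvPolynomial (Exponent M) ℂ →+* ℂ), RingHom.ker_isPrime _⟩ :=
    coneIdeal_lt_ker (hirr _).1
  have hmP : coneIdeal (Z (Fin.last _)) ≤
      RingHom.ker (constantCoeff : MvPolynomial (Exponent M) ℂ →+* ℂ) :=
    (coneIdeal_lt_ker (hirr _).1).le
  -- The vertex of the cone adds one more prime; this is the passage from affine to projective
  -- dimension.
  let q' := q.snoc ⟨⟨RingHom.ker (constantCoeff : MvPolynomial (Exponent M) ℂ →+* ℂ),
    RingHom.ker_isPrime _⟩, hmP⟩ hm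
  have h1 := Order.LTSeries.length_le_krullDim q'
  rw [← ringKrullDim_quotient] at h1
  have h2 := ringKrullDim_le_of_badCoeffs hM (coneIdeal (Z (Fin.last _))) (by
    intro G hG
    rw [mem_coneIdeal]
    have h3 : closure (regularLocus M)ᶜ ⊆ {V : ParamSpace M | lineRestrict V.coords G = 0} := by
      refine closure_minimal ?_ (isClosed_setOf_lineRestrict_eq_zero G)
      intro V hV
      refine (lineRestrict_eq_zero_iff _ _).2 fun t ht => ?_
      exact hG _ (smul_mem_badCoeffs (coords_mem_badCoeffs (by omega) hV) ht)
    rintro _ ⟨V, -, rfl⟩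
    exact h3 V.2)
  have h4 := (add_le_add_left h1 ((M * (M - 5) / 2 + 4 : ℕ) : WithBot ℕ∞)).trans h2
  have h5 : q'.length = p.length + 1 := rfl
  rw [h5] at h4
  have h6 : p.length + 1 + (M * (M - 5) / 2 + 4) ≤ Fintype.card (Exponent M) := by
    exact_mod_cast h4
  omega

/-- The linear subspace on which all but the first `r + 1` coordinates vanish. -/
def coordinateSubspace (r : ℕ) : Set (ParamSpace M) :=
  {V | ∀ d, r < (Fintype.equivFin (Exponent M) d : ℕ) → V.coords d = 0}

theorem isClosed_coordinateSubspace (r : ℕ) :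
    IsClosed (coordinateSubspace r : Set (ParamSpace M)) := by
  rw [isClosed_iff]
  refine ⟨{G | ∃ d, r < (Fintype.equivFin (Exponent M) d : ℕ) ∧ G = X d}, ?_, ?_⟩
  · rintro _ ⟨d, -, rfl⟩
    exact ⟨1, isHomogeneous_X ℂ d⟩
  · ext V
    constructor
    · rintro h _ ⟨d, hd, rfl⟩
      rw [eval_X]
      exact h d hd
    · intro h d hd
      have h1 := h (X d) ⟨d, hd, rfl⟩
      rwa [eval_X] at h1

theorem isIrreducible_coordinateSubspace (hM : 0 < Fintype.card (Exponent M)) (r : ℕ) :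
    IsIrreducible (coordinateSubspace r : Set (ParamSpace M)) := by
  classical
  let d₀ : Exponent M := (Fintype.equivFin (Exponent M)).symm ⟨0, hM⟩
  have hd₀ : ¬ r < (Fintype.equivFin (Exponent M) d₀ : ℕ) := by simp [d₀]
  let φ : MvPolynomial (Exponent M) ℂ →ₐ[ℂ] MvPolynomial (Exponent M) ℂ :=
    aeval fun d => if r < (Fintype.equivFin (Exponent M) d : ℕ) then 0 else X d
  let τ : (Exponent M → ℂ) → Exponent M → ℂ := fun w d =>
    if r < (Fintype.equivFin (Exponent M) d : ℕ) then 0 else w d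
  have hφ : ∀ w G, eval w (φ G) = eval (τ w) G := fun w G => by
    have h : (aeval w : MvPolynomial (Exponent M) ℂ →ₐ[ℂ] ℂ).comp φ = aeval (τ w) := by
      ext1 d
      by_cases hd : r < (Fintype.equivFin (Exponent M) d : ℕ) <;> simp [φ, τ, hd]
    have h2 := DFunLike.congr_fun h G
    simpa [coe_aeval_eq_eval] using h2
  have hX : φ (X d₀) ≠ 0 := by
    simp only [φ, aeval_X, if_neg hd₀]
    exact X_ne_zero d₀
  have hpt : ∀ G, φ G ≠ 0 → ∃ V ∈ (coordinateSubspace r : Set (ParamSpace M)), ∃ s : ℂ, s ≠ 0 ∧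
      eval (s • V.coords) G ≠ 0 := by
    intro G hG
    -- The factor `X d₀` ensures that the truncated vector `τ w` is nonzero and so defines a point
    -- of projective space.
    obtain ⟨w, hw⟩ : ∃ w, eval w (φ (G * X d₀)) ≠ 0 := by
      by_contra hcon
      push Not at hcon
      refine mul_ne_zero hG hX ?_
      rw [← map_mul]
      exact MvPolynomial.funext fun w => by rw [hcon, map_zero]
    rw [hφ, map_mul, eval_X] at hw
    have hw0 : τ w ≠ 0 := fun h => hw (by rw [h, Pi.zero_apply, mul_zero])
    obtain ⟨V, s, hs, hV⟩ := exists_coords_eq_smul hw0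
    refine ⟨V, fun d hd => ?_, s⁻¹, inv_ne_zero hs, ?_⟩
    · simp [hV, τ, hd]
    · rw [hV, smul_smul, inv_mul_cancel₀ hs, one_smul]
      exact left_ne_zero_of_mul hw
  have hne : ∀ V ∈ (coordinateSubspace r : Set (ParamSpace M)), ∀ G, eval V.coords G ≠ 0 →
      φ G ≠ 0 := by
    intro V hV G hG h
    apply hG
    have h1 : τ V.coords = V.coords := by
      ext d
      by_cases hd : r < (Fintype.equivFin (Exponent M) d : ℕ)
      · simp only [τ, if_pos hd, hV d hd]
      · simp only [τ, if_neg hd]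
    rw [← h1, ← hφ, h, map_zero]
  refine ⟨?_, ?_⟩
  · obtain ⟨V, hV, -⟩ := hpt 1 (by rw [map_one]; exact one_ne_zero)
    exact ⟨V, hV⟩
  · rw [isPreirreducible_iff_isClosed_union_isClosed]
    intro A B hA hB hAB
    obtain ⟨S, hS, rfl⟩ := isClosed_iff.1 hA
    obtain ⟨T, hT, rfl⟩ := isClosed_iff.1 hB
    by_contra hcon
    simp only [Set.not_subset, not_or] at hcon
    obtain ⟨⟨V, hV, hVS⟩, W, hW, hWT⟩ := hcon
    simp only [zeroLocus, Set.mem_ofPred_eq, not_forall] at hVS hWT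
    obtain ⟨F, hF, hVF⟩ := hVS
    obtain ⟨G, hG, hWG⟩ := hWT
    obtain ⟨U, hU, s, hs, hUFG⟩ := hpt (F * G) (by
      rw [map_mul]
      exact mul_ne_zero (hne V hV F hVF) (hne W hW G hWG))
    obtain ⟨m, hm⟩ := hS F hF
    obtain ⟨n, hn⟩ := hT G hG
    rw [eval_smul_of_isHomogeneous (hm.mul hn), map_mul] at hUFG
    apply hUFG
    rcases hAB hU with h | h
    · rw [h F hF, zero_mul, mul_zero]
    · rw [h G hG, mul_zero, mul_zero]

theorem coordinateSubspace_ssubset {r r' : ℕ} (h : r < r')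
    (hr' : r' < Fintype.card (Exponent M)) :
    (coordinateSubspace r : Set (ParamSpace M)) ⊂ coordinateSubspace r' := by
  classical
  refine ⟨fun V hV d hd => hV d (h.trans hd), fun hsub => ?_⟩
  let d₁ : Exponent M := (Fintype.equivFin (Exponent M)).symm ⟨r', hr'⟩
  obtain ⟨V, s, hs, hV⟩ := exists_coords_eq_smul (w := (Pi.single d₁ 1 : Exponent M → ℂ))
    (fun h0 => one_ne_zero (α := ℂ) (by simpa using congrFun h0 d₁))
  have h1 : V ∈ (coordinateSubspace r' : Set (ParamSpace M)) := by
    intro d hd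
    have hne : d ≠ d₁ := by
      rintro rfl
      simp [d₁] at hd
    simp [hV, hne]
  have h2 := hsub h1 d₁ (by simpa [d₁] using h)
  rw [hV, Pi.smul_apply, Pi.single_eq_same, smul_eq_mul, mul_one] at h2
  exact hs h2

theorem le_topologicalKrullDim_paramSpace {k : ℕ} (hk : k < Fintype.card (Exponent M)) :
    (k : WithBot ℕ∞) ≤ topologicalKrullDim (ParamSpace M) := by
  let q : LTSeries (TopologicalSpace.IrreducibleCloseds (ParamSpace M)) :=
    LTSeries.mk k (fun i => ⟨coordinateSubspace i,
      isIrreducible_coordinateSubspace (by omega) i, isClosed_coordinateSubspace i⟩)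
      (fun i j hij => coordinateSubspace_ssubset hij (by omega))
  exact Order.LTSeries.length_le_krullDim q

end Cones

end Hypersurfaces

theorem proposition3 (M : ℕ) (hM : 5 ≤ M) :
    Hypersurfaces.CodimAtLeast (closure (Hypersurfaces.regularLocus M)ᶜ)
      (M * (M - 5) / 2 + 4) := by
  have key := Hypersurfaces.length_add_codim_lt hM
  rw [Hypersurfaces.CodimAtLeast, topologicalKrullDim]
  set c := M * (M - 5) / 2 + 4
  rcases isEmpty_or_nonempty (TopologicalSpace.IrreducibleCloseds
    ↥(closure (Hypersurfaces.regularLocus M)ᶜ)) with h | h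
  · rw [Order.krullDim_eq_bot, WithBot.bot_add]
    exact bot_le
  -- The chain of length zero gives `c + 1 ≤ Fintype.card (Exponent M)`, so the natural subtraction
  -- below is not truncated.
  · have h0 := key (RelSeries.singleton _ h.some)
    have h1 : Order.krullDim (TopologicalSpace.IrreducibleCloseds
        ↥(closure (Hypersurfaces.regularLocus M)ᶜ)) ≤
        ((Fintype.card (Hypersurfaces.Exponent M) - 1 - c : ℕ) : WithBot ℕ∞) := by
      refine iSup_le fun p => ?_
      have h2 := key p
      exact_mod_cast (by omega : p.length ≤ Fintype.card (Hypersurfaces.Exponent M) - 1 - c)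
    refine le_trans (add_le_add_left h1 _) ?_
    refine le_trans ?_ (Hypersurfaces.le_topologicalKrullDim_paramSpace
      (k := Fintype.card (Hypersurfaces.Exponent M) - 1) (by omega))
    exact_mod_cast (by omega : Fintype.card (Hypersurfaces.Exponent M) - 1 - c + c ≤
      Fintype.card (Hypersurfaces.Exponent M) - 1)
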